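/- **Setting.** An episodic two-player zero-sum Markov game has a countable state space $\mathcal S$, a finite action set $\mathcal A$ used by both players, a horizon $H\ge 1$, known rewards $r_h:\mathcal Z\to[-1,1]$ and unknown transition probabilities $\mathbb P_h(\cdot\mid z)$ on $\mathcal S$, where $z=(x,a,b)\in\mathcal Z=\mathcal S\times\mathcal A\times\mathcal A$ and $h=1,\dots,H$. For Markov policies $\pi,\nu$ let $V_h^{\pi,\nu}(x)$ be the expected total reward of the steps $h,\dots,H$ given $x_h=x$ when the players act independently according to $\pi$ and $\nu$, and put $V_h^{*,\nu}=\sup_\pi V_h^{\pi,\nu}$, $V_h^{\pi,*}=\inf_\nu V_h^{\pi,\nu}$. Let $\mathcal H$ be a real Hilbert space with a feature map $\phi(s'\mid z)\in\mathcal H$ such that, for every $V:\mathcal S\to[-1,1]$ and $z\in\mathcal Z$, the sum $\phi_V(z)=\sum_{s'}V(s')\phi(s'\mid z)$ converges and $\|\phi_V(z)\|\le 1$. Put $k_{V_1,V_2}(z_1,z_2)=\sum_{s_1,s_2}V_1(s_1)V_2(s_2)\langle\phi(s_1\mid z_1),\phi(s_2\mid z_2)\rangle$ and $$\Gamma_K(T,\lambda)=\sup_{V_1,\dots,V_T:\mathcal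 S\to[-H,H],\ z_1,\dots,z_T\in\mathcal Z}\tfrac12\log\det\Big(I+\tfrac1\lambda\big[k_{V_p,V_q}(z_p,z_q)\big]_{p,q=1}^T\Big).$$ **Algorithm KernelCCE-VTR** with parameters $\lambda$ and $\beta_t>0$. Put $\overline V_{H+1}^t=\underline V_{H+1}^t=0$. In episode $t=1,\dots,T$, for $h=H,\dots,1$, let $\overline\theta_h^t$ minimize $\sum_{\tau<t}[\overline V_{h+1}^\tau(x_{h+1}^\tau)-\langle\phi_{\overline V_{h+1}^\tau}(z_h^\tau),\theta\rangle]^2+\lambda\|\theta\|^2$ over $\theta\in\mathcal H$, let $$\overline{\mathcal C}_h^t=\Big\{\theta:\ \big(\lambda\|\theta-\overline\theta_h^t\|^2+\textstyle\sum_{\tau<t}\langle\phi_{\overline V_{h+1}^\tau}(z_h^\tau),\theta-\overline\theta_h^t\rangle^2\big)^{1/2}\le\beta_t\Big\},$$ and let $\overline Q_h^t(z)$ be the projection of $r_h(z)+\max_{\theta\in\overline{\mathcal C}_h^t}\langle\phi_{\overline V_{h+1}^t}(z),\theta\rangle$ onto $[-H,H]$; define $\underline Q_h^t$ in the same way from $\underline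 V$, with $\min$ in place of $\max$. For each $x$ let $\sigma_h^t(x)$ be the coarse correlated equilibrium of $(\overline Q_h^t,\underline Q_h^t)$ at $x$ returned by a fixed subroutine, i.e. a distribution on $\mathcal A\times\mathcal A$ with $\mathbb E_{\sigma}\overline Q_h^t(x,a,b)\ge\mathbb E_{\sigma}\overline Q_h^t(x,a',b)$ and $\mathbb E_{\sigma}\underline Q_h^t(x,a,b)\le\mathbb E_{\sigma}\underline Q_h^t(x,a,b')$ for all $a',b'\in\mathcal A$, and let $\overline V_h^t(x),\underline V_h^t(x)$ be the expectations of $\overline Q_h^t(x,\cdot),\underline Q_h^t(x,\cdot)$ under $\sigma_h^t(x)$. The initial state $x_1^t$ is arbitrary (possibly dependent on the past); then, for $h=1,\dots,H$, $(a_h^t,b_h^t)\sim\sigma_h^t(x_h^t)$, $z_h^t=(x_h^t,a_h^t,b_h^t)$ and $x_{h+1}^t\sim\mathbb P_h(\cdot\mid z_h^t)$. Let $\pi^t,\nu^t$ be the policies given by the first and second marginals of $\sigma_h^t$, and $$\mathrm{Regret}(T)=\sum_{t=1}^T\big(V_1^{*,\nu^t}(x_1^t)-V_1^{\pi^t,*}(x_1^t)\big).$$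 **Theorem (RKHS function approximation with misspecification).** There is a universal constant $c>0$ such that the following holds for every such game, Hilbert space, feature map and equilibrium subroutine, and all $T\ge1$, $\delta>0$, $B\in\mathbb R$, $\iota_{\mathrm{mis}}>0$. Assume that there are $\theta_1^*,\dots,\theta_H^*\in\mathcal H$ with $\|\theta_h^*\|\le B$ and $$\big\|\mathbb P_h(\cdot\mid z)-\langle\phi(\cdot\mid z),\theta_h^*\rangle\big\|_{\mathrm{TV}}:=\sum_{s'\in\mathcal S}\big|\mathbb P_h(s'\mid z)-\langle\phi(s'\mid z),\theta_h^*\rangle\big|\le\iota_{\mathrm{mis}}\qquad(1\le h\le H,\ z\in\mathcal Z).$$ Let $\lambda=1+1/T$, and let $\beta_1,\dots,\beta_T>0$ be such that, for every $t\le T$, $\beta_t\le\beta_T$ and $$\Big(\frac{\beta_t}{H}\Big)^2\ \ge\ 12\,\Gamma_K(T,\lambda)+3+6\log\frac1\delta+3\lambda\Big(\frac BH\Big)^2+3\,\iota_{\mathrm{mis}}^2\,t .$$ Then, with probability at least $1-\delta$, KernelCCE-VTR satisfies $$\mathrm{Regret}(T)\ \le\ c\Big(\beta_T H\sqrt{T\,\Gamma_K(T,\lambda)}+1+H^2\,T\,\iota_{\mathrm{mis}}\Big).$$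 -/

import Mathlib

open scoped BigOperators

noncomputable section

namespace KernelMG

/-- Expectation `E_{i ∼ p}[f i]` of a real function under a discrete distribution. -/
def expect {α : Type*} (p : PMF α) (f : α → ℝ) : ℝ :=
  ∑' i, (p i).toReal * f i

/-- An episodic two-player zero-sum simultaneous-move Markov game with state space `S` and common
action set `A`.  Steps are numbered `1, …, H`; only those indices of `r` and `P` are ever used.
A state-action triplet is `z = (x, a, b) : S × A × A`. -/
structure MarkovGame (S A : Type*) where
  /-- the horizon -/
  H : ℕ
  one_le_H : 1 ≤ H
  /-- the (known) rewards `r_h(x, a, b)`, paid by the second player to the first -/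
  r : ℕ → S × A × A → ℝ
  r_mem : ∀ h ∈ Finset.Icc 1 H, ∀ z, r h z ∈ Set.Icc (-1 : ℝ) 1
  /-- the (unknown) transition probabilities `P_h(· | x, a, b)` -/
  P : ℕ → S × A × A → PMF S

/-- A stochastic Markov policy `(h, x) ↦ π_h(· | x)` of one player. -/
abbrev Policy (S A : Type*) := ℕ → S → PMF A

section Game

variable {S A : Type*}

/-- Law of `(z_h, …, z_{h+k-1})` when the state at step `h` is `x` and the players act
independently according to `π` and `ν`. -/
def MarkovGame.playLaw (G : MarkovGame S A) (π ν : Policy S A) :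
    ℕ → ℕ → S → PMF (List (S × A × A))
  | _, 0, _ => PMF.pure []
  | h, k + 1, x =>
      (π h x).bind fun a => (ν h x).bind fun b => (G.P h (x, a, b)).bind fun x' =>
        (G.playLaw π ν (h + 1) k x').map fun l => (x, a, b) :: l

/-- Total reward of a play that starts at step `h`. -/
def MarkovGame.totalReward (G : MarkovGame S A) : ℕ → List (S × A × A) → ℝ
  | _, [] => 0
  | h, z :: l => G.r h z + G.totalReward (h + 1) l

/-- `V_h^{π,ν}(x)`: expected total reward collected at the steps `h, …, H`, given `x_h = x`. -/
def MarkovGame.value (G : MarkovGame S A) (π ν : Policy S A) (h : ℕ) (x : S) : ℝ :=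
  expect (G.playLaw π ν h (G.H + 1 - h) x) (G.totalReward h)

/-- `V_h^{*,ν}(x)`: value when the first player best-responds to `ν`. -/
def MarkovGame.valueMax (G : MarkovGame S A) (ν : Policy S A) (h : ℕ) (x : S) : ℝ :=
  ⨆ π : Policy S A, G.value π ν h x

/-- `V_h^{π,*}(x)`: value when the second player best-responds to `π`. -/
def MarkovGame.valueMin (G : MarkovGame S A) (π : Policy S A) (h : ℕ) (x : S) : ℝ :=
  ⨅ ν : Policy S A, G.value π ν h x

/-- `σ` is a coarse correlated equilibrium at the state `x` for the payoffs `Q₁` (of the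
maximizing first player) and `Q₂` (of the minimizing second player). -/
def IsCCE (Q₁ Q₂ : S × A × A → ℝ) (x : S) (σ : PMF (A × A)) : Prop :=
  (∀ a' : A, expect (σ.map Prod.snd) (fun b => Q₁ (x, a', b)) ≤
      expect σ (fun p => Q₁ (x, p.1, p.2))) ∧
  (∀ b' : A, expect σ (fun p => Q₂ (x, p.1, p.2)) ≤
      expect (σ.map Prod.fst) (fun a => Q₂ (x, a, b')))

/-- The subroutine `FIND_CCE`: a rule that returns a coarse correlated equilibrium for every
pair of payoffs and every state (no assumption on how it picks one of them). -/
structure CCESolver (S A : Type*) where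
  find : (S × A × A → ℝ) → (S × A × A → ℝ) → S → PMF (A × A)
  isCCE : ∀ Q₁ Q₂ x, IsCCE Q₁ Q₂ x (find Q₁ Q₂ x)

end Game

section Features

variable {S A E : Type*} [NormedAddCommGroup E] [InnerProductSpace ℝ E]

/-- `φ_V(z) = ∑_{s'} V(s') φ(s' | z)`, where `φ s' z` stands for `φ(s' | z)`. -/
def featureOf (φ : S → S × A × A → E) (V : S → ℝ) (z : S × A × A) : E :=
  ∑' s, V s • φ s z

/-- For every `V : S → [-1, 1]` and every `z`, `φ_V(z)` is well defined and `‖φ_V(z)‖ ≤ 1`. -/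
def BoundedFeatures (φ : S → S × A × A → E) : Prop :=
  ∀ V : S → ℝ, (∀ s, V s ∈ Set.Icc (-1 : ℝ) 1) → ∀ z,
    Summable (fun s => V s • φ s z) ∧ ‖featureOf φ V z‖ ≤ 1

/-- The weighted kernel function
`k_{V₁,V₂}(z₁, z₂) = ∑_{s₁,s₂} V₁(s₁) V₂(s₂) ⟨φ(s₁ | z₁), φ(s₂ | z₂)⟩`. -/
def weightedKernel (φ : S → S × A × A → E) (V₁ V₂ : S → ℝ) (z₁ z₂ : S × A × A) : ℝ :=
  ∑' s₁, ∑' s₂, V₁ s₁ * V₂ s₂ * inner ℝ (φ s₁ z₁) (φ s₂ z₂)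

/-- The matrix `K({V_i}, {z_i})`. -/
def kernelMatrix (φ : S → S × A × A → E) {T : ℕ} (V : Fin T → S → ℝ) (z : Fin T → S × A × A) :
    Matrix (Fin T) (Fin T) ℝ :=
  Matrix.of fun p q => weightedKernel φ (V p) (V q) (z p) (z q)

/-- The effective dimension (maximal information gain) `Γ_K(T, lam)`, the supremum over
`V_i : S → [-H, H]` and `z_i` of `(1/2) log det (I + K({V_i}, {z_i}) / lam)`. -/
def effDim (φ : S → S × A × A → E) (H T : ℕ) (lam : ℝ) : ℝ :=
  sSup {g : ℝ | ∃ (V : Fin T → S → ℝ) (z : Fin T → S × A × A),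
    (∀ i s, V i s ∈ Set.Icc (-(H : ℝ)) H) ∧
    g = 1 / 2 * Real.log (1 + lam⁻¹ • kernelMatrix φ V z).det}

/-- Total variation norm `‖P_h(· | z) - ⟨φ(· | z), θ⟩‖_TV`, that is, the total mass of the
absolute value of this signed measure on the discrete space `S`. -/
def MarkovGame.tvError (G : MarkovGame S A) (φ : S → S × A × A → E) (h : ℕ) (θ : E)
    (z : S × A × A) : ℝ :=
  ∑' s, |(G.P h z s).toReal - inner ℝ (φ s z) θ|

/-- The misspecified model with parameters `θ_1, …, θ_H`, norm bound `B` and error `ι`. -/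
def MarkovGame.Misspecified (G : MarkovGame S A) (φ : S → S × A × A → E) (θ : ℕ → E)
    (B ι : ℝ) : Prop :=
  ∀ h ∈ Finset.Icc 1 G.H, ‖θ h‖ ≤ B ∧ ∀ z, G.tvError φ h (θ h) z ≤ ι

end Features

/-- Everything observed in the episodes `t = 1, 2, …`: the states `x_h^t` and the pairs of
actions `(a_h^t, b_h^t)`. -/
structure Data (S A : Type*) where
  state : ℕ → ℕ → S
  act : ℕ → ℕ → A × A

/-- `z_h^t = (x_h^t, a_h^t, b_h^t)`. -/
def Data.z {S A : Type*} (D : Data S A) (t h : ℕ) : S × A × A := (D.state t h, D.act t h)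

section Algorithm

variable {S A E : Type*} [NormedAddCommGroup E] [InnerProductSpace ℝ E]

/-- Projection of `v` onto `[-H, H]`. -/
def clip (H : ℕ) (v : ℝ) : ℝ := max (-(H : ℝ)) (min (H : ℝ) v)

/-- The ridge regression objective of episode `t` at step `h`; `V τ` is the estimate
`V_{h+1}^τ` of the value function at step `h + 1` in episode `τ`. -/
def ridgeLoss (φ : S → S × A × A → E) (lam : ℝ) (D : Data S A) (h : ℕ) (V : ℕ → S → ℝ) (t : ℕ)
    (θ : E) : ℝ :=
  ∑ τ ∈ Finset.Icc 1 (t - 1),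
      (V τ (D.state τ (h + 1)) - inner ℝ (featureOf φ (V τ) (D.z τ h)) θ) ^ 2
    + lam * ‖θ‖ ^ 2

/-- The (for `lam > 0` unique) minimizer of the ridge regression objective. -/
def ridge (φ : S → S × A × A → E) (lam : ℝ) (D : Data S A) (h : ℕ) (V : ℕ → S → ℝ) (t : ℕ) : E :=
  Classical.epsilon fun θ : E => ∀ θ' : E, ridgeLoss φ lam D h V t θ ≤ ridgeLoss φ lam D h V t θ'

/-- The confidence region of radius `b` around the ridge regression solution. -/
def confRegion (φ : S → S × A × A → E) (lam : ℝ) (D : Data S A) (h : ℕ) (V : ℕ → S → ℝ) (t : ℕ)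
    (b : ℝ) : Set E :=
  {θ | Real.sqrt (lam * ‖θ - ridge φ lam D h V t‖ ^ 2 +
      ∑ τ ∈ Finset.Icc 1 (t - 1),
        (inner ℝ (featureOf φ (V τ) (D.z τ h)) (θ - ridge φ lam D h V t)) ^ 2) ≤ b}

/-- The optimistic action-value estimate
`Π_{[-H,H]} [r_h(z) + max_{θ ∈ C} ⟨φ_{V_{h+1}^t}(z), θ⟩]`. -/
def upperQ (G : MarkovGame S A) (φ : S → S × A × A → E) (lam : ℝ) (β : ℕ → ℝ) (D : Data S A)
    (h : ℕ) (V : ℕ → S → ℝ) (t : ℕ) (z : S × A × A) : ℝ :=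
  clip G.H (G.r h z +
    sSup ((fun θ => inner ℝ (featureOf φ (V t) z) θ) '' confRegion φ lam D h V t (β t)))

/-- The pessimistic action-value estimate, with `min` in place of `max`. -/
def lowerQ (G : MarkovGame S A) (φ : S → S × A × A → E) (lam : ℝ) (β : ℕ → ℝ) (D : Data S A)
    (h : ℕ) (V : ℕ → S → ℝ) (t : ℕ) (z : S × A × A) : ℝ :=
  clip G.H (G.r h z +
    sInf ((fun θ => inner ℝ (featureOf φ (V t) z) θ) '' confRegion φ lam D h V t (β t)))

/-- The optimistic and pessimistic value estimates of KernelCCE-VTR at the step with `k` steps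
to go (step `h = H + 1 - k`), for all episodes `t`.  They vanish at step `H + 1`; at step
`h = H - k` they are the expectations of the two action-value estimates under the coarse
correlated equilibrium returned by `FIND_CCE`.  The value in episode `t` only involves the
data of the episodes `1, …, t - 1`. -/
def valueEst (G : MarkovGame S A) (cce : CCESolver S A) (φ : S → S × A × A → E) (lam : ℝ)
    (β : ℕ → ℝ) (D : Data S A) : ℕ → ℕ → (S → ℝ) × (S → ℝ)
  | 0, _ => (fun _ => 0, fun _ => 0)
  | k + 1, t =>
      let next := valueEst G cce φ lam β D k
      let Qu := upperQ G φ lam β D (G.H - k) (fun τ => (next τ).1) t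
      let Ql := lowerQ G φ lam β D (G.H - k) (fun τ => (next τ).2) t
      (fun x => expect (cce.find Qu Ql x) (fun p => Qu (x, p.1, p.2)),
       fun x => expect (cce.find Qu Ql x) (fun p => Ql (x, p.1, p.2)))

/-- The joint distribution `σ_h^t(x) = FIND_CCE(Qupper_h^t, Qlower_h^t, x)` from which
KernelCCE-VTR draws the two actions at step `h` of episode `t` in state `x`. -/
def jointPolicy (G : MarkovGame S A) (cce : CCESolver S A) (φ : S → S × A × A → E) (lam : ℝ)
    (β : ℕ → ℝ) (D : Data S A) (t h : ℕ) (x : S) : PMF (A × A) :=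
  cce.find
    (upperQ G φ lam β D h (fun τ => (valueEst G cce φ lam β D (G.H - h) τ).1) t)
    (lowerQ G φ lam β D h (fun τ => (valueEst G cce φ lam β D (G.H - h) τ).2) t) x

/-- The policy `π^t` of the first player: the first marginals of `σ_h^t`. -/
def policyOne (G : MarkovGame S A) (cce : CCESolver S A) (φ : S → S × A × A → E) (lam : ℝ)
    (β : ℕ → ℝ) (D : Data S A) (t : ℕ) : Policy S A :=
  fun h x => (jointPolicy G cce φ lam β D t h x).map Prod.fst

/-- The policy `ν^t` of the second player: the second marginals of `σ_h^t`. -/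
def policyTwo (G : MarkovGame S A) (cce : CCESolver S A) (φ : S → S × A × A → E) (lam : ℝ)
    (β : ℕ → ℝ) (D : Data S A) (t : ℕ) : Policy S A :=
  fun h x => (jointPolicy G cce φ lam β D t h x).map Prod.snd

/-- `Regret(T) = ∑_{t=1}^T (V_1^{*,ν^t}(x_1^t) - V_1^{π^t,*}(x_1^t))`. -/
def regret (G : MarkovGame S A) (cce : CCESolver S A) (φ : S → S × A × A → E) (lam : ℝ)
    (β : ℕ → ℝ) (D : Data S A) (T : ℕ) : ℝ :=
  ∑ t ∈ Finset.Icc 1 T,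
    (G.valueMax (policyTwo G cce φ lam β D t) 1 (D.state t 1) -
      G.valueMin (policyOne G cce φ lam β D t) 1 (D.state t 1))

/-- `D` and `D'` agree on what is known when the state of step `h` in episode `t` has been
observed and the actions of that step have not been drawn yet (horizon `H`). -/
def AgreeBeforeAction (H t h : ℕ) (D D' : Data S A) : Prop :=
  (∀ τ ∈ Finset.Icc 1 (t - 1), ∀ j ∈ Finset.Icc 1 (H + 1), D.state τ j = D'.state τ j) ∧
  (∀ τ ∈ Finset.Icc 1 (t - 1), ∀ j ∈ Finset.Icc 1 H, D.act τ j = D'.act τ j) ∧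
  (∀ j ∈ Finset.Icc 1 h, D.state t j = D'.state t j) ∧
  (∀ j ∈ Finset.Icc 1 (h - 1), D.act t j = D'.act t j)

/-- The random data `D` on the probability space `(Ω, μ)` are produced by `T` episodes of
KernelCCE-VTR on the game `G`: for every possible past `d`, the actions of step `h` of episode
`t` have conditional distribution `σ_h^t(x_h^t)`, and given the past and these actions the next
state has distribution `P_h(· | z_h^t)`.  The initial states `x_1^t` are arbitrary; they may be
random and may depend on the previous episodes. -/
structure IsRun {Ω : Type*} [MeasurableSpace Ω] (μ : MeasureTheory.Measure Ω)
    (G : MarkovGame S A) (cce : CCESolver S A) (φ : S → S × A × A → E) (lam : ℝ)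
    (β : ℕ → ℝ) (T : ℕ) (D : Ω → Data S A) : Prop where
  measurable_state : ∀ t h x, MeasurableSet {ω | (D ω).state t h = x}
  measurable_act : ∀ t h p, MeasurableSet {ω | (D ω).act t h = p}
  act_law : ∀ t ∈ Finset.Icc 1 T, ∀ h ∈ Finset.Icc 1 G.H, ∀ (d : Data S A) (p : A × A),
    μ {ω | AgreeBeforeAction G.H t h (D ω) d ∧ (D ω).act t h = p} =
      μ {ω | AgreeBeforeAction G.H t h (D ω) d} *
        jointPolicy G cce φ lam β d t h (d.state t h) p
  state_law : ∀ t ∈ Finset.Icc 1 T, ∀ h ∈ Finset.Icc 1 G.H, ∀ (d : Data S A) (x' : S),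
    μ {ω | (AgreeBeforeAction G.H t h (D ω) d ∧ (D ω).act t h = d.act t h) ∧
        (D ω).state t (h + 1) = x'} =
      μ {ω | AgreeBeforeAction G.H t h (D ω) d ∧ (D ω).act t h = d.act t h} *
        G.P h (d.z t h) x'

end Algorithm

end KernelMG

end

/-! The proof is optimism plus a self-normalized concentration bound. Suppose every true parameter
lies in both of its confidence regions. By backward induction the upper estimate then dominates
every value against `ν^t`, and the lower estimate is dominated by every value against `π^t`, up to a
bias `H ι` per step. The coarse correlated equilibrium inequalities are exactly what this needs,
since a best response is a unilateral deviation from the joint law (`value_le_valueEst`,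
`valueEst_le_value`). The regret is thus at most the sum of the gaps between the two estimates.
Along the trajectory actually played, each gap telescopes into martingale differences, bias and
confidence widths (`valueGap_step`). Azuma–Hoeffding controls the first, and the elliptical
potential argument with Cauchy–Schwarz the last (`sum_width_le`).

Coverage rests on a mixture martingale in the Hilbert space. The inverse of the design operator is
built by rank-one updates, and the product of the factors `1 + potential` is the determinant of the
regularized Gram matrix (`det_regGram`), hence at most `exp (2 Γ)`. Averaging Hoeffding's bound over
a Gaussian, one episode at a time, gives factors of conditional mean at most 1. Their product is
`exp ((‖S_n‖² - log det) / 2)`, where `S_n` is the noise sum measured in the dual norm; Ville's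
inequality bounds it for all `n` at once. The ridge error then splits into regularization, noise and
misspecification (`energy_sub_ridge_le`).

A union bound over three events at each of the `H` steps costs `log (3 H)`, which does not appear in
the condition on `β`. A case distinction supplies it. If `ι ≥ 1/4` or `T ≤ 25 β_T² Γ`, the trivial
regret bound `2 H T` is already below the claim. Otherwise `T > 75 B² Γ`. Since transition
probabilities have mass one, the feature of the constant function 1 cannot be short compared with `1
/ B`, and repeating it `T` times forces `Γ ≥ 1/2` and `Γ ≥ log (3 H)` (`log_le_effDim`). The
coefficient 12 of `Γ` then pays for both the determinant and the union bound. -/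

namespace KernelMG

/-! ### Discrete expectations, Hoeffding's lemma and Gaussian mixing -/

section Expect

variable {α γ : Type*}

theorem hasSum_pmf_toReal (p : PMF α) : HasSum (fun i => (p i).toReal) 1 := by
  have h := (ENNReal.hasSum_toReal (f := fun i => p i) p.tsum_coe_ne_top)
  rwa [← ENNReal.tsum_toReal_eq (fun i => p.apply_ne_top i), p.tsum_coe, ENNReal.toReal_one] at h

/-- The bound is asked only on the support because the total reward is controlled only on lists that
a play can produce. -/
theorem expect_summable {p : PMF α} {f : α → ℝ} {C : ℝ} (h : ∀ i, p i ≠ 0 → |f i| ≤ C) :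
    Summable fun i => (p i).toReal * f i := by
  refine Summable.of_norm_bounded ((hasSum_pmf_toReal p).summable.mul_right C) fun i => ?_
  rw [Real.norm_eq_abs, abs_mul, abs_of_nonneg ENNReal.toReal_nonneg]
  by_cases hi : p i = 0
  · simp [hi]
  · exact mul_le_mul_of_nonneg_left (h i hi) ENNReal.toReal_nonneg

theorem expect_congr {p : PMF α} {f g : α → ℝ} (h : ∀ i, p i ≠ 0 → f i = g i) :
    expect p f = expect p g := by
  refine tsum_congr fun i => ?_
  by_cases hi : p i = 0
  · simp [hi]
  · rw [h i hi]

theorem expect_const (p : PMF α) (c : ℝ) : expect p (fun _ => c) = c := by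
  simp [expect, tsum_mul_right, (hasSum_pmf_toReal p).tsum_eq]

theorem expect_mono {p : PMF α} {f g : α → ℝ} {C D : ℝ} (hf : ∀ i, |f i| ≤ C)
    (hg : ∀ i, |g i| ≤ D) (h : ∀ i, f i ≤ g i) : expect p f ≤ expect p g :=
  Summable.tsum_le_tsum (fun i => mul_le_mul_of_nonneg_left (h i) ENNReal.toReal_nonneg)
    (expect_summable fun i _ => hf i) (expect_summable fun i _ => hg i)

theorem expect_add {p : PMF α} {f g : α → ℝ} {C D : ℝ} (hf : ∀ i, |f i| ≤ C)
    (hg : ∀ i, |g i| ≤ D) : expect p (fun i => f i + g i) = expect p f + expect p g := by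
  simp only [expect, mul_add]
  exact (expect_summable fun i _ => hf i).tsum_add (expect_summable fun i _ => hg i)

theorem expect_sub {p : PMF α} {f g : α → ℝ} {C D : ℝ} (hf : ∀ i, |f i| ≤ C)
    (hg : ∀ i, |g i| ≤ D) : expect p (fun i => f i - g i) = expect p f - expect p g := by
  simp only [expect, mul_sub]
  exact (expect_summable fun i _ => hf i).tsum_sub (expect_summable fun i _ => hg i)

theorem expect_add_const {p : PMF α} {f : α → ℝ} {C : ℝ} (hf : ∀ i, |f i| ≤ C) (c : ℝ) :
    expect p (fun i => f i + c) = expect p f + c := by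
  rw [expect_add hf (fun _ => le_rfl), expect_const]

theorem expect_const_add {p : PMF α} {f : α → ℝ} {C : ℝ} (hf : ∀ i, p i ≠ 0 → |f i| ≤ C) (c : ℝ) :
    expect p (fun i => c + f i) = c + expect p f := by
  have h : Summable fun i => (p i).toReal * c := (hasSum_pmf_toReal p).summable.mul_right c
  simp only [expect, mul_add]
  rw [h.tsum_add (expect_summable hf), tsum_mul_right, (hasSum_pmf_toReal p).tsum_eq, one_mul]

theorem abs_expect_le {p : PMF α} {f : α → ℝ} {C : ℝ} (hf : ∀ i, p i ≠ 0 → |f i| ≤ C) :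
    |expect p f| ≤ C := by
  have hs := expect_summable hf
  have h1 : |expect p f| ≤ ∑' i, |(p i).toReal * f i| := by
    simpa [expect, Real.norm_eq_abs] using norm_tsum_le_tsum_norm hs.norm
  refine h1.trans ?_
  have h2 : ∑' i, (p i).toReal * C = C := by
    rw [tsum_mul_right, (hasSum_pmf_toReal p).tsum_eq, one_mul]
  rw [← h2]
  refine Summable.tsum_le_tsum (fun i => ?_) hs.abs ((hasSum_pmf_toReal p).summable.mul_right C)
  rw [abs_mul, abs_of_nonneg ENNReal.toReal_nonneg]
  by_cases hi : p i = 0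
  · simp [hi]
  · exact mul_le_mul_of_nonneg_left (hf i hi) ENNReal.toReal_nonneg

theorem expect_mem_Icc {p : PMF α} {f : α → ℝ} {a b : ℝ} (hf : ∀ i, f i ∈ Set.Icc a b) :
    expect p f ∈ Set.Icc a b := by
  have hC : ∀ i, |f i| ≤ max |a| |b| := fun i => abs_le_max_abs_abs (hf i).1 (hf i).2
  constructor
  · rw [← expect_const p a]
    exact expect_mono (fun _ => le_rfl) hC fun i => (hf i).1
  · rw [← expect_const p b]
    exact expect_mono hC (fun _ => le_rfl) fun i => (hf i).2

theorem expect_bind (p : PMF α) (q : α → PMF γ) {f : γ → ℝ} {C : ℝ}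
    (hf : ∀ a, p a ≠ 0 → ∀ b, q a b ≠ 0 → |f b| ≤ C) :
    expect (p.bind q) f = expect p fun a => expect (q a) f := by
  have hpq : Summable fun ab : α × γ => (p ab.1).toReal * (q ab.1 ab.2).toReal := by
    have h0 : 0 ≤ fun ab : α × γ => (p ab.1).toReal * (q ab.1 ab.2).toReal := fun _ =>
      mul_nonneg ENNReal.toReal_nonneg ENNReal.toReal_nonneg
    have h1 : ∀ a, HasSum (fun b => (p a).toReal * (q a b).toReal) (p a).toReal := fun a => by
      simpa only [mul_one] using (hasSum_pmf_toReal (q a)).mul_left (p a).toReal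
    rw [summable_prod_of_nonneg h0]
    refine ⟨fun a => (h1 a).summable, ?_⟩
    simp only [(h1 _).tsum_eq]
    exact (hasSum_pmf_toReal p).summable
  have hF : Summable fun ab : α × γ => (p ab.1).toReal * ((q ab.1 ab.2).toReal * f ab.2) := by
    refine Summable.of_norm_bounded (hpq.mul_right C) fun ab => ?_
    rw [Real.norm_eq_abs, ← mul_assoc, abs_mul,
      abs_of_nonneg (mul_nonneg ENNReal.toReal_nonneg ENNReal.toReal_nonneg)]
    by_cases ha : p ab.1 = 0
    · simp [ha]
    by_cases hb : q ab.1 ab.2 = 0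
    · simp [hb]
    exact mul_le_mul_of_nonneg_left (hf _ ha _ hb)
      (mul_nonneg ENNReal.toReal_nonneg ENNReal.toReal_nonneg)
  calc expect (p.bind q) f
      = ∑' b, ∑' a, (p a).toReal * ((q a b).toReal * f b) := by
        refine tsum_congr fun b => ?_
        rw [PMF.bind_apply, ENNReal.tsum_toReal_eq fun a =>
          ENNReal.mul_ne_top (p.apply_ne_top a) ((q a).apply_ne_top b), ← tsum_mul_right]
        exact tsum_congr fun a => by rw [ENNReal.toReal_mul, mul_assoc]
    _ = ∑' a, ∑' b, (p a).toReal * ((q a b).toReal * f b) := hF.tsum_comm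
    _ = _ := tsum_congr fun a => by rw [tsum_mul_left]; rfl

theorem expect_pure (a : α) (f : α → ℝ) : expect (PMF.pure a) f = f a := by
  rw [expect, tsum_eq_single a]
  · simp
  · intro b hb
    simp [PMF.pure_apply, hb]

theorem expect_map (p : PMF α) (g : α → γ) {f : γ → ℝ} {C : ℝ}
    (hf : ∀ a, p a ≠ 0 → |f (g a)| ≤ C) : expect (p.map g) f = expect p fun a => f (g a) := by
  rw [← PMF.bind_pure_comp, expect_bind (C := C)]
  · simp only [Function.comp_apply, expect_pure]
  · intro a ha b hb
    simp only [Function.comp_apply, PMF.pure_apply, ne_eq, ite_eq_right_iff, one_ne_zero,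
      imp_false, not_not] at hb
    rw [hb]
    exact hf a ha

/-- Hoeffding's lemma for a discrete distribution. -/
theorem tsum_exp_centered_le (p : PMF α) {f : α → ℝ} {a b : ℝ} (hf : ∀ i, f i ∈ Set.Icc a b)
    (t : ℝ) : ∑' i, p i * ENNReal.ofReal (Real.exp (t * (f i - expect p f))) ≤
      ENNReal.ofReal (Real.exp (((b - a) / 2) ^ 2 * t ^ 2 / 2)) := by
  let _ : MeasurableSpace α := ⊤
  have hm : Measurable f := measurable_from_top
  have hbdd : ∀ i, |f i| ≤ max |a| |b| := fun i => abs_le_max_abs_abs (hf i).1 (hf i).2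
  have hint : MeasureTheory.Integrable f p.toMeasure :=
    MeasureTheory.Integrable.of_mem_Icc a b hm.aemeasurable (Filter.Eventually.of_forall hf)
  have hE : ∫ i, f i ∂p.toMeasure = expect p f := PMF.integral_eq_tsum p f hint
  have hsub := ProbabilityTheory.hasSubgaussianMGF_of_mem_Icc (μ := p.toMeasure) hm.aemeasurable
    (Filter.Eventually.of_forall hf)
  have hmgf := hsub.mgf_le t
  have hi := hsub.integrable_exp_mul t
  rw [hE] at hmgf hi
  have h1 : ProbabilityTheory.mgf (fun ω => f ω - expect p f) p.toMeasure t =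
      expect p fun i => Real.exp (t * (f i - expect p f)) := PMF.integral_eq_tsum p _ hi
  rw [h1] at hmgf
  have hC : ∀ i, |Real.exp (t * (f i - expect p f))| ≤
      Real.exp (|t| * (max |a| |b| + |expect p f|)) := fun i => by
    rw [Real.abs_exp, Real.exp_le_exp]
    refine (le_abs_self _).trans ?_
    rw [abs_mul]
    refine mul_le_mul_of_nonneg_left ((abs_sub _ _).trans ?_) (abs_nonneg _)
    linarith [hbdd i]
  have h2 : ∑' i, p i * ENNReal.ofReal (Real.exp (t * (f i - expect p f))) =
      ENNReal.ofReal (expect p fun i => Real.exp (t * (f i - expect p f))) := by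
    refine Eq.trans (tsum_congr fun i => ?_) (ENNReal.ofReal_tsum_of_nonneg
      (fun i => mul_nonneg ENNReal.toReal_nonneg (Real.exp_pos _).le)
      (expect_summable fun i _ => hC i)).symm
    rw [ENNReal.ofReal_mul ENNReal.toReal_nonneg, ENNReal.ofReal_toReal (p.apply_ne_top i)]
  rw [h2]
  refine ENNReal.ofReal_le_ofReal (hmgf.trans_eq ?_)
  simp [div_pow]

/-- Completing the square: for `w > 0`, the density of `N(u, w)` times the integrand is a constant
times the density of `N((u + e w) / (1 + w), w / (1 + w))`. In the application `e` is a normalized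
noise, `u` pairs the past noise sum with the new feature through the resolvent, and `w` is the
potential of that feature. -/
theorem lintegral_gaussianReal_exp (u : ℝ) (w : NNReal) (e : ℝ) :
    ∫⁻ g, ENNReal.ofReal (Real.exp (e * g - g ^ 2 / 2)) ∂(ProbabilityTheory.gaussianReal u w) =
      ENNReal.ofReal (Real.exp ((2 * e * u + e ^ 2 * w - u ^ 2) / (2 * (1 + w))) /
        Real.sqrt (1 + w)) := by
  by_cases hw : w = 0
  · subst hw
    rw [ProbabilityTheory.gaussianReal_zero_var, MeasureTheory.lintegral_dirac' _ (by fun_prop)]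
    simp
    congr 2
    ring
  have hw' : (0 : ℝ) < w := by positivity
  rw [ProbabilityTheory.gaussianReal_of_var_ne_zero _ hw,
    MeasureTheory.lintegral_withDensity_eq_lintegral_mul _
      (ProbabilityTheory.measurable_gaussianPDF _ _) (by fun_prop)]
  set v : NNReal := w / (1 + w) with hv
  have hv0 : v ≠ 0 := by positivity
  have hvr : (v : ℝ) = w / (1 + w) := by simp [hv]
  set K : ℝ := Real.exp ((2 * e * u + e ^ 2 * w - u ^ 2) / (2 * (1 + w))) / Real.sqrt (1 + w)
  have key : ∀ g, ((ProbabilityTheory.gaussianPDF u w) *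
      fun g => ENNReal.ofReal (Real.exp (e * g - g ^ 2 / 2))) g =
      ENNReal.ofReal K * ProbabilityTheory.gaussianPDF ((u + e * w) / (1 + w)) v g := by
    intro g
    simp only [Pi.mul_apply, ProbabilityTheory.gaussianPDF]
    rw [← ENNReal.ofReal_mul (ProbabilityTheory.gaussianPDFReal_nonneg _ _ _),
      ← ENNReal.ofReal_mul (by positivity)]
    congr 1
    simp only [ProbabilityTheory.gaussianPDFReal, K]
    rw [hvr, ← mul_div_assoc, Real.sqrt_div' _ (by positivity)]
    have h1 : Real.sqrt (1 + (w : ℝ)) ≠ 0 := by positivity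
    have h2 : Real.sqrt (2 * Real.pi * w) ≠ 0 := by positivity
    have h3 : Real.exp (-(g - u) ^ 2 / (2 * w)) * Real.exp (e * g - g ^ 2 / 2) =
        Real.exp ((2 * e * u + e ^ 2 * w - u ^ 2) / (2 * (1 + w))) *
        Real.exp (-(g - (u + e * w) / (1 + w)) ^ 2 / (2 * w / (1 + w))) := by
      rw [← Real.exp_add, ← Real.exp_add]
      congr 1
      field_simp
      ring
    rw [mul_assoc, h3]
    field_simp
  rw [MeasureTheory.lintegral_congr key, MeasureTheory.lintegral_const_mul _
    (ProbabilityTheory.measurable_gaussianPDF _ _),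
    ProbabilityTheory.lintegral_gaussianPDF_eq_one _ hv0, mul_one]

/-- One step of the self-normalized exponential supermartingale, for a noise variable whose
range has length `2 * c`. -/
theorem tsum_selfNormalized_le_one (p : PMF α) {f : α → ℝ} {c : ℝ} (hc : 0 < c)
    (hf : ∀ i, f i ∈ Set.Icc (-c) c) (u : ℝ) {w : ℝ} (hw : 0 ≤ w) :
    ∑' i, p i * ENNReal.ofReal (Real.exp ((2 * ((f i - expect p f) / c) * u +
      ((f i - expect p f) / c) ^ 2 * w - u ^ 2) / (2 * (1 + w))) / Real.sqrt (1 + w)) ≤ 1 := by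
  lift w to NNReal using hw
  have hcount : Function.support p |>.Countable := p.support_countable
  simp_rw [← lintegral_gaussianReal_exp]
  -- Exchanging sum and integral needs a countable index; `α` is arbitrary, but the support of a
  -- `PMF` is countable.
  have hsupp : ∀ F : α → ENNReal, ∑' i, p i * F i = ∑' i : p.support, p i * F i := fun F => by
    refine (tsum_subtype_eq_of_support_subset ?_).symm
    intro i hi h0
    exact hi (by simp [h0])
  rw [hsupp]
  have : Countable p.support := hcount.to_subtype
  simp_rw [← MeasureTheory.lintegral_const_mul' _ _ (p.apply_ne_top _)]
  rw [← MeasureTheory.lintegral_tsum (fun i => by fun_prop)]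
  calc _ ≤ ∫⁻ _g : ℝ, 1 ∂(ProbabilityTheory.gaussianReal u w) := ?_
    _ = 1 := by simp
  refine MeasureTheory.lintegral_mono fun g => ?_
  rw [← hsupp fun i => ENNReal.ofReal (Real.exp ((f i - expect p f) / c * g - g ^ 2 / 2))]
  -- At the parameter `g / c` Hoeffding's factor is `exp (g² / 2)`, which the Gaussian weight in the
  -- integrand cancels exactly.
  have h := tsum_exp_centered_le p hf (g / c)
  have h2 : ∀ i, p i * ENNReal.ofReal (Real.exp ((f i - expect p f) / c * g - g ^ 2 / 2)) =
      p i * ENNReal.ofReal (Real.exp (g / c * (f i - expect p f))) *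
        ENNReal.ofReal (Real.exp (-(g ^ 2 / 2))) := fun i => by
    rw [mul_assoc, ← ENNReal.ofReal_mul (Real.exp_pos _).le, ← Real.exp_add]
    congr 3
    ring
  simp_rw [h2]
  rw [ENNReal.tsum_mul_right]
  refine (mul_le_mul_left h _).trans_eq ?_
  rw [← ENNReal.ofReal_mul (Real.exp_pos _).le, ← Real.exp_add]
  have : ((c - -c) / 2) ^ 2 * (g / c) ^ 2 / 2 + -(g ^ 2 / 2) = 0 := by field_simp; ring
  rw [this]
  simp

end Expect

/-! ### Rank-one updates of the inverse design operator -/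

section Resolvent

variable {E : Type*} [NormedAddCommGroup E] [InnerProductSpace ℝ E]

/-- The inverse of the regularized design operator `lam + ∑_{i=1}^n f_i ⟨f_i, ·⟩`, built by
rank-one updates. -/
noncomputable def resolvent (lam : ℝ) (f : ℕ → E) : ℕ → E →ₗ[ℝ] E
  | 0 => lam⁻¹ • LinearMap.id
  | n + 1 => resolvent lam f n -
      (1 + inner ℝ (f (n + 1)) (resolvent lam f n (f (n + 1))))⁻¹ •
        ((innerₛₗ ℝ (resolvent lam f n (f (n + 1)))).smulRight (resolvent lam f n (f (n + 1))))

/-- The regularized design operator `lam + ∑_{i=1}^n f_i ⟨f_i, ·⟩`. -/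
noncomputable def design (lam : ℝ) (f : ℕ → E) (n : ℕ) (x : E) : E :=
  lam • x + ∑ i ∈ Finset.Icc 1 n, (inner ℝ (f i) x : ℝ) • f i

/-- The energy `lam ‖x‖² + ∑_{i=1}^n ⟨f_i, x⟩²`. -/
noncomputable def energy (lam : ℝ) (f : ℕ → E) (n : ℕ) (x : E) : ℝ :=
  lam * ‖x‖ ^ 2 + ∑ i ∈ Finset.Icc 1 n, (inner ℝ (f i) x : ℝ) ^ 2

/-- The potential `⟨x, R_n x⟩` of the resolvent. -/
noncomputable def potential (lam : ℝ) (f : ℕ → E) (n : ℕ) (x : E) : ℝ :=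
  inner ℝ x (resolvent lam f n x)

variable {lam : ℝ} {f : ℕ → E}

theorem resolvent_succ_apply (n : ℕ) (x : E) :
    resolvent lam f (n + 1) x = resolvent lam f n x -
      ((1 + potential lam f n (f (n + 1)))⁻¹ * inner ℝ (resolvent lam f n (f (n + 1))) x) •
        resolvent lam f n (f (n + 1)) := by
  simp [resolvent, potential, smul_smul]

theorem resolvent_congr {f' : ℕ → E} {n : ℕ} (h : ∀ i ∈ Finset.Icc 1 n, f i = f' i) :
    resolvent lam f n = resolvent lam f' n := by
  induction n with
  | zero => rfl
  | succ n ih =>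
    have h1 := ih fun i hi => h i (Finset.Icc_subset_Icc_right n.le_succ hi)
    have h2 := h (n + 1) (by simp)
    simp only [resolvent, h1, h2]

theorem energy_nonneg (hl : 0 < lam) (n : ℕ) (x : E) : 0 ≤ energy lam f n x :=
  add_nonneg (by positivity) (Finset.sum_nonneg fun _ _ => sq_nonneg _)

theorem inner_design (n : ℕ) (x y : E) : inner ℝ (design lam f n x) y =
    lam * inner ℝ x y + ∑ i ∈ Finset.Icc 1 n, (inner ℝ (f i) x : ℝ) * inner ℝ (f i) y := by
  simp [design, inner_add_left, inner_smul_left, sum_inner]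

theorem inner_design_comm (n : ℕ) (x y : E) :
    inner ℝ (design lam f n x) y = inner ℝ x (design lam f n y) := by
  rw [inner_design, real_inner_comm (design lam f n y) x, inner_design, real_inner_comm y x]
  simp only [mul_comm]

theorem inner_design_self (n : ℕ) (x : E) : inner ℝ (design lam f n x) x = energy lam f n x := by
  rw [inner_design, energy, real_inner_self_eq_norm_sq]
  simp only [sq]

theorem design_succ (n : ℕ) (x : E) : design lam f (n + 1) x =
    design lam f n x + (inner ℝ (f (n + 1)) x : ℝ) • f (n + 1) := by
  rw [design, design, Finset.sum_Icc_succ_top (by omega), add_assoc]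

theorem design_sub (n : ℕ) (x y : E) :
    design lam f n (x - y) = design lam f n x - design lam f n y := by
  simp only [design, smul_sub, inner_sub_right, sub_smul, Finset.sum_sub_distrib]
  abel

theorem design_smul (n : ℕ) (c : ℝ) (x : E) :
    design lam f n (c • x) = c • design lam f n x := by
  simp only [design, smul_add, Finset.smul_sum, inner_smul_right, mul_smul, smul_comm lam c]

/-- One induction carries all three claims: the Sherman–Morrison step divides by `1 + w` and moves
the resolvent across the inner product. Nonnegativity and symmetry follow in turn, at each `n`, from
the right-inverse property, because the design operator is symmetric with quadratic form `energy`.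
-/
theorem resolvent_spec (hl : 0 < lam) (n : ℕ) :
    (∀ x, design lam f n (resolvent lam f n x) = x) ∧ 0 ≤ potential lam f n (f (n + 1)) ∧
      ∀ x y, inner ℝ (resolvent lam f n x) y = (inner ℝ x (resolvent lam f n y) : ℝ) := by
  have aux : ∀ n, (∀ x, design lam f n (resolvent lam f n x) = x) →
      0 ≤ potential lam f n (f (n + 1)) ∧
      ∀ x y, inner ℝ (resolvent lam f n x) y = (inner ℝ x (resolvent lam f n y) : ℝ) := by
    intro n h
    refine ⟨?_, fun x y => ?_⟩
    · have := inner_design_self (lam := lam) (f := f) n (resolvent lam f n (f (n + 1)))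
      rw [h] at this
      rw [potential, this]
      exact energy_nonneg hl _ _
    · conv_lhs => rw [← h y]
      rw [← inner_design_comm, h]
  induction n with
  | zero =>
    have h0 : ∀ x, design lam f 0 (resolvent lam f 0 x) = x := fun x => by
      simp [design, resolvent, smul_smul, hl.ne']
    exact ⟨h0, aux 0 h0⟩
  | succ n ih =>
    obtain ⟨h1, h2, h3⟩ := ih
    have hs : ∀ x, design lam f (n + 1) (resolvent lam f (n + 1) x) = x := fun x => by
      set w := potential lam f n (f (n + 1)) with hw
      have hw1 : (1 + w) ≠ 0 := by positivity
      have hww : inner ℝ (f (n + 1)) (resolvent lam f n (f (n + 1))) = w := rfl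
      rw [resolvent_succ_apply, design_succ, design_sub, design_smul, h1, h1, inner_sub_right,
        inner_smul_right, hww, h3, ← hw, sub_add, ← sub_smul]
      have : (1 + w)⁻¹ * inner ℝ (f (n + 1)) (resolvent lam f n x) -
        (inner ℝ (f (n + 1)) (resolvent lam f n x) -
          (1 + w)⁻¹ * inner ℝ (f (n + 1)) (resolvent lam f n x) * w) = 0 := by
        field_simp
        ring
      rw [this, zero_smul, sub_zero]
    exact ⟨hs, aux _ hs⟩

theorem design_resolvent (hl : 0 < lam) (n : ℕ) (x : E) :
    design lam f n (resolvent lam f n x) = x := (resolvent_spec hl n).1 x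

theorem inner_resolvent_comm (hl : 0 < lam) (n : ℕ) (x y : E) :
    inner ℝ (resolvent lam f n x) y = (inner ℝ x (resolvent lam f n y) : ℝ) :=
  (resolvent_spec hl n).2.2 x y

theorem potential_eq_energy (hl : 0 < lam) (n : ℕ) (x : E) :
    potential lam f n x = energy lam f n (resolvent lam f n x) := by
  rw [← inner_design_self, design_resolvent hl, potential]

theorem potential_nonneg (hl : 0 < lam) (n : ℕ) (x : E) : 0 ≤ potential lam f n x := by
  rw [potential_eq_energy hl]
  exact energy_nonneg hl _ _

theorem resolvent_design (hl : 0 < lam) (n : ℕ) (x : E) :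
    resolvent lam f n (design lam f n x) = x := by
  refine ext_inner_right ℝ fun y => ?_
  rw [inner_resolvent_comm hl, inner_design_comm, design_resolvent hl]

theorem energy_eq_potential (hl : 0 < lam) (n : ℕ) (x : E) :
    energy lam f n x = potential lam f n (design lam f n x) := by
  rw [potential, resolvent_design hl, inner_design_self]

/-- Cauchy–Schwarz for a dual pair of norms: the energy is nonnegative along the line `y - t R x`,
with `R` the resolvent, so the discriminant of this quadratic in `t` is not positive. -/
theorem inner_sq_le_potential_mul_energy (hl : 0 < lam) (n : ℕ) (x y : E) :
    (inner ℝ x y : ℝ) ^ 2 ≤ potential lam f n x * energy lam f n y := by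
  set z := resolvent lam f n x
  have hx : design lam f n z = x := design_resolvent hl n x
  have hexp : ∀ t : ℝ, energy lam f n (y - t • z) =
      potential lam f n x * (t * t) + (-2 * inner ℝ x y) * t + energy lam f n y := fun t => by
    have hyz : inner ℝ (design lam f n y) z = (inner ℝ x y : ℝ) := by
      rw [inner_design_comm, hx, real_inner_comm]
    have hxz : (inner ℝ x z : ℝ) = potential lam f n x := rfl
    rw [← inner_design_self, design_sub, design_smul, hx]
    simp only [inner_sub_left, inner_sub_right, inner_smul_left, inner_smul_right]
    rw [inner_design_self, hyz, hxz]
    simp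
    ring
  have h := discrim_le_zero (a := potential lam f n x) (b := -2 * inner ℝ x y)
    (c := energy lam f n y) fun t => by rw [← hexp]; exact energy_nonneg hl _ _
  rw [discrim] at h
  nlinarith

theorem abs_inner_le_sqrt_potential_mul (hl : 0 < lam) (n : ℕ) (x y : E) {b : ℝ}
    (hy : Real.sqrt (energy lam f n y) ≤ b) :
    |(inner ℝ x y : ℝ)| ≤ b * Real.sqrt (potential lam f n x) := by
  have h := inner_sq_le_potential_mul_energy (f := f) hl n x y
  calc |(inner ℝ x y : ℝ)| ≤ Real.sqrt (potential lam f n x * energy lam f n y) :=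
        Real.abs_le_sqrt h
    _ = Real.sqrt (potential lam f n x) * Real.sqrt (energy lam f n y) :=
        Real.sqrt_mul (potential_nonneg hl _ _) _
    _ ≤ Real.sqrt (potential lam f n x) * b := by gcongr
    _ = _ := mul_comm _ _

theorem potential_le_norm_sq_div (hl : 0 < lam) (n : ℕ) (x : E) :
    potential lam f n x ≤ ‖x‖ ^ 2 / lam := by
  set z := resolvent lam f n x
  have h1 : potential lam f n x = energy lam f n z := potential_eq_energy hl n x
  have h2 : lam * ‖z‖ ^ 2 ≤ energy lam f n z :=
    le_add_of_nonneg_right (Finset.sum_nonneg fun _ _ => sq_nonneg _)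
  have h3 : potential lam f n x ≤ ‖x‖ * ‖z‖ := real_inner_le_norm _ _
  rw [le_div_iff₀ hl]
  have h4 := potential_nonneg (f := f) hl n x
  nlinarith [sq_nonneg (‖x‖ - lam * ‖z‖)]

theorem potential_add_add_le (hl : 0 < lam) (n : ℕ) (a b c : E) :
    potential lam f n (a + b + c) ≤
      3 * (potential lam f n a + potential lam f n b + potential lam f n c) := by
  have hsub : ∀ x y : E, 0 ≤ potential lam f n x + potential lam f n y -
      2 * inner ℝ x (resolvent lam f n y) := fun x y => by
    have h := potential_nonneg (f := f) hl n (x - y)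
    have hc : inner ℝ y (resolvent lam f n x) = (inner ℝ x (resolvent lam f n y) : ℝ) := by
      rw [← inner_resolvent_comm hl, real_inner_comm]
    simp only [potential, map_sub, inner_sub_left, inner_sub_right] at h ⊢
    linarith
  have hc : ∀ x y : E, inner ℝ y (resolvent lam f n x) = (inner ℝ x (resolvent lam f n y) : ℝ) :=
    fun x y => by rw [← inner_resolvent_comm hl, real_inner_comm]
  have h1 := hsub a b
  have h2 := hsub a c
  have h3 := hsub b c
  simp only [potential, map_add, inner_add_left, inner_add_right] at *
  rw [hc a b, hc a c, hc b c]
  linarith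

theorem potential_neg (n : ℕ) (x : E) : potential lam f n (-x) = potential lam f n x := by
  simp [potential]

/-- With `z = R x` the potential equals `∑ m_i ⟨f_i, z⟩`. Young's inequality leaves `∑ ⟨f_i, z⟩²`,
which is part of the energy of `z`, that is, of the potential itself; so no factor `1 / lam` is
lost. -/
theorem potential_sum_smul_le (hl : 0 < lam) (n : ℕ) (m : ℕ → ℝ) :
    potential lam f n (∑ i ∈ Finset.Icc 1 n, m i • f i) ≤ ∑ i ∈ Finset.Icc 1 n, m i ^ 2 := by
  set x := ∑ i ∈ Finset.Icc 1 n, m i • f i with hx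
  set z := resolvent lam f n x
  have h1 : potential lam f n x = energy lam f n z := potential_eq_energy hl n x
  have h2 : ∑ i ∈ Finset.Icc 1 n, (inner ℝ (f i) z : ℝ) ^ 2 ≤ energy lam f n z :=
    le_add_of_nonneg_left (by positivity)
  have h3 : potential lam f n x = ∑ i ∈ Finset.Icc 1 n, m i * inner ℝ (f i) z := by
    rw [potential, hx, sum_inner]
    simp only [inner_smul_left]
    rfl
  have h4 : 2 * ∑ i ∈ Finset.Icc 1 n, m i * inner ℝ (f i) z ≤
      ∑ i ∈ Finset.Icc 1 n, m i ^ 2 + ∑ i ∈ Finset.Icc 1 n, (inner ℝ (f i) z : ℝ) ^ 2 := by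
    rw [Finset.mul_sum, ← Finset.sum_add_distrib]
    refine Finset.sum_le_sum fun i _ => ?_
    nlinarith [sq_nonneg (m i - inner ℝ (f i) z)]
  linarith

/-- Sherman–Morrison for the squared dual norm. The increment is twice the exponent produced by
Gaussian mixing in `lintegral_gaussianReal_exp`, which is why the product of the mixed factors
telescopes. -/
theorem potential_update (hl : 0 < lam) (n : ℕ) (x : E) (e : ℝ) :
    potential lam f (n + 1) (x + e • f (n + 1)) = potential lam f n x +
      (2 * e * inner ℝ x (resolvent lam f n (f (n + 1))) +
        e ^ 2 * potential lam f n (f (n + 1)) -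
        (inner ℝ x (resolvent lam f n (f (n + 1)))) ^ 2) /
        (1 + potential lam f n (f (n + 1))) := by
  set w := potential lam f n (f (n + 1)) with hw
  set u : ℝ := inner ℝ x (resolvent lam f n (f (n + 1))) with hu
  have hw0 : 0 ≤ w := potential_nonneg hl n _
  have hww : inner ℝ (f (n + 1)) (resolvent lam f n (f (n + 1))) = w := rfl
  have hu2 : (inner ℝ (f (n + 1)) (resolvent lam f n x) : ℝ) = u := by
    rw [← inner_resolvent_comm hl, real_inner_comm]
  have hu3 : (inner ℝ (resolvent lam f n (f (n + 1))) (f (n + 1)) : ℝ) = w := by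
    rw [real_inner_comm]; exact hww
  have hu4 : (inner ℝ (resolvent lam f n (f (n + 1))) x : ℝ) = u := by
    rw [real_inner_comm]
  rw [potential, resolvent_succ_apply, ← hw]
  simp only [map_add, map_smul, inner_add_left, inner_add_right, inner_sub_right, inner_smul_left,
    inner_smul_right, hww, hu2, hu3, hu4, ← hu, potential]
  simp only [conj_trivial]
  field_simp
  ring

theorem potential_selfNormalized (hl : 0 < lam) (e : ℕ → ℝ) (n : ℕ) :
    potential lam f n (∑ i ∈ Finset.Icc 1 n, e i • f i) = ∑ i ∈ Finset.range n,
      (2 * e (i + 1) * inner ℝ (∑ j ∈ Finset.Icc 1 i, e j • f j)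
          (resolvent lam f i (f (i + 1))) +
        e (i + 1) ^ 2 * potential lam f i (f (i + 1)) -
        (inner ℝ (∑ j ∈ Finset.Icc 1 i, e j • f j) (resolvent lam f i (f (i + 1)))) ^ 2) /
        (1 + potential lam f i (f (i + 1))) := by
  induction n with
  | zero => simp [potential]
  | succ n ih =>
    rw [Finset.sum_Icc_succ_top (by omega), potential_update hl, ih, Finset.sum_range_succ]

end Resolvent

/-! ### Gram determinant as a product of potentials -/

section Determinant

variable {E : Type*} [NormedAddCommGroup E] [InnerProductSpace ℝ E]

/-- The regularized Gram matrix `I + K / lam` of `f_1, …, f_n`. -/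
noncomputable def regGram (lam : ℝ) (f : ℕ → E) (n : ℕ) : Matrix (Fin n) (Fin n) ℝ :=
  1 + lam⁻¹ • Matrix.of fun i j : Fin n => (inner ℝ (f (i + 1)) (f (j + 1)) : ℝ)

/-- A new vector borders the Gram matrix by one row and column, and the Schur complement of the
corner is `1 + potential`: solving the system with the old Gram matrix amounts to applying the
resolvent to the new vector. -/
theorem det_regGram {lam : ℝ} (hl : 0 < lam) (f : ℕ → E) (n : ℕ) :
    (regGram lam f n).det = ∏ i ∈ Finset.range n, (1 + potential lam f i (f (i + 1))) := by
  induction n with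
  | zero => simp
  | succ n ih =>
    have hpos : 0 < (regGram lam f n).det := by
      rw [ih]
      exact Finset.prod_pos fun i _ => by
        have := potential_nonneg (f := f) hl i (f (i + 1))
        positivity
    set M := regGram lam f n with hM
    have hunit : IsUnit M.det := hpos.ne'.isUnit
    let _ : Invertible M := M.invertibleOfIsUnitDet hunit
    set v : Fin n → ℝ := fun i => lam⁻¹ * inner ℝ (f (i + 1)) (f (n + 1)) with hv
    have hblock : regGram lam f (n + 1) = (Matrix.fromBlocks M (Matrix.of fun i (_ : Fin 1) => v i)
        (Matrix.of fun (_ : Fin 1) i => v i)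
        (Matrix.of fun (_ _ : Fin 1) => 1 + lam⁻¹ * inner ℝ (f (n + 1)) (f (n + 1)))).submatrix
          finSumFinEquiv.symm finSumFinEquiv.symm := by
      ext i j
      refine Fin.addCases (fun i => ?_) (fun i => ?_) i <;>
        refine Fin.addCases (fun j => ?_) (fun j => ?_) j
      · simp [regGram, hM, Matrix.one_apply]
      · simp [regGram, hv, Matrix.one_apply, Fin.ext_iff]
        omega
      · simp [regGram, hv, Matrix.one_apply, Fin.ext_iff, real_inner_comm]
        omega
      · simp [regGram, Matrix.one_apply, Fin.ext_iff]
    rw [hblock, Matrix.det_submatrix_equiv_self, Matrix.det_fromBlocks₁₁, ih,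
      Finset.prod_range_succ, Matrix.det_fin_one]
    congr 1
    set c : Fin n → ℝ := M⁻¹.mulVec v with hc
    have hMc : M.mulVec c = v := by
      rw [hc, Matrix.mulVec_mulVec, Matrix.mul_nonsing_inv _ hunit, Matrix.one_mulVec]
    have hMc' : ∀ i : Fin n, c i + lam⁻¹ * ∑ j : Fin n, inner ℝ (f (i + 1)) (f (j + 1)) * c j =
        lam⁻¹ * inner ℝ (f (i + 1)) (f (n + 1)) := fun i => by
      have h := congrFun hMc i
      rw [hM, regGram, Matrix.add_mulVec, Matrix.one_mulVec, Matrix.smul_mulVec] at h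
      exact h
    -- Explicit candidate for the resolvent of `f (n + 1)`, identified below by applying the design
    -- operator to it.
    set ψ : E := lam⁻¹ • (f (n + 1) - ∑ i : Fin n, c i • f (i + 1)) with hψ
    have hsum : ∀ F : ℕ → E, ∑ i ∈ Finset.Icc 1 n, F i = ∑ i : Fin n, F (i + 1) := fun F => by
      rw [Fin.sum_univ_eq_sum_range (fun i => F (i + 1)) n, Finset.range_eq_Ico,
        Finset.sum_Ico_add' F 0 n 1, zero_add]
      rfl
    have hdes : design lam f n ψ = f (n + 1) := by
      have hci : ∀ i : Fin n, inner ℝ (f (i + 1)) ψ = c i := fun i => by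
        have h := hMc' i
        simp only [hψ, inner_smul_right, inner_sub_right, inner_sum]
        rw [mul_sub, ← h]
        simp only [mul_comm (c _)]
        ring
      rw [design, hsum]
      simp only [hci]
      rw [hψ, smul_smul, mul_inv_cancel₀ hl.ne', one_smul, sub_add_cancel]
    have hw : potential lam f n (f (n + 1)) = inner ℝ (f (n + 1)) ψ := by
      rw [potential, ← hdes, resolvent_design hl, hdes]
    rw [hw, Matrix.invOf_eq_nonsing_inv]
    have hdot : (Matrix.of (fun (_ : Fin 1) i => v i) * M⁻¹ * Matrix.of fun i (_ : Fin 1) => v i)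
        0 0 = ∑ i, v i * c i := by
      rw [Matrix.mul_assoc]
      rfl
    rw [Matrix.sub_apply, hdot]
    simp only [Matrix.of_apply, hψ, inner_smul_right, inner_sub_right, inner_sum, hv]
    rw [mul_sub, Finset.mul_sum, add_sub_assoc]
    congr 2
    refine Finset.sum_congr rfl fun i _ => ?_
    rw [real_inner_comm (f (n + 1))]
    ring

end Determinant

/-! ### Features, misspecification and effective dimension -/

section FeatureMap

variable {S A E : Type*} [NormedAddCommGroup E] [InnerProductSpace ℝ E] {φ : S → S × A × A → E}

theorem BoundedFeatures.summable_and_norm_le (hφ : BoundedFeatures φ) {c : ℝ} (hc : 0 < c)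
    {V : S → ℝ} (hV : ∀ s, V s ∈ Set.Icc (-c) c) (z : S × A × A) :
    Summable (fun s => V s • φ s z) ∧ ‖featureOf φ V z‖ ≤ c := by
  obtain ⟨h1, h2⟩ := hφ (fun s => V s / c) (fun s =>
    ⟨by rw [le_div_iff₀ hc]; linarith [(hV s).1], by rw [div_le_one hc]; exact (hV s).2⟩) z
  have h3 : (fun s => V s • φ s z) = fun s => c • ((V s / c) • φ s z) := by
    funext s
    rw [smul_smul, mul_div_cancel₀ _ hc.ne']
  rw [featureOf, h3, h1.tsum_const_smul, norm_smul, Real.norm_of_nonneg hc.le]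
  exact ⟨h1.const_smul c, mul_le_of_le_one_right hc.le h2⟩

theorem BoundedFeatures.inner_featureOf (hφ : BoundedFeatures φ) {c : ℝ} (hc : 0 < c)
    {V : S → ℝ} (hV : ∀ s, V s ∈ Set.Icc (-c) c) (z : S × A × A) (θ : E) :
    HasSum (fun s => V s * inner ℝ (φ s z) θ) (inner ℝ (featureOf φ V z) θ) := by
  have h := ((innerSL ℝ θ).hasSum (hφ.summable_and_norm_le hc hV z).1.hasSum)
  simp only [innerSL_apply_apply, inner_smul_right] at h
  simpa only [real_inner_comm θ, featureOf] using h

theorem BoundedFeatures.weightedKernel_eq (hφ : BoundedFeatures φ) {c : ℝ} (hc : 0 < c)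
    {V₁ V₂ : S → ℝ} (h₁ : ∀ s, V₁ s ∈ Set.Icc (-c) c) (h₂ : ∀ s, V₂ s ∈ Set.Icc (-c) c)
    (z₁ z₂ : S × A × A) :
    weightedKernel φ V₁ V₂ z₁ z₂ = inner ℝ (featureOf φ V₁ z₁) (featureOf φ V₂ z₂) := by
  rw [← (hφ.inner_featureOf hc h₁ z₁ _).tsum_eq, weightedKernel]
  refine tsum_congr fun s₁ => ?_
  have h := hφ.inner_featureOf hc h₂ z₂ (φ s₁ z₁)
  rw [real_inner_comm] at h
  rw [← h.tsum_eq, ← tsum_mul_left]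
  exact tsum_congr fun s₂ => by rw [real_inner_comm (φ s₁ z₁), mul_assoc]

theorem MarkovGame.Misspecified.abs_expect_sub_inner_le {G : MarkovGame S A} {θ : ℕ → E} {B ι : ℝ}
    (hG : G.Misspecified φ θ B ι) (hφ : BoundedFeatures φ) {h : ℕ} (hh : h ∈ Finset.Icc 1 G.H)
    {c : ℝ} (hc : 0 < c) {V : S → ℝ} (hV : ∀ s, V s ∈ Set.Icc (-c) c) (z : S × A × A) :
    |expect (G.P h z) V - inner ℝ (featureOf φ V z) (θ h)| ≤ c * ι := by
  have h1 := hφ.inner_featureOf hc hV z (θ h)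
  have hVc : ∀ s, |V s| ≤ c := fun s => abs_le.2 (hV s)
  have h2 : Summable fun s => ((G.P h z) s).toReal * V s := expect_summable fun s _ => hVc s
  -- The case `V = 1` makes the series in `tvError` convergent; a divergent one would have the
  -- default value 0 and bound nothing.
  have h3 : Summable fun s => inner ℝ (φ s z) (θ h) := by
    have := (hφ.inner_featureOf (V := fun _ => 1) one_pos (fun s => by simp) z (θ h)).summable
    simpa using this
  have h4 : Summable fun s => |((G.P h z) s).toReal - inner ℝ (φ s z) (θ h)| :=
    ((hasSum_pmf_toReal (G.P h z)).summable.sub h3).abs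
  have h5 : ∑' s, |((G.P h z) s).toReal - inner ℝ (φ s z) (θ h)| ≤ ι := (hG h hh).2 z
  rw [← h1.tsum_eq, expect, ← h2.tsum_sub h1.summable]
  have h6 : ∀ s, |((G.P h z) s).toReal * V s - V s * inner ℝ (φ s z) (θ h)| ≤
      c * |((G.P h z) s).toReal - inner ℝ (φ s z) (θ h)| := fun s => by
    rw [mul_comm, ← mul_sub, abs_mul]
    exact mul_le_mul_of_nonneg_right (hVc s) (abs_nonneg _)
  have h7 := (h2.sub h1.summable).abs
  have h8 := h4.mul_left c
  calc _ ≤ ∑' s, |((G.P h z) s).toReal * V s - V s * inner ℝ (φ s z) (θ h)| := by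
        simpa only [Real.norm_eq_abs] using norm_tsum_le_tsum_norm (h2.sub h1.summable).norm
    _ ≤ ∑' s, c * |((G.P h z) s).toReal - inner ℝ (φ s z) (θ h)| :=
        h7.tsum_le_tsum h6 h8
    _ = c * ∑' s, |((G.P h z) s).toReal - inner ℝ (φ s z) (θ h)| := tsum_mul_left
    _ ≤ c * ι := by gcongr

/-- The real `sSup` of an unbounded set is 0, so `Γ` is an upper bound only thanks to this. A crude
estimate is enough: `log |x| ≤ |x|` and a determinant with bounded entries. -/
theorem effDim_bddAbove (hφ : BoundedFeatures φ) {H : ℕ} (hH : 1 ≤ H) (T : ℕ) {lam : ℝ}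
    (hl : 0 < lam) : BddAbove {g : ℝ | ∃ (V : Fin T → S → ℝ) (z : Fin T → S × A × A),
      (∀ i s, V i s ∈ Set.Icc (-(H : ℝ)) H) ∧
      g = 1 / 2 * Real.log (1 + lam⁻¹ • kernelMatrix φ V z).det} := by
  have hH' : (0 : ℝ) < H := by exact_mod_cast hH
  refine ⟨1 / 2 * (T.factorial • (1 + lam⁻¹ * (H * H)) ^ T), ?_⟩
  rintro _ ⟨V, z, hV, rfl⟩
  refine mul_le_mul_of_nonneg_left ?_ (by norm_num)
  rw [← Real.log_abs]
  refine (Real.log_le_self (abs_nonneg _)).trans ?_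
  have hent : ∀ i j, AbsoluteValue.abs ((1 + lam⁻¹ • kernelMatrix φ V z) i j) ≤
      1 + lam⁻¹ * ((H : ℝ) * H) := fun i j => by
    have hk : |kernelMatrix φ V z i j| ≤ (H : ℝ) * H := by
      rw [kernelMatrix, Matrix.of_apply, hφ.weightedKernel_eq hH' (hV i) (hV j)]
      refine (abs_real_inner_le_norm _ _).trans ?_
      exact mul_le_mul (hφ.summable_and_norm_le hH' (hV i) _).2
        (hφ.summable_and_norm_le hH' (hV j) _).2 (norm_nonneg _) hH'.le
    have h1 : |(1 : Matrix (Fin T) (Fin T) ℝ) i j| ≤ 1 := by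
      rw [Matrix.one_apply]
      split_ifs <;> simp
    rw [AbsoluteValue.abs_apply, Matrix.add_apply, Matrix.smul_apply, smul_eq_mul]
    refine (abs_add_le _ _).trans (add_le_add h1 ?_)
    rw [abs_mul, abs_of_pos (inv_pos.2 hl)]
    exact mul_le_mul_of_nonneg_left hk (inv_pos.2 hl).le
  have := Matrix.det_le hent
  simpa using this

/-- The information gain along any sequence is at most the effective dimension. -/
theorem sum_log_one_add_potential_le (hφ : BoundedFeatures φ) {H : ℕ} (hH : 1 ≤ H) (T : ℕ)
    {lam : ℝ} (hl : 0 < lam) (V : ℕ → S → ℝ) (hV : ∀ i s, V i s ∈ Set.Icc (-(H : ℝ)) H)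
    (z : ℕ → S × A × A) {f : ℕ → E} (hf : ∀ i, f i = featureOf φ (V i) (z i)) :
    ∑ i ∈ Finset.range T, Real.log (1 + potential lam f i (f (i + 1))) ≤
      2 * effDim φ H T lam := by
  have hH' : (0 : ℝ) < H := by exact_mod_cast hH
  have h1 : regGram lam f T = 1 + lam⁻¹ • kernelMatrix φ (fun i : Fin T => V (i + 1))
      (fun i : Fin T => z (i + 1)) := by
    rw [regGram]
    congr 2
    ext i j
    rw [kernelMatrix, Matrix.of_apply, Matrix.of_apply, hφ.weightedKernel_eq hH' (hV _) (hV _),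
      hf, hf]
  have h2 : 1 / 2 * Real.log (regGram lam f T).det ≤ effDim φ H T lam :=
    le_csSup (effDim_bddAbove hφ hH T hl) ⟨_, _, fun i => hV _, by rw [h1]⟩
  rw [det_regGram hl, Real.log_prod fun i _ => by
    have := potential_nonneg (f := f) hl i (f (i + 1))
    positivity] at h2
  linarith

/-- Take the constant function `H` and the same triplet `z` all `T` times: the kernel matrix is
constant of rank at most one, and the matrix determinant lemma applies. -/
theorem effDim_ge (hφ : BoundedFeatures φ) {H : ℕ} (hH : 1 ≤ H) (T : ℕ)
    {lam : ℝ} (hl : 0 < lam) (z : S × A × A) :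
    1 / 2 * Real.log (1 + T * (lam⁻¹ * (H * ‖featureOf φ (fun _ => 1) z‖) ^ 2)) ≤
      effDim φ H T lam := by
  have hH' : (0 : ℝ) < H := by exact_mod_cast hH
  have hV : ∀ s : S, (H : ℝ) ∈ Set.Icc (-(H : ℝ)) H := fun _ => ⟨by linarith, le_rfl⟩
  refine le_csSup (effDim_bddAbove hφ hH T hl) ⟨fun _ _ => H, fun _ => z, fun _ => hV, ?_⟩
  have hfeat : featureOf φ (fun _ => (H : ℝ)) z = (H : ℝ) • featureOf φ (fun _ => 1) z := by
    have h := (hφ.summable_and_norm_le (V := fun _ => 1) one_pos (fun s => by simp) z).1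
    rw [featureOf, featureOf, ← h.tsum_const_smul]
    simp
  have hM : (1 + lam⁻¹ • kernelMatrix φ (fun (_ : Fin T) _ => (H : ℝ)) (fun _ => z)) =
      1 + Matrix.replicateCol Unit (fun _ : Fin T => lam⁻¹ *
        (H * ‖featureOf φ (fun _ => 1) z‖) ^ 2) * Matrix.replicateRow Unit (fun _ : Fin T => (1 : ℝ)) := by
    congr 1
    ext i j
    rw [Matrix.smul_apply, kernelMatrix, Matrix.of_apply, hφ.weightedKernel_eq hH' hV hV, hfeat,
      real_inner_self_eq_norm_sq, norm_smul, Real.norm_of_nonneg hH'.le]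
    simp [Matrix.mul_apply]
  rw [hM, Matrix.det_one_add_replicateCol_mul_replicateRow]
  simp [dotProduct]

end FeatureMap

/-! ### Tower property and Ville's inequality along the episodes -/

section Ville

variable {S A E : Type*} [NormedAddCommGroup E] [InnerProductSpace ℝ E] {φ : S → S × A × A → E}

/-- What is known of the data before the actions of step `h` in episode `t`, as an element of a
countable type. -/
def history (H t h : ℕ) (d : Data S A) :
    (Finset.Icc 1 (t - 1) → Finset.Icc 1 (H + 1) → S) ×
      (Finset.Icc 1 (t - 1) → Finset.Icc 1 H → A × A) ×
      (Finset.Icc 1 h → S) × (Finset.Icc 1 (h - 1) → A × A) :=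
  (fun τ j => d.state τ j, fun τ j => d.act τ j, fun j => d.state t j, fun j => d.act t j)

theorem history_eq_iff {H t h : ℕ} {d d' : Data S A} :
    history H t h d = history H t h d' ↔ AgreeBeforeAction H t h d d' := by
  simp only [history, AgreeBeforeAction, Prod.mk.injEq, funext_iff, Subtype.forall]

theorem AgreeBeforeAction.of_lt {H t h s : ℕ} {d d' : Data S A}
    (hd : AgreeBeforeAction H t h d d') (hs : s ∈ Finset.Icc 1 (t - 1)) (hh : h ≤ H) :
    AgreeBeforeAction H s h d d' := by
  obtain ⟨h1, h2, -, -⟩ := hd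
  rw [Finset.mem_Icc] at hs
  refine ⟨fun τ hτ => h1 τ ?_, fun τ hτ => h2 τ ?_,
    fun j hj => h1 s ?_ j ?_, fun j hj => h2 s ?_ j ?_⟩ <;>
  simp only [Finset.mem_Icc] at * <;> omega

theorem prod_eq_of_agree {H n h : ℕ} (hh : h ∈ Finset.Icc 1 H)
    {Y : ℕ → Data S A → A × A → S → ENNReal}
    (hY : ∀ t ∈ Finset.Icc 1 n, ∀ d d', AgreeBeforeAction H t h d d' → Y t d = Y t d')
    (d d' : Data S A) (hd : AgreeBeforeAction H (n + 1) h d d') :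
    ∏ t ∈ Finset.Icc 1 n, Y t d (d.act t h) (d.state t (h + 1)) =
      ∏ t ∈ Finset.Icc 1 n, Y t d' (d'.act t h) (d'.state t (h + 1)) := by
  refine Finset.prod_congr rfl fun t ht => ?_
  have hh' := Finset.mem_Icc.1 hh
  rw [hY t ht d d' (hd.of_lt (by simpa using ht) hh'.2), hd.2.1 t (by simpa using ht) h hh,
    hd.1 t (by simpa using ht) (h + 1) (by simp only [Finset.mem_Icc]; omega)]

variable {Ω : Type*} [MeasurableSpace Ω] {μ : MeasureTheory.Measure Ω}
  {G : MarkovGame S A} {cce : CCESolver S A} {lam : ℝ} {β : ℕ → ℝ} {T : ℕ} {D : Ω → Data S A}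

theorem IsRun.measurableSet_agree (hrun : IsRun μ G cce φ lam β T D) (H t h : ℕ) (d : Data S A) :
    MeasurableSet {ω | AgreeBeforeAction H t h (D ω) d} := by
  have hs := hrun.measurable_state
  have ha := hrun.measurable_act
  simp only [AgreeBeforeAction, Set.ofPred_and, Set.ofPred_forall]
  refine MeasurableSet.inter ?_ (MeasurableSet.inter ?_ (MeasurableSet.inter ?_ ?_))
  · exact Finset.measurableSet_biInter _ fun τ _ => Finset.measurableSet_biInter _ fun j _ => hs _ _ _
  · exact Finset.measurableSet_biInter _ fun τ _ => Finset.measurableSet_biInter _ fun j _ => ha _ _ _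
  · exact Finset.measurableSet_biInter _ fun j _ => hs _ _ _
  · exact Finset.measurableSet_biInter _ fun j _ => ha _ _ _

theorem IsRun.measurableSet_history (hrun : IsRun μ G cce φ lam β T D) (H t h : ℕ) (i) :
    MeasurableSet {ω | history H t h (D ω) = i} := by
  by_cases hi : ∃ d, history H t h d = i
  · obtain ⟨d, rfl⟩ := hi
    simp only [history_eq_iff]
    exact hrun.measurableSet_agree H t h d
  · convert MeasurableSet.empty
    ext ω
    simp only [Set.mem_ofPred_eq, Set.mem_empty_iff_false, iff_false]
    exact fun h => hi ⟨_, h⟩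

/-- `state_law` conditions on the action stored in `d`. Overwriting that single entry by `p` reaches
every action and leaves the past before the action unchanged. -/
theorem IsRun.joint_law (hrun : IsRun μ G cce φ lam β T D) {t h : ℕ} (ht : t ∈ Finset.Icc 1 T)
    (hh : h ∈ Finset.Icc 1 G.H) (d : Data S A) (p : A × A) (x : S) :
    μ {ω | (AgreeBeforeAction G.H t h (D ω) d ∧ (D ω).act t h = p) ∧ (D ω).state t (h + 1) = x} =
      μ {ω | AgreeBeforeAction G.H t h (D ω) d} * jointPolicy G cce φ lam β d t h (d.state t h) p *
        G.P h (d.state t h, p) x := by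
  set d' : Data S A := ⟨d.state, fun t' h' => if t' = t ∧ h' = h then p else d.act t' h'⟩ with hd'
  have hagree : ∀ D', AgreeBeforeAction G.H t h D' d' ↔ AgreeBeforeAction G.H t h D' d := by
    intro D'
    have h1 : ∀ τ ∈ Finset.Icc 1 (t - 1), ∀ j, d'.act τ j = d.act τ j := fun τ hτ j => by
      rw [Finset.mem_Icc] at hτ
      have : τ ≠ t := by omega
      simp [hd', this]
    have h2 : ∀ j ∈ Finset.Icc 1 (h - 1), d'.act t j = d.act t j := fun j hj => by
      rw [Finset.mem_Icc] at hj
      have : j ≠ h := by omega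
      simp [hd', this]
    refine and_congr Iff.rfl (and_congr ?_ (and_congr Iff.rfl ?_))
    · exact forall₂_congr fun τ hτ => forall₂_congr fun j _ => by rw [h1 τ hτ]
    · exact forall₂_congr fun j hj => by rw [h2 j hj]
  have hp : d'.act t h = p := by simp [hd']
  have h1 := hrun.state_law t ht h hh d' x
  have h2 := hrun.act_law t ht h hh d p
  simp only [hagree, hp, Data.z] at h1
  rw [h1, h2]

variable [Countable S] [Finite A]

/-- A function of the past factors through a countable set of histories, so it is measurable however
irregular the equilibrium subroutine is. -/
theorem IsRun.measurable_comp (hrun : IsRun μ G cce φ lam β T D) {H t h : ℕ} {W : Data S A → ENNReal}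
    (hW : ∀ d d', AgreeBeforeAction H t h d d' → W d = W d') : Measurable fun ω => W (D ω) := by
  let J := (Finset.Icc 1 (t - 1) → Finset.Icc 1 (H + 1) → S) ×
      (Finset.Icc 1 (t - 1) → Finset.Icc 1 H → A × A) ×
      (Finset.Icc 1 h → S) × (Finset.Icc 1 (h - 1) → A × A)
  let _ : MeasurableSpace J := ⊤
  have : Countable J := inferInstance
  have h1 : Measurable fun ω => (history H t h (D ω) : J) :=
    measurable_to_countable' fun i => hrun.measurableSet_history H t h i
  rcases isEmpty_or_nonempty (Data S A) with hE | hE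
  · have : IsEmpty Ω := ⟨fun ω => hE.elim (D ω)⟩
    exact measurable_of_empty _
  have h2 : (fun ω => W (D ω)) = (fun i : J => W (Function.invFun (history H t h) i)) ∘
      fun ω => (history H t h (D ω) : J) := by
    funext ω
    exact hW _ _ (history_eq_iff.1 (Function.invFun_eq ⟨D ω, rfl⟩).symm)
  rw [h2]
  exact measurable_from_top.comp h1

/-- The tower property, without conditional expectations: the past takes countably many values, `W`
and `Y` are fixed on each of them, and the action and next state have the prescribed product law
there. -/
theorem IsRun.lintegral_mul_le (hrun : IsRun μ G cce φ lam β T D) {t h : ℕ}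
    (ht : t ∈ Finset.Icc 1 T) (hh : h ∈ Finset.Icc 1 G.H) {W : Data S A → ENNReal}
    (hW : ∀ d d', AgreeBeforeAction G.H t h d d' → W d = W d')
    {Y : Data S A → A × A → S → ENNReal}
    (hY : ∀ d d', AgreeBeforeAction G.H t h d d' → Y d = Y d')
    (hY1 : ∀ d, ∑' p, jointPolicy G cce φ lam β d t h (d.state t h) p *
      ∑' x, G.P h (d.state t h, p) x * Y d p x ≤ 1) :
    ∫⁻ ω, W (D ω) * Y (D ω) ((D ω).act t h) ((D ω).state t (h + 1)) ∂μ ≤ ∫⁻ ω, W (D ω) ∂μ := by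
  rcases isEmpty_or_nonempty (Data S A) with hE | hE
  · have : IsEmpty Ω := ⟨fun ω => hE.elim (D ω)⟩
    simp [MeasureTheory.Measure.eq_zero_of_isEmpty μ]
  let I := (Finset.Icc 1 (t - 1) → Finset.Icc 1 (G.H + 1) → S) ×
      (Finset.Icc 1 (t - 1) → Finset.Icc 1 G.H → A × A) ×
      (Finset.Icc 1 h → S) × (Finset.Icc 1 (h - 1) → A × A)
  let hist : Data S A → I := history G.H t h
  -- A representative of each history; histories that no record has get an arbitrary one and carry
  -- no mass.
  let r : I → Data S A := Function.invFun hist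
  have hr : ∀ d, AgreeBeforeAction G.H t h d (r (hist d)) := fun d =>
    history_eq_iff.1 (Function.invFun_eq (f := hist) ⟨d, rfl⟩).symm
  let J := I × (A × A) × S
  let _ : MeasurableSpace I := ⊤
  let _ : MeasurableSpace J := ⊤
  have : Countable I := inferInstanceAs (Countable (_ × _))
  have : Countable J := inferInstance
  have : MeasurableSingletonClass J := ⟨fun _ => trivial⟩
  have : MeasurableSingletonClass I := ⟨fun _ => trivial⟩
  let j : Ω → J := fun ω => (hist (D ω), (D ω).act t h, (D ω).state t (h + 1))
  have hjset : ∀ k : J, j ⁻¹' {k} = {ω | hist (D ω) = k.1} ∩ ({ω | (D ω).act t h = k.2.1} ∩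
      {ω | (D ω).state t (h + 1) = k.2.2}) := fun k => by
    obtain ⟨i, p, x⟩ := k
    ext ω
    constructor
    · intro hk
      exact ⟨congrArg Prod.fst hk, congrArg (fun k : J => k.2.1) hk,
        congrArg (fun k : J => k.2.2) hk⟩
    · rintro ⟨hk1, hk2, hk3⟩
      exact Prod.ext hk1 (Prod.ext hk2 hk3)
  have hj : Measurable j := measurable_to_countable' fun k => by
    rw [hjset]
    exact (hrun.measurableSet_history _ _ _ _).inter
      ((hrun.measurable_act _ _ _).inter (hrun.measurable_state _ _ _))
  have hi : Measurable fun ω => hist (D ω) := measurable_to_countable' fun i =>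
    hrun.measurableSet_history _ _ _ _
  have hlaw : ∀ (i : I) (p : A × A) (x : S), μ (j ⁻¹' {(i, p, x)}) =
      μ {ω | hist (D ω) = i} * (jointPolicy G cce φ lam β (r i) t h ((r i).state t h) p *
        G.P h ((r i).state t h, p) x) := fun i p x => by
    by_cases hex : ∃ d, hist d = i
    · have hri : hist (r i) = i := Function.invFun_eq hex
      have hset : ∀ ω, hist (D ω) = i ↔ AgreeBeforeAction G.H t h (D ω) (r i) := fun ω => by
        rw [← history_eq_iff]
        exact ⟨fun h => h.trans hri.symm, fun h => h.trans hri⟩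
      have := hrun.joint_law ht hh (r i) p x
      rw [hjset]
      simp only [hset]
      rw [← mul_assoc, ← this]
      congr 1
      ext ω
      simp [and_assoc]
    · have h0 : {ω | hist (D ω) = i} = ∅ := by
        ext ω
        simp only [Set.mem_ofPred_eq, Set.mem_empty_iff_false, iff_false]
        exact fun h => hex ⟨_, h⟩
      rw [hjset]
      simp [h0]
  calc ∫⁻ ω, W (D ω) * Y (D ω) ((D ω).act t h) ((D ω).state t (h + 1)) ∂μ
      = ∫⁻ ω, (fun k : J => W (r k.1) * Y (r k.1) k.2.1 k.2.2) (j ω) ∂μ := by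
        refine MeasureTheory.lintegral_congr fun ω => ?_
        simp only [j]
        rw [← hW _ _ (hr (D ω)), ← hY _ _ (hr (D ω))]
    _ = ∑' k : J, W (r k.1) * Y (r k.1) k.2.1 k.2.2 * μ (j ⁻¹' {k}) := by
        rw [← MeasureTheory.lintegral_map
          (f := fun k : J => W (r k.1) * Y (r k.1) k.2.1 k.2.2) measurable_from_top hj,
          MeasureTheory.lintegral_countable']
        exact tsum_congr fun k => by rw [MeasureTheory.Measure.map_apply hj trivial]
    _ = ∑' i, W (r i) * μ {ω | hist (D ω) = i} *
          ∑' p, jointPolicy G cce φ lam β (r i) t h ((r i).state t h) p *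
            ∑' x, G.P h ((r i).state t h, p) x * Y (r i) p x := by
        rw [ENNReal.tsum_prod']
        refine tsum_congr fun i => ?_
        rw [ENNReal.tsum_prod', ← ENNReal.tsum_mul_left]
        refine tsum_congr fun p => ?_
        rw [← ENNReal.tsum_mul_left, ← ENNReal.tsum_mul_left]
        refine tsum_congr fun x => ?_
        rw [hlaw]
        ring
    _ ≤ ∑' i, W (r i) * μ {ω | hist (D ω) = i} * 1 := by
        gcongr
        exact hY1 _
    _ = ∫⁻ ω, (fun i => W (r i)) (hist (D ω)) ∂μ := by
        rw [← MeasureTheory.lintegral_map (f := fun i => W (r i)) measurable_from_top hi,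
          MeasureTheory.lintegral_countable']
        refine tsum_congr fun i => ?_
        rw [MeasureTheory.Measure.map_apply hi trivial, mul_one]
        rfl
    _ = ∫⁻ ω, W (D ω) ∂μ := by
        refine MeasureTheory.lintegral_congr fun ω => ?_
        exact (hW _ _ (hr (D ω))).symm

variable [MeasureTheory.IsProbabilityMeasure μ]

theorem IsRun.lintegral_prod_le_one (hrun : IsRun μ G cce φ lam β T D) {h : ℕ}
    (hh : h ∈ Finset.Icc 1 G.H) {Y : ℕ → Data S A → A × A → S → ENNReal}
    (hY : ∀ t ∈ Finset.Icc 1 T, ∀ d d', AgreeBeforeAction G.H t h d d' → Y t d = Y t d')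
    (hY1 : ∀ t ∈ Finset.Icc 1 T, ∀ d, ∑' p, jointPolicy G cce φ lam β d t h (d.state t h) p *
      ∑' x, G.P h (d.state t h, p) x * Y t d p x ≤ 1) (n : ℕ) (hn : n ≤ T) :
    ∫⁻ ω, ∏ t ∈ Finset.Icc 1 n, Y t (D ω) ((D ω).act t h) ((D ω).state t (h + 1)) ∂μ ≤ 1 := by
  induction n with
  | zero => simp
  | succ n ih =>
    refine le_trans (le_of_eq ?_) ((hrun.lintegral_mul_le (t := n + 1)
      (W := fun d => ∏ t ∈ Finset.Icc 1 n, Y t d (d.act t h) (d.state t (h + 1)))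
      (Y := Y (n + 1)) (by simp only [Finset.mem_Icc]; omega) hh
      (prod_eq_of_agree hh fun t ht => hY t (Finset.Icc_subset_Icc_right (by omega) ht))
      (hY _ (by simp only [Finset.mem_Icc]; omega))
      (hY1 _ (by simp only [Finset.mem_Icc]; omega))).trans (ih (by omega)))
    refine MeasureTheory.lintegral_congr fun ω => ?_
    rw [Finset.prod_Icc_succ_top (by omega)]

/-- **Ville's inequality** for products of increments along the episodes at a fixed step. -/
theorem IsRun.measure_exists_prod_ge_le (hrun : IsRun μ G cce φ lam β T D) {h : ℕ}
    (hh : h ∈ Finset.Icc 1 G.H) {Y : ℕ → Data S A → A × A → S → ENNReal}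
    (hY : ∀ t ∈ Finset.Icc 1 T, ∀ d d', AgreeBeforeAction G.H t h d d' → Y t d = Y t d')
    (hY1 : ∀ t ∈ Finset.Icc 1 T, ∀ d, ∑' p, jointPolicy G cce φ lam β d t h (d.state t h) p *
      ∑' x, G.P h (d.state t h, p) x * Y t d p x ≤ 1) {a : ENNReal} (ha : a ≠ 0) (ha' : a ≠ ⊤) :
    μ {ω | ∃ n ≤ T, a ≤ ∏ t ∈ Finset.Icc 1 n,
      Y t (D ω) ((D ω).act t h) ((D ω).state t (h + 1))} ≤ a⁻¹ := by
  classical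
  let Z : ℕ → Data S A → ENNReal := fun n d =>
    ∏ t ∈ Finset.Icc 1 n, Y t d (d.act t h) (d.state t (h + 1))
  -- Stopping: after a partial product has reached `a` all factors become 1, so the product up to
  -- `T` keeps its value at the first crossing and Markov's inequality at time `T` suffices.
  let Y' : ℕ → Data S A → A × A → S → ENNReal := fun t d p x =>
    if ∃ k < t, a ≤ Z k d then 1 else Y t d p x
  have hZ : ∀ n ≤ T, ∀ d d', AgreeBeforeAction G.H (n + 1) h d d' → Z n d = Z n d' :=
    fun n hn => prod_eq_of_agree hh fun t ht => hY t (Finset.Icc_subset_Icc_right hn ht)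
  have hh' := Finset.mem_Icc.1 hh
  have hY' : ∀ t ∈ Finset.Icc 1 T, ∀ d d', AgreeBeforeAction G.H t h d d' → Y' t d = Y' t d' := by
    intro t ht d d' hd
    have hiff : (∃ k < t, a ≤ Z k d) ↔ ∃ k < t, a ≤ Z k d' := by
      refine exists_congr fun k => and_congr_right fun hk => ?_
      have ht' := Finset.mem_Icc.1 ht
      rw [hZ k (by omega) d d']
      rcases Nat.lt_or_ge (k + 1) t with h1 | h1
      · exact hd.of_lt (by simp only [Finset.mem_Icc]; omega) hh'.2
      · obtain rfl : t = k + 1 := by omega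
        exact hd
    funext p x
    simp only [Y', hiff, hY t ht d d' hd]
  have hY1' : ∀ t ∈ Finset.Icc 1 T, ∀ d, ∑' p, jointPolicy G cce φ lam β d t h (d.state t h) p *
      ∑' x, G.P h (d.state t h, p) x * Y' t d p x ≤ 1 := by
    intro t ht d
    by_cases hex : ∃ k < t, a ≤ Z k d
    · simp [Y', hex, PMF.tsum_coe]
    · simp only [Y', hex, if_false]
      exact hY1 t ht d
  have hint := hrun.lintegral_prod_le_one hh hY' hY1' T le_rfl
  have hmeas : Measurable fun ω => ∏ t ∈ Finset.Icc 1 T,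
      Y' t (D ω) ((D ω).act t h) ((D ω).state t (h + 1)) :=
    hrun.measurable_comp (H := G.H) (t := T + 1) (h := h)
      (W := fun d => ∏ t ∈ Finset.Icc 1 T, Y' t d (d.act t h) (d.state t (h + 1)))
      (prod_eq_of_agree hh hY')
  have hsub : {ω | ∃ n ≤ T, a ≤ Z n (D ω)} ⊆ {ω | a ≤ ∏ t ∈ Finset.Icc 1 T,
      Y' t (D ω) ((D ω).act t h) ((D ω).state t (h + 1))} := by
    rintro ω ⟨n₀, hn₀, ha₀⟩
    have hex : ∃ n, a ≤ Z n (D ω) := ⟨n₀, ha₀⟩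
    set n := Nat.find hex
    have hn : n ≤ T := (Nat.find_min' hex ha₀).trans hn₀
    have hle : a ≤ Z n (D ω) := Nat.find_spec hex
    have hprod : ∏ t ∈ Finset.Icc 1 T, Y' t (D ω) ((D ω).act t h) ((D ω).state t (h + 1)) =
        Z n (D ω) := by
      rw [← Finset.prod_subset (Finset.Icc_subset_Icc_right hn)]
      · refine Finset.prod_congr rfl fun t ht => ?_
        have : ¬ ∃ k < t, a ≤ Z k (D ω) := by
          rintro ⟨k, hk, hka⟩
          have := Nat.find_min' hex hka
          have := (Finset.mem_Icc.1 ht).2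
          omega
        simp only [Y', this, if_false]
      · intro t ht htn
        have : ∃ k < t, a ≤ Z k (D ω) := ⟨n, by
          simp only [Finset.mem_Icc] at ht htn
          omega, hle⟩
        simp only [Y', this, if_true]
    rw [Set.mem_ofPred_eq, hprod]
    exact hle
  refine (MeasureTheory.measure_mono hsub).trans
    ((MeasureTheory.meas_ge_le_lintegral_div hmeas.aemeasurable ha ha').trans ?_)
  rw [div_eq_mul_inv]
  exact (mul_le_mul_left hint _).trans_eq (one_mul _)

end Ville

/-! ### Ridge regression and confidence regions -/

section Ridge

variable {S A E : Type*} [NormedAddCommGroup E] [InnerProductSpace ℝ E] {φ : S → S × A × A → E}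
  {lam : ℝ} {D : Data S A} {h : ℕ} {V : ℕ → S → ℝ}

/-- The regression features `φ_{V^τ}(z_h^τ)`. -/
noncomputable def regFeature (φ : S → S × A × A → E) (D : Data S A) (h : ℕ) (V : ℕ → S → ℝ)
    (τ : ℕ) : E :=
  featureOf φ (V τ) (D.z τ h)

theorem energy_sub (hl : 0 < lam) (f : ℕ → E) (n : ℕ) (b θ : E) :
    energy lam f n (θ - resolvent lam f n b) =
      energy lam f n θ - 2 * inner ℝ b θ + potential lam f n b := by
  rw [← inner_design_self, design_sub, design_resolvent hl, inner_sub_left, inner_sub_right,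
    inner_design_self, inner_design_comm, design_resolvent hl, inner_sub_right, potential,
    real_inner_comm b θ]
  ring

/-- Completing the square; the second bracket does not involve `θ`. -/
theorem ridgeLoss_eq (hl : 0 < lam) (t : ℕ) (θ : E) :
    ridgeLoss φ lam D h V t θ =
      energy lam (regFeature φ D h V) (t - 1) (θ - resolvent lam (regFeature φ D h V) (t - 1)
        (∑ τ ∈ Finset.Icc 1 (t - 1), V τ (D.state τ (h + 1)) • regFeature φ D h V τ)) +
      (∑ τ ∈ Finset.Icc 1 (t - 1), V τ (D.state τ (h + 1)) ^ 2 -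
        potential lam (regFeature φ D h V) (t - 1)
          (∑ τ ∈ Finset.Icc 1 (t - 1), V τ (D.state τ (h + 1)) • regFeature φ D h V τ)) := by
  rw [energy_sub hl, sum_inner]
  simp only [ridgeLoss, energy, inner_smul_left, conj_trivial]
  have : ∀ τ, (V τ (D.state τ (h + 1)) - inner ℝ (featureOf φ (V τ) (D.z τ h)) θ) ^ 2 =
      V τ (D.state τ (h + 1)) ^ 2 - 2 * (V τ (D.state τ (h + 1)) *
        inner ℝ (regFeature φ D h V τ) θ) + inner ℝ (regFeature φ D h V τ) θ ^ 2 := fun τ => by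
    rw [regFeature]
    ring
  simp only [this, Finset.sum_add_distrib, Finset.sum_sub_distrib, ← Finset.mul_sum]
  ring

/-- The completed square exhibits a minimizer explicitly, so none has to be found by compactness or
completeness; `lam > 0` makes it the only one, which pins down the choice made by
`Classical.epsilon`. -/
theorem ridge_eq (hl : 0 < lam) (t : ℕ) :
    ridge φ lam D h V t = resolvent lam (regFeature φ D h V) (t - 1)
      (∑ τ ∈ Finset.Icc 1 (t - 1), V τ (D.state τ (h + 1)) • regFeature φ D h V τ) := by
  set f := regFeature φ D h V
  set θ₀ := resolvent lam f (t - 1)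
    (∑ τ ∈ Finset.Icc 1 (t - 1), V τ (D.state τ (h + 1)) • f τ) with hθ₀
  have hex : ∃ θ : E, ∀ θ' : E, ridgeLoss φ lam D h V t θ ≤ ridgeLoss φ lam D h V t θ' :=
    ⟨θ₀, fun θ' => by
      rw [ridgeLoss_eq hl, ridgeLoss_eq hl, ← hθ₀, sub_self]
      have := energy_nonneg (f := f) hl (t - 1) (θ' - θ₀)
      have h0 : energy lam f (t - 1) 0 = 0 := by simp [energy]
      linarith⟩
  have hspec := Classical.epsilon_spec hex θ₀
  change ridgeLoss φ lam D h V t (ridge φ lam D h V t) ≤ _ at hspec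
  rw [ridgeLoss_eq hl, ridgeLoss_eq hl, ← hθ₀, sub_self] at hspec
  have h0 : energy lam f (t - 1) 0 = 0 := by simp [energy]
  have h1 : lam * ‖ridge φ lam D h V t - θ₀‖ ^ 2 ≤
      energy lam f (t - 1) (ridge φ lam D h V t - θ₀) :=
    le_add_of_nonneg_right (Finset.sum_nonneg fun _ _ => sq_nonneg _)
  have h2 : lam * ‖ridge φ lam D h V t - θ₀‖ ^ 2 ≤ 0 := by linarith
  have h3 : ‖ridge φ lam D h V t - θ₀‖ ^ 2 = 0 :=
    le_antisymm (nonpos_of_mul_nonpos_right h2 hl) (sq_nonneg _)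
  exact sub_eq_zero.1 (norm_eq_zero.1 (pow_eq_zero_iff two_ne_zero |>.1 h3))

theorem mem_confRegion_iff {t : ℕ} {b : ℝ} {θ : E} : θ ∈ confRegion φ lam D h V t b ↔
    Real.sqrt (energy lam (regFeature φ D h V) (t - 1) (θ - ridge φ lam D h V t)) ≤ b := Iff.rfl

theorem abs_inner_sub_ridge_le (hl : 0 < lam) {t : ℕ} {b : ℝ} {θ : E}
    (hθ : θ ∈ confRegion φ lam D h V t b) (x : E) :
    |(inner ℝ x θ : ℝ) - inner ℝ x (ridge φ lam D h V t)| ≤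
      b * Real.sqrt (potential lam (regFeature φ D h V) (t - 1) x) := by
  rw [← inner_sub_right]
  exact abs_inner_le_sqrt_potential_mul hl _ _ _ (mem_confRegion_iff.1 hθ)

/-- Both `θ` and any competitor are within one radius of the ridge solution, whence the factor 2.
The member `θ` also makes the region nonempty, as the supremum requires. -/
theorem sSup_confRegion (hl : 0 < lam) {t : ℕ} {b : ℝ} {θ : E}
    (hθ : θ ∈ confRegion φ lam D h V t b) (x : E) :
    inner ℝ x θ ≤ sSup ((fun θ' => (inner ℝ x θ' : ℝ)) '' confRegion φ lam D h V t b) ∧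
    sSup ((fun θ' => (inner ℝ x θ' : ℝ)) '' confRegion φ lam D h V t b) ≤ inner ℝ x θ +
      2 * b * Real.sqrt (potential lam (regFeature φ D h V) (t - 1) x) := by
  have h0 := abs_le.1 (abs_inner_sub_ridge_le hl hθ x)
  constructor
  · refine le_csSup ⟨inner ℝ x (ridge φ lam D h V t) +
      b * Real.sqrt (potential lam (regFeature φ D h V) (t - 1) x), ?_⟩ ⟨θ, hθ, rfl⟩
    rintro _ ⟨θ', hθ', rfl⟩
    have := abs_le.1 (abs_inner_sub_ridge_le hl hθ' x)
    simp only
    linarith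
  · refine csSup_le ⟨_, θ, hθ, rfl⟩ ?_
    rintro _ ⟨θ', hθ', rfl⟩
    have := abs_le.1 (abs_inner_sub_ridge_le hl hθ' x)
    simp only
    linarith

theorem sInf_confRegion (hl : 0 < lam) {t : ℕ} {b : ℝ} {θ : E}
    (hθ : θ ∈ confRegion φ lam D h V t b) (x : E) :
    sInf ((fun θ' => (inner ℝ x θ' : ℝ)) '' confRegion φ lam D h V t b) ≤ inner ℝ x θ ∧
    inner ℝ x θ - 2 * b * Real.sqrt (potential lam (regFeature φ D h V) (t - 1) x) ≤
      sInf ((fun θ' => (inner ℝ x θ' : ℝ)) '' confRegion φ lam D h V t b) := by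
  have h0 := abs_le.1 (abs_inner_sub_ridge_le hl hθ x)
  constructor
  · refine csInf_le ⟨inner ℝ x (ridge φ lam D h V t) -
      b * Real.sqrt (potential lam (regFeature φ D h V) (t - 1) x), ?_⟩ ⟨θ, hθ, rfl⟩
    rintro _ ⟨θ', hθ', rfl⟩
    have := abs_le.1 (abs_inner_sub_ridge_le hl hθ' x)
    simp only
    linarith
  · refine le_csInf ⟨_, θ, hθ, rfl⟩ ?_
    rintro _ ⟨θ', hθ', rfl⟩
    have := abs_le.1 (abs_inner_sub_ridge_le hl hθ' x)
    simp only
    linarith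

/-- Bias-variance decomposition of the ridge regression error; `m τ` is the conditional mean of
the response in episode `τ`. -/
theorem energy_sub_ridge_le (hl : 0 < lam) (t : ℕ) (θ : E) (m : ℕ → ℝ) {M : ℝ}
    (hm : ∀ τ, |m τ - inner ℝ (regFeature φ D h V τ) θ| ≤ M) :
    energy lam (regFeature φ D h V) (t - 1) (θ - ridge φ lam D h V t) ≤
      3 * (lam * ‖θ‖ ^ 2 + potential lam (regFeature φ D h V) (t - 1)
        (∑ τ ∈ Finset.Icc 1 (t - 1), (V τ (D.state τ (h + 1)) - m τ) • regFeature φ D h V τ) +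
        (t - 1 : ℕ) * M ^ 2) := by
  set f := regFeature φ D h V
  set n := t - 1
  -- Normal equations: applied to the error, the design operator gives regularization minus noise
  -- minus model bias.
  have hdec : design lam f n (θ - ridge φ lam D h V t) = lam • θ +
      -(∑ τ ∈ Finset.Icc 1 n, (V τ (D.state τ (h + 1)) - m τ) • f τ) +
      -(∑ τ ∈ Finset.Icc 1 n, (m τ - inner ℝ (f τ) θ) • f τ) := by
    rw [design_sub, ridge_eq hl, design_resolvent hl, design, ← Finset.sum_neg_distrib,
      ← Finset.sum_neg_distrib, add_assoc, add_sub_assoc, ← Finset.sum_sub_distrib,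
      ← Finset.sum_add_distrib]
    congr 1
    refine Finset.sum_congr rfl fun τ _ => ?_
    simp only [sub_smul]
    abel
  rw [energy_eq_potential hl, hdec]
  refine (potential_add_add_le hl n _ _ _).trans ?_
  rw [potential_neg, potential_neg]
  have h1 : potential lam f n (lam • θ) ≤ lam * ‖θ‖ ^ 2 := by
    refine (potential_le_norm_sq_div hl n _).trans_eq ?_
    rw [norm_smul, Real.norm_of_nonneg hl.le]
    field_simp
  have h2 : potential lam f n (∑ τ ∈ Finset.Icc 1 n, (m τ - inner ℝ (f τ) θ) • f τ) ≤
      n * M ^ 2 := by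
    refine (potential_sum_smul_le hl n _).trans ?_
    calc _ ≤ ∑ _τ ∈ Finset.Icc 1 n, M ^ 2 :=
          Finset.sum_le_sum fun τ _ => sq_le_sq' (abs_le.1 (hm τ)).1 (abs_le.1 (hm τ)).2
      _ = n * M ^ 2 := by simp
  linarith

end Ridge

/-! ### Adaptedness of the estimates to the past -/

section Dependence

variable {S A E : Type*} [NormedAddCommGroup E] [InnerProductSpace ℝ E] {φ : S → S × A × A → E}
  {G : MarkovGame S A} {cce : CCESolver S A} {lam : ℝ} {β : ℕ → ℝ}

theorem clip_mem_Icc (H : ℕ) (v : ℝ) : clip H v ∈ Set.Icc (-(H : ℝ)) H := by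
  have : (0 : ℝ) ≤ H := Nat.cast_nonneg H
  exact ⟨le_max_left _ _, max_le (by linarith) (min_le_left _ _)⟩

theorem valueEst_mem_Icc (D : Data S A) (k t : ℕ) (x : S) :
    (valueEst G cce φ lam β D k t).1 x ∈ Set.Icc (-(G.H : ℝ)) G.H ∧
    (valueEst G cce φ lam β D k t).2 x ∈ Set.Icc (-(G.H : ℝ)) G.H := by
  have : (0 : ℝ) ≤ G.H := Nat.cast_nonneg _
  cases k with
  | zero => simp [valueEst]
  | succ k => exact ⟨expect_mem_Icc fun p => clip_mem_Icc _ _,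
      expect_mem_Icc fun p => clip_mem_Icc _ _⟩

variable {d d' : Data S A} {t h : ℕ}

theorem confRegion_congr {h : ℕ} {V V' : ℕ → S → ℝ} {τ : ℕ} {b : ℝ}
    (hV : ∀ i ∈ Finset.Icc 1 (τ - 1), V i = V' i)
    (hs : ∀ i ∈ Finset.Icc 1 (τ - 1), d.state i (h + 1) = d'.state i (h + 1))
    (hz : ∀ i ∈ Finset.Icc 1 (τ - 1), d.z i h = d'.z i h) :
    confRegion φ lam d h V τ b = confRegion φ lam d' h V' τ b := by
  have h1 : ridgeLoss φ lam d h V τ = ridgeLoss φ lam d' h V' τ := by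
    funext θ
    simp only [ridgeLoss]
    congr 1
    exact Finset.sum_congr rfl fun i hi => by rw [hV i hi, hs i hi, hz i hi]
  have h2 : ridge φ lam d h V τ = ridge φ lam d' h V' τ := by
    simp only [ridge, h1]
  ext θ
  simp only [confRegion, Set.mem_ofPred_eq, h2]
  rw [Finset.sum_congr rfl fun i hi => by rw [hV i hi, hz i hi]]

theorem AgreeBeforeAction.z_eq (hd : AgreeBeforeAction G.H t h d d') {i j : ℕ}
    (hi : i ∈ Finset.Icc 1 (t - 1)) (hj : j ∈ Finset.Icc 1 G.H) : d.z i j = d'.z i j := by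
  have hj' := Finset.mem_Icc.1 hj
  rw [Data.z, Data.z, hd.1 i hi j (by simp only [Finset.mem_Icc]; omega), hd.2.1 i hi j hj]

theorem AgreeBeforeAction.confRegion_eq (hd : AgreeBeforeAction G.H t h d d') {j τ : ℕ}
    (hj : j ∈ Finset.Icc 1 G.H) (hτ : τ ≤ t) {V V' : ℕ → S → ℝ} {b : ℝ}
    (hV : ∀ i ≤ τ, V i = V' i) :
    confRegion φ lam d j V τ b = confRegion φ lam d' j V' τ b := by
  have hsub : ∀ i ∈ Finset.Icc 1 (τ - 1), i ∈ Finset.Icc 1 (t - 1) := fun i hi => by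
    simp only [Finset.mem_Icc] at hi ⊢
    omega
  have hj' := Finset.mem_Icc.1 hj
  refine confRegion_congr (fun i hi => hV i ?_)
    (fun i hi => hd.1 i (hsub i hi) _ (by simp only [Finset.mem_Icc]; omega))
    (fun i hi => hd.z_eq (hsub i hi) hj)
  have := Finset.mem_Icc.1 hi
  omega

/-- This predictability is what lets the estimates enter the factors of Ville's inequality. All `τ ≤
t` are needed, since the regression of an episode uses the estimates of all earlier ones. -/
theorem AgreeBeforeAction.valueEst_eq (hd : AgreeBeforeAction G.H t h d d') {k τ : ℕ}
    (hk : k ≤ G.H) (hτ : τ ≤ t) :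
    valueEst G cce φ lam β d k τ = valueEst G cce φ lam β d' k τ := by
  induction k generalizing τ with
  | zero => rfl
  | succ k ih =>
    have ih' : ∀ i ≤ τ, valueEst G cce φ lam β d k i = valueEst G cce φ lam β d' k i :=
      fun i hi => ih (by omega) (hi.trans hτ)
    have hj : G.H - k ∈ Finset.Icc 1 G.H := by simp only [Finset.mem_Icc]; omega
    have hu := hd.confRegion_eq (φ := φ) (lam := lam) (b := β τ) hj hτ
      (V := fun i => (valueEst G cce φ lam β d k i).1)
      (V' := fun i => (valueEst G cce φ lam β d' k i).1) fun i hi => by simp only [ih' i hi]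
    have hl := hd.confRegion_eq (φ := φ) (lam := lam) (b := β τ) hj hτ
      (V := fun i => (valueEst G cce φ lam β d k i).2)
      (V' := fun i => (valueEst G cce φ lam β d' k i).2) fun i hi => by simp only [ih' i hi]
    have hQu : upperQ G φ lam β d (G.H - k) (fun i => (valueEst G cce φ lam β d k i).1) τ =
        upperQ G φ lam β d' (G.H - k) (fun i => (valueEst G cce φ lam β d' k i).1) τ := by
      funext z
      simp only [upperQ, hu, ih' τ le_rfl]
    have hQl : lowerQ G φ lam β d (G.H - k) (fun i => (valueEst G cce φ lam β d k i).2) τ =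
        lowerQ G φ lam β d' (G.H - k) (fun i => (valueEst G cce φ lam β d' k i).2) τ := by
      funext z
      simp only [lowerQ, hl, ih' τ le_rfl]
    simp only [valueEst, hQu, hQl]

/-- The optimistic action-value estimate of step `h` in episode `t`. -/
noncomputable def qUpper (G : MarkovGame S A) (cce : CCESolver S A) (φ : S → S × A × A → E)
    (lam : ℝ) (β : ℕ → ℝ) (D : Data S A) (h t : ℕ) : S × A × A → ℝ :=
  upperQ G φ lam β D h (fun τ => (valueEst G cce φ lam β D (G.H - h) τ).1) t

/-- The pessimistic action-value estimate of step `h` in episode `t`. -/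
noncomputable def qLower (G : MarkovGame S A) (cce : CCESolver S A) (φ : S → S × A × A → E)
    (lam : ℝ) (β : ℕ → ℝ) (D : Data S A) (h t : ℕ) : S × A × A → ℝ :=
  lowerQ G φ lam β D h (fun τ => (valueEst G cce φ lam β D (G.H - h) τ).2) t

theorem AgreeBeforeAction.qUpper_eq (hd : AgreeBeforeAction G.H t h d d') {j : ℕ}
    (hj : j ∈ Finset.Icc 1 G.H) :
    qUpper G cce φ lam β d j t = qUpper G cce φ lam β d' j t := by
  have h1 : ∀ i ≤ t, (valueEst G cce φ lam β d (G.H - j) i) =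
      (valueEst G cce φ lam β d' (G.H - j) i) := fun i hi => hd.valueEst_eq (by omega) hi
  funext z
  simp only [qUpper, upperQ, h1 t le_rfl]
  rw [hd.confRegion_eq (V' := fun i => (valueEst G cce φ lam β d' (G.H - j) i).1) hj le_rfl
    fun i hi => by simp only [h1 i hi]]

theorem AgreeBeforeAction.qLower_eq (hd : AgreeBeforeAction G.H t h d d') {j : ℕ}
    (hj : j ∈ Finset.Icc 1 G.H) :
    qLower G cce φ lam β d j t = qLower G cce φ lam β d' j t := by
  have h1 : ∀ i ≤ t, (valueEst G cce φ lam β d (G.H - j) i) =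
      (valueEst G cce φ lam β d' (G.H - j) i) := fun i hi => hd.valueEst_eq (by omega) hi
  funext z
  simp only [qLower, lowerQ, h1 t le_rfl]
  rw [hd.confRegion_eq (V' := fun i => (valueEst G cce φ lam β d' (G.H - j) i).2) hj le_rfl
    fun i hi => by simp only [h1 i hi]]

theorem jointPolicy_eq (D : Data S A) (t h : ℕ) (x : S) : jointPolicy G cce φ lam β D t h x =
    cce.find (qUpper G cce φ lam β D h t) (qLower G cce φ lam β D h t) x := rfl

theorem AgreeBeforeAction.jointPolicy_eq (hd : AgreeBeforeAction G.H t h d d') {j : ℕ}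
    (hj : j ∈ Finset.Icc 1 G.H) (x : S) :
    jointPolicy G cce φ lam β d t j x = jointPolicy G cce φ lam β d' t j x := by
  rw [KernelMG.jointPolicy_eq, KernelMG.jointPolicy_eq, hd.qUpper_eq hj, hd.qLower_eq hj]

theorem AgreeBeforeAction.state_eq (hd : AgreeBeforeAction G.H t h d d')
    (hh : h ∈ Finset.Icc 1 G.H) : d.state t h = d'.state t h :=
  hd.2.2.1 h (by have := Finset.mem_Icc.1 hh; simp only [Finset.mem_Icc]; omega)

end Dependence

/-! ### Self-normalized and Azuma–Hoeffding bounds -/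

section Concentration

variable {S A E : Type*} [NormedAddCommGroup E] [InnerProductSpace ℝ E] {φ : S → S × A × A → E}

theorem prod_Icc_one_eq_prod_range {M : Type*} [CommMonoid M] (F : ℕ → M) (n : ℕ) :
    ∏ t ∈ Finset.Icc 1 n, F t = ∏ i ∈ Finset.range n, F (i + 1) := by
  induction n with
  | zero => simp
  | succ n ih => rw [Finset.prod_Icc_succ_top (by omega), ih, Finset.prod_range_succ]

theorem exp_div_sqrt_one_add (x : ℝ) {w : ℝ} (hw : 0 ≤ w) :
    Real.exp x / Real.sqrt (1 + w) = Real.exp (x - Real.log (1 + w) / 2) := by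
  rw [Real.exp_sub, Real.exp_half, Real.exp_log (by positivity)]

variable {Ω : Type*} [MeasurableSpace Ω] {μ : MeasureTheory.Measure Ω}
  [MeasureTheory.IsProbabilityMeasure μ] [Countable S] [Finite A]
  {G : MarkovGame S A} {cce : CCESolver S A} {lam : ℝ} {β : ℕ → ℝ} {T : ℕ} {D : Ω → Data S A}

theorem ofReal_exp_inv (L : ℝ) :
    (ENNReal.ofReal (Real.exp L))⁻¹ = ENNReal.ofReal (Real.exp (-L)) := by
  rw [Real.exp_neg, ENNReal.ofReal_inv_of_pos (Real.exp_pos _)]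

/-- The centered and normalized response of episode `τ` in the regression of step `h`. -/
noncomputable def noise (G : MarkovGame S A) (d : Data S A) (h : ℕ) (V : ℕ → S → ℝ) (τ : ℕ) : ℝ :=
  (V τ (d.state τ (h + 1)) - expect (G.P h (d.z τ h)) (V τ)) / G.H

theorem IsRun.measure_potential_noise_le (hrun : IsRun μ G cce φ lam β T D)
    (hφ : BoundedFeatures φ) (hl : 0 < lam) {h : ℕ} (hh : h ∈ Finset.Icc 1 G.H)
    {V : Data S A → ℕ → S → ℝ}
    (hV1 : ∀ t d d', AgreeBeforeAction G.H t h d d' → ∀ τ ≤ t, V d τ = V d' τ)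
    (hV2 : ∀ d τ s, V d τ s ∈ Set.Icc (-(G.H : ℝ)) G.H) (L : ℝ) :
    μ {ω | ∃ n ≤ T, 2 * L + 2 * effDim φ G.H T lam ≤
      potential lam (regFeature φ (D ω) h (V (D ω))) n (∑ i ∈ Finset.Icc 1 n,
        noise G (D ω) h (V (D ω)) i • regFeature φ (D ω) h (V (D ω)) i)} ≤
      ENNReal.ofReal (Real.exp (-L)) := by
  have hH : (0 : ℝ) < G.H := by exact_mod_cast G.one_le_H
  let f : Data S A → ℕ → E := fun d => regFeature φ d h (V d)
  let e : Data S A → ℕ → ℝ := fun d => noise G d h (V d)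
  -- The current feature depends on the action `p`, drawn before the next state: for each fixed `p`
  -- the sum over next states is at most 1, and averaging over `p` keeps the bound.
  let g : ℕ → Data S A → A × A → E := fun t d p => featureOf φ (V d t) (d.state t h, p)
  let u : ℕ → Data S A → E → ℝ := fun n d x =>
    inner ℝ (∑ j ∈ Finset.Icc 1 n, e d j • f d j) (resolvent lam (f d) n x)
  let w : ℕ → Data S A → E → ℝ := fun n d x => potential lam (f d) n x
  let inc : ℝ → ℝ → ℝ → ℝ := fun e u w =>
    Real.exp ((2 * e * u + e ^ 2 * w - u ^ 2) / (2 * (1 + w))) / Real.sqrt (1 + w)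
  let Y : ℕ → Data S A → A × A → S → ENNReal := fun t d p x => ENNReal.ofReal (inc
    ((V d t x - expect (G.P h (d.state t h, p)) (V d t)) / G.H)
    (u (t - 1) d (g t d p)) (w (t - 1) d (g t d p)))
  have hY : ∀ t ∈ Finset.Icc 1 T, ∀ d d', AgreeBeforeAction G.H t h d d' → Y t d = Y t d' := by
    intro t ht d d' hd
    have hV := hV1 t d d' hd
    have hs := hd.state_eq hh
    have hf : ∀ i ∈ Finset.Icc 1 (t - 1), f d i = f d' i := fun i hi => by
      simp only [f, regFeature]
      rw [hV i (by have := Finset.mem_Icc.1 hi; omega), hd.z_eq hi hh]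
    have he : ∀ i ∈ Finset.Icc 1 (t - 1), e d i = e d' i := fun i hi => by
      simp only [e, noise]
      rw [hV i (by have := Finset.mem_Icc.1 hi; omega), hd.z_eq hi hh, hd.1 i hi (h + 1)
        (by have := Finset.mem_Icc.1 hh; simp only [Finset.mem_Icc]; omega)]
    have hg : g t d = g t d' := by
      funext p
      simp only [g]
      rw [hV t le_rfl, hs]
    have hu : u (t - 1) d = u (t - 1) d' := by
      funext x
      simp only [u]
      rw [resolvent_congr hf, Finset.sum_congr rfl fun i hi => by rw [hf i hi, he i hi]]
    have hw : w (t - 1) d = w (t - 1) d' := by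
      funext x
      simp only [w, potential]
      rw [resolvent_congr hf]
    funext p x
    simp only [Y]
    rw [hu, hw, hg, hs, hV t le_rfl]
  have hY1 : ∀ t ∈ Finset.Icc 1 T, ∀ d, ∑' p, jointPolicy G cce φ lam β d t h (d.state t h) p *
      ∑' x, G.P h (d.state t h, p) x * Y t d p x ≤ 1 := by
    intro t _ d
    calc _ ≤ ∑' p, jointPolicy G cce φ lam β d t h (d.state t h) p * 1 := by
          gcongr with p
          exact tsum_selfNormalized_le_one (G.P h (d.state t h, p)) hH (hV2 d t) _
            (potential_nonneg hl _ _)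
      _ = 1 := by simp [PMF.tsum_coe]
  have hville := hrun.measure_exists_prod_ge_le hh hY hY1 (a := ENNReal.ofReal (Real.exp L))
    (by simpa using Real.exp_pos L) ENNReal.ofReal_ne_top
  rw [ofReal_exp_inv] at hville
  refine (MeasureTheory.measure_mono ?_).trans hville
  rintro ω ⟨n, hn, hpot⟩
  refine ⟨n, hn, ?_⟩
  set d := D ω
  have hw0 : ∀ i, 0 ≤ w i d (f d (i + 1)) := fun i => potential_nonneg hl _ _
  have hprod : ∏ t ∈ Finset.Icc 1 n, Y t d (d.act t h) (d.state t (h + 1)) =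
      ENNReal.ofReal (Real.exp (∑ i ∈ Finset.range n,
        ((2 * e d (i + 1) * u i d (f d (i + 1)) + e d (i + 1) ^ 2 * w i d (f d (i + 1)) -
          u i d (f d (i + 1)) ^ 2) / (2 * (1 + w i d (f d (i + 1)))) -
          Real.log (1 + w i d (f d (i + 1))) / 2))) := by
    rw [prod_Icc_one_eq_prod_range, Real.exp_sum,
      ENNReal.ofReal_prod_of_nonneg fun _ _ => (Real.exp_pos _).le]
    refine Finset.prod_congr rfl fun i _ => ?_
    rw [← exp_div_sqrt_one_add _ (hw0 i)]
    rfl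
  rw [hprod]
  refine ENNReal.ofReal_le_ofReal (Real.exp_le_exp.2 ?_)
  -- The logarithms are nonnegative, so a sum stopped at `n` is at most the full sum up to `T`.
  have hlog : ∑ i ∈ Finset.range n, Real.log (1 + w i d (f d (i + 1))) ≤
      2 * effDim φ G.H T lam := by
    refine le_trans ?_ (sum_log_one_add_potential_le hφ G.one_le_H T hl (V d) (hV2 d)
      (fun τ => d.z τ h) (f := f d) fun _ => rfl)
    refine Finset.sum_le_sum_of_subset_of_nonneg (Finset.range_subset_range.2 hn) fun i _ _ => ?_
    exact Real.log_nonneg (le_add_of_nonneg_right (hw0 i))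
  have hid := potential_selfNormalized (f := f d) hl (e d) n
  have hid2 : ∑ i ∈ Finset.range n,
      ((2 * e d (i + 1) * u i d (f d (i + 1)) + e d (i + 1) ^ 2 * w i d (f d (i + 1)) -
          u i d (f d (i + 1)) ^ 2) / (2 * (1 + w i d (f d (i + 1)))) -
          Real.log (1 + w i d (f d (i + 1))) / 2) =
      (potential lam (f d) n (∑ i ∈ Finset.Icc 1 n, e d i • f d i) -
        ∑ i ∈ Finset.range n, Real.log (1 + w i d (f d (i + 1)))) / 2 := by
    rw [hid, ← Finset.sum_sub_distrib, Finset.sum_div]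
    refine Finset.sum_congr rfl fun i _ => ?_
    simp only [w, u]
    rw [mul_comm (2 : ℝ) (1 + _), ← div_div, ← sub_div]
  rw [hid2]
  change 2 * L + 2 * effDim φ G.H T lam ≤
    potential lam (f d) n (∑ i ∈ Finset.Icc 1 n, e d i • f d i) at hpot
  linarith

/-- The deviation of `Q` and `U` from their conditional means, in episode `t` at step `h`. -/
noncomputable def deviation (G : MarkovGame S A) (cce : CCESolver S A) (φ : S → S × A × A → E)
    (lam : ℝ) (β : ℕ → ℝ) (d : Data S A) (h : ℕ) (Q : ℕ → S × A × A → ℝ) (U : ℕ → S → ℝ)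
    (t : ℕ) : ℝ :=
  expect (jointPolicy G cce φ lam β d t h (d.state t h)) (fun p => Q t (d.state t h, p)) -
    Q t (d.z t h) + (expect (G.P h (d.z t h)) (U t) - U t (d.state t (h + 1)))

/-- The **Azuma–Hoeffding inequality** along the episodes at a fixed step. -/
theorem IsRun.measure_sum_deviation_ge_le (hrun : IsRun μ G cce φ lam β T D)
    {h : ℕ} (hh : h ∈ Finset.Icc 1 G.H)
    {Q : Data S A → ℕ → S × A × A → ℝ} {U : Data S A → ℕ → S → ℝ}
    (hQ1 : ∀ t d d', AgreeBeforeAction G.H t h d d' → Q d t = Q d' t)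
    (hU1 : ∀ t d d', AgreeBeforeAction G.H t h d d' → U d t = U d' t)
    (hQ2 : ∀ d t z, Q d t z ∈ Set.Icc (0 : ℝ) (2 * G.H))
    (hU2 : ∀ d t s, U d t s ∈ Set.Icc (0 : ℝ) (2 * G.H)) (L s : ℝ) :
    μ {ω | L + T * (s ^ 2 * (G.H : ℝ) ^ 2) ≤ s * ∑ t ∈ Finset.Icc 1 T,
      deviation G cce φ lam β (D ω) h (Q (D ω)) (U (D ω)) t} ≤
      ENNReal.ofReal (Real.exp (-L)) := by
  -- Hoeffding's cost of one variable of range `2 H`. Each episode has two of them, the action and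
  -- the next state, which gives `T s² H²` in total. The exponents carry `-s` because a deviation is
  -- mean minus realized value.
  let K : ℝ := s ^ 2 * (G.H : ℝ) ^ 2 / 2
  let y1 : ℕ → Data S A → A × A → ENNReal := fun t d p => ENNReal.ofReal (Real.exp
    (-s * (Q d t (d.state t h, p) - expect (jointPolicy G cce φ lam β d t h (d.state t h))
      (fun p => Q d t (d.state t h, p)))))
  let y2 : ℕ → Data S A → A × A → S → ENNReal := fun t d p x => ENNReal.ofReal (Real.exp
    (-s * (U d t x - expect (G.P h (d.state t h, p)) (U d t))))
  let c : ENNReal := ENNReal.ofReal (Real.exp (-K))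
  let Y : ℕ → Data S A → A × A → S → ENNReal := fun t d p x => y1 t d p * c * (y2 t d p x * c)
  have hY : ∀ t ∈ Finset.Icc 1 T, ∀ d d', AgreeBeforeAction G.H t h d d' → Y t d = Y t d' := by
    intro t _ d d' hd
    funext p x
    simp only [Y, y1, y2, hQ1 t d d' hd, hU1 t d d' hd, hd.state_eq hh, hd.jointPolicy_eq hh]
  have hc : ENNReal.ofReal (Real.exp (((2 * G.H - 0) / 2) ^ 2 * (-s) ^ 2 / 2)) * c = 1 := by
    rw [← ENNReal.ofReal_mul (Real.exp_pos _).le, ← Real.exp_add]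
    have : ((2 * (G.H : ℝ) - 0) / 2) ^ 2 * (-s) ^ 2 / 2 + -K = 0 := by simp only [K]; ring
    rw [this]
    simp
  have hY1 : ∀ t ∈ Finset.Icc 1 T, ∀ d, ∑' p, jointPolicy G cce φ lam β d t h (d.state t h) p *
      ∑' x, G.P h (d.state t h, p) x * Y t d p x ≤ 1 := by
    intro t _ d
    have h2 : ∀ p, ∑' x, G.P h (d.state t h, p) x * Y t d p x ≤ y1 t d p * c := fun p => by
      calc ∑' x, G.P h (d.state t h, p) x * Y t d p x
          = y1 t d p * c * ((∑' x, G.P h (d.state t h, p) x * y2 t d p x) * c) := by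
            rw [← ENNReal.tsum_mul_right, ← ENNReal.tsum_mul_left]
            exact tsum_congr fun x => by simp only [Y]; ring
        _ ≤ y1 t d p * c * (ENNReal.ofReal
              (Real.exp (((2 * G.H - 0) / 2) ^ 2 * (-s) ^ 2 / 2)) * c) := by
            gcongr
            exact tsum_exp_centered_le _ (hU2 d t) (-s)
        _ = y1 t d p * c := by rw [hc, mul_one]
    calc _ ≤ ∑' p, jointPolicy G cce φ lam β d t h (d.state t h) p * (y1 t d p * c) := by
          gcongr with p
          exact h2 p
      _ = (∑' p, jointPolicy G cce φ lam β d t h (d.state t h) p * y1 t d p) * c := by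
          rw [← ENNReal.tsum_mul_right]
          exact tsum_congr fun p => by ring
      _ ≤ ENNReal.ofReal (Real.exp (((2 * G.H - 0) / 2) ^ 2 * (-s) ^ 2 / 2)) * c := by
          gcongr
          exact tsum_exp_centered_le _ (fun p => hQ2 d t (d.state t h, p)) (-s)
      _ = 1 := hc
  have hville := hrun.measure_exists_prod_ge_le hh hY hY1 (a := ENNReal.ofReal (Real.exp L))
    (by simpa using Real.exp_pos L) ENNReal.ofReal_ne_top
  rw [ofReal_exp_inv] at hville
  refine (MeasureTheory.measure_mono ?_).trans hville
  intro ω hω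
  refine ⟨T, le_rfl, ?_⟩
  set d := D ω with hd
  have hprod : ∏ t ∈ Finset.Icc 1 T, Y t d (d.act t h) (d.state t (h + 1)) =
      ENNReal.ofReal (Real.exp (∑ t ∈ Finset.Icc 1 T,
        (s * deviation G cce φ lam β d h (Q d) (U d) t - 2 * K))) := by
    rw [Real.exp_sum, ENNReal.ofReal_prod_of_nonneg fun _ _ => (Real.exp_pos _).le]
    refine Finset.prod_congr rfl fun t _ => ?_
    simp only [Y, y1, y2, c]
    rw [← ENNReal.ofReal_mul (Real.exp_pos _).le, ← ENNReal.ofReal_mul (Real.exp_pos _).le,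
      ← ENNReal.ofReal_mul (by positivity), ← Real.exp_add, ← Real.exp_add, ← Real.exp_add]
    congr 2
    simp only [deviation, Data.z]
    ring
  rw [hprod]
  refine ENNReal.ofReal_le_ofReal (Real.exp_le_exp.2 ?_)
  rw [Finset.sum_sub_distrib, ← Finset.mul_sum]
  have hω' : L + T * (s ^ 2 * (G.H : ℝ) ^ 2) ≤ s * ∑ t ∈ Finset.Icc 1 T,
      deviation G cce φ lam β d h (Q d) (U d) t := hω
  simp only [Finset.sum_const, Nat.card_Icc, nsmul_eq_mul, K, add_tsub_cancel_right]
  linarith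

end Concentration

/-! ### Values of Markov policies -/

section Bellman

theorem expect_comm {α γ : Type*} (p : PMF α) (q : PMF γ) {F : α → γ → ℝ} {C : ℝ}
    (hF : ∀ a b, |F a b| ≤ C) : expect p (fun a => expect q (F a)) =
      expect q (fun b => expect p fun a => F a b) := by
  have h1 := expect_bind p (fun a => q.bind fun b => PMF.pure (a, b))
    (f := fun ab : α × γ => F ab.1 ab.2) (C := C) fun _ _ ab _ => hF _ _
  have h2 := expect_bind q (fun b => p.bind fun a => PMF.pure (a, b))
    (f := fun ab : α × γ => F ab.1 ab.2) (C := C) fun _ _ ab _ => hF _ _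
  rw [PMF.bind_comm, h2] at h1
  have h3 : ∀ a, expect (q.bind fun b => PMF.pure (a, b)) (fun ab : α × γ => F ab.1 ab.2) =
      expect q (F a) := fun a => by
    rw [expect_bind (C := C) _ _ fun _ _ ab _ => hF _ _]
    simp only [expect_pure]
  have h4 : ∀ b, expect (p.bind fun a => PMF.pure (a, b)) (fun ab : α × γ => F ab.1 ab.2) =
      expect p (fun a => F a b) := fun b => by
    rw [expect_bind (C := C) _ _ fun _ _ ab _ => hF _ _]
    simp only [expect_pure]
  simp only [h3, h4] at h1
  exact h1.symm

variable {S A : Type*} (G : MarkovGame S A) (π ν : Policy S A)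

theorem MarkovGame.abs_r_le {h : ℕ} (hh : h ∈ Finset.Icc 1 G.H) (z : S × A × A) :
    |G.r h z| ≤ 1 := abs_le.2 (G.r_mem h hh z)

theorem MarkovGame.abs_totalReward_le (k h : ℕ) (h1 : 1 ≤ h) (hk : h + k ≤ G.H + 1) (x : S)
    (l : List (S × A × A)) (hl : G.playLaw π ν h k x l ≠ 0) : |G.totalReward h l| ≤ k := by
  induction k generalizing h x l with
  | zero =>
    have : l = [] := by simpa [MarkovGame.playLaw, PMF.pure_apply] using hl
    simp [this, MarkovGame.totalReward]
  | succ k ih =>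
    rw [← PMF.mem_support_iff, MarkovGame.playLaw] at hl
    simp only [PMF.mem_support_bind_iff, PMF.mem_support_map_iff] at hl
    obtain ⟨a, _, b, _, x', _, l', hl', rfl⟩ := hl
    have h2 := ih (h + 1) (by omega) (by omega) x' l' ((PMF.mem_support_iff _ _).1 hl')
    have h3 := G.abs_r_le (h := h) (by simp only [Finset.mem_Icc]; omega) (x, a, b)
    rw [MarkovGame.totalReward]
    refine (abs_add_le _ _).trans ?_
    push_cast
    linarith

theorem MarkovGame.value_end (x : S) : G.value π ν (G.H + 1) x = 0 := by
  simp [MarkovGame.value, MarkovGame.playLaw, expect_pure, MarkovGame.totalReward]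

theorem MarkovGame.abs_value_le_sub {h : ℕ} (h1 : 1 ≤ h) (hh : h ≤ G.H + 1) (x : S) :
    |G.value π ν h x| ≤ (G.H + 1 - h : ℕ) :=
  abs_expect_le fun l hl => G.abs_totalReward_le π ν _ h h1 (by omega) x l hl

theorem MarkovGame.abs_value_le {h : ℕ} (h1 : 1 ≤ h) (hh : h ≤ G.H + 1) (x : S) :
    |G.value π ν h x| ≤ G.H :=
  (G.abs_value_le_sub π ν h1 hh x).trans (by exact_mod_cast (by omega : G.H + 1 - h ≤ G.H))

/-- One reward now and at most `H - h` later: Bellman targets lie in `[-H, H]`, so clipping the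
estimates never cuts off a true value. -/
theorem MarkovGame.abs_reward_add_expect_value_le {h : ℕ} (hh : h ∈ Finset.Icc 1 G.H)
    (z : S × A × A) : |G.r h z + expect (G.P h z) (G.value π ν (h + 1))| ≤ G.H := by
  have hh' := Finset.mem_Icc.1 hh
  have h1 : |expect (G.P h z) (G.value π ν (h + 1))| ≤ (G.H + 1 - (h + 1) : ℕ) :=
    abs_expect_le fun s _ => G.abs_value_le_sub π ν (by omega) (by omega) s
  have h2 : ((G.H + 1 - (h + 1) : ℕ) : ℝ) + 1 ≤ G.H := by
    exact_mod_cast (by omega : G.H + 1 - (h + 1) + 1 ≤ G.H)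
  linarith [abs_add_le (G.r h z) (expect (G.P h z) (G.value π ν (h + 1))), G.abs_r_le hh z]

/-- The Bellman equation. -/
theorem MarkovGame.value_eq {h : ℕ} (hh : h ∈ Finset.Icc 1 G.H) (x : S) :
    G.value π ν h x = expect (π h x) fun a => expect (ν h x) fun b =>
      G.r h (x, a, b) + expect (G.P h (x, a, b)) (G.value π ν (h + 1)) := by
  have hh' := Finset.mem_Icc.1 hh
  obtain ⟨k, hk⟩ : ∃ k, G.H + 1 - h = k + 1 := ⟨G.H - h, by omega⟩
  have hk' : G.H + 1 - (h + 1) = k := by omega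
  have hb := G.abs_totalReward_le π ν (k + 1) h hh'.1 (by omega) x
  have hb' := G.abs_totalReward_le π ν k (h + 1) (by omega) (by omega)
  have hval : ∀ x', expect (G.playLaw π ν (h + 1) k x') (G.totalReward (h + 1)) =
      G.value π ν (h + 1) x' := fun x' => by rw [MarkovGame.value, hk']
  rw [MarkovGame.value, hk, MarkovGame.playLaw, expect_bind (C := (k + 1 : ℕ))]
  swap
  · intro a ha l hl
    refine hb l ((PMF.mem_support_iff _ _).1 ?_)
    rw [MarkovGame.playLaw]
    exact (PMF.mem_support_bind_iff _ _ _).2 ⟨a, ha, hl⟩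
  refine expect_congr fun a ha => ?_
  rw [expect_bind (C := (k + 1 : ℕ))]
  swap
  · intro b hb' l hl
    refine hb l ((PMF.mem_support_iff _ _).1 ?_)
    rw [MarkovGame.playLaw]
    exact (PMF.mem_support_bind_iff _ _ _).2 ⟨a, ha, (PMF.mem_support_bind_iff _ _ _).2 ⟨b, hb', hl⟩⟩
  refine expect_congr fun b hb₁ => ?_
  have hsum : ∀ x' l, G.playLaw π ν (h + 1) k x' l ≠ 0 →
      |G.totalReward h ((x, a, b) :: l)| ≤ 1 + k := fun x' l hl => by
    rw [MarkovGame.totalReward]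
    exact (abs_add_le _ _).trans (add_le_add (G.abs_r_le hh _) (hb' x' l hl))
  rw [expect_bind (C := 1 + k)]
  swap
  · intro x' hx' l hl
    obtain ⟨l', hl', rfl⟩ := (PMF.mem_support_map_iff _ _ _).1 ((PMF.mem_support_iff _ _).2 hl)
    exact hsum x' l' ((PMF.mem_support_iff _ _).1 hl')
  have hstep : ∀ x', expect ((G.playLaw π ν (h + 1) k x').map fun l => (x, a, b) :: l)
      (G.totalReward h) = G.r h (x, a, b) + G.value π ν (h + 1) x' := fun x' => by
    rw [expect_map _ _ (hsum x'), ← hval, ← expect_const_add (hb' x')]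
    rfl
  simp only [hstep]
  exact expect_const_add (C := G.H) (fun x' _ => G.abs_value_le π ν (by omega) (by omega) x') _

end Bellman

/-! ### Optimism and pessimism under coverage -/

section Optimism

variable {S A E : Type*} [NormedAddCommGroup E] [InnerProductSpace ℝ E] {φ : S → S × A × A → E}
  {G : MarkovGame S A} {cce : CCESolver S A} {lam : ℝ} {β : ℕ → ℝ} {d : Data S A} {t : ℕ}
  {θ : ℕ → E} {B ι : ℝ}

theorem le_clip_add {H : ℕ} {y v a : ℝ} (hy : y ≤ H) (ha : 0 ≤ a) (h : y ≤ v + a) :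
    y ≤ clip H v + a :=
  sub_le_iff_le_add.1 <|
  le_max_of_le_right (le_min (by linarith) (by linarith))

theorem clip_le {H : ℕ} {y v a : ℝ} (hy : -(H : ℝ) ≤ y) (ha : 0 ≤ a) (h : v ≤ y + a) :
    clip H v ≤ y + a :=
  max_le (by linarith) ((min_le_right _ _).trans h)

theorem clip_sub_clip_le (H : ℕ) {u v c : ℝ} (hc : 0 ≤ c) (h : u - v ≤ c) :
    clip H u - clip H v ≤ c := by
  have h1 : clip H u ≤ clip H (v + c) :=
    max_le_max le_rfl (min_le_min le_rfl (by linarith))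
  have h2 : clip H (v + c) ≤ clip H v + c := by
    refine max_le ?_ ?_
    · have := le_max_left (-(H : ℝ)) (min (H : ℝ) v)
      simp only [clip]
      linarith
    · have h3 := le_max_right (-(H : ℝ)) (min (H : ℝ) v)
      have h4 : min (H : ℝ) (v + c) ≤ min (H : ℝ) v + c := by
        rw [← min_add_add_right]
        exact min_le_min (by linarith) le_rfl
      simp only [clip]
      linarith
  linarith

theorem qUpper_mem_Icc (h t : ℕ) (z : S × A × A) :
    qUpper G cce φ lam β d h t z ∈ Set.Icc (-(G.H : ℝ)) G.H := clip_mem_Icc _ _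

theorem qLower_mem_Icc (h t : ℕ) (z : S × A × A) :
    qLower G cce φ lam β d h t z ∈ Set.Icc (-(G.H : ℝ)) G.H := clip_mem_Icc _ _

theorem valueEst_eq_expect {h : ℕ} (hh : h ∈ Finset.Icc 1 G.H) (x : S) :
    (valueEst G cce φ lam β d (G.H + 1 - h) t).1 x =
      expect (jointPolicy G cce φ lam β d t h x) (fun p => qUpper G cce φ lam β d h t (x, p)) ∧
    (valueEst G cce φ lam β d (G.H + 1 - h) t).2 x =
      expect (jointPolicy G cce φ lam β d t h x) (fun p => qLower G cce φ lam β d h t (x, p)) := by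
  obtain ⟨k, rfl, hk⟩ : ∃ k, h = G.H - k ∧ k < G.H :=
    ⟨G.H - h, by have := Finset.mem_Icc.1 hh; omega, by have := Finset.mem_Icc.1 hh; omega⟩
  have h1 : G.H + 1 - (G.H - k) = k + 1 := by omega
  have h2 : G.H - (G.H - k) = k := by omega
  rw [h1, jointPolicy_eq]
  simp only [qUpper, qLower, h2]
  exact ⟨rfl, rfl⟩

/-- The true parameters lie in both confidence regions of episode `t`, at all steps. -/
def Covered (G : MarkovGame S A) (cce : CCESolver S A) (φ : S → S × A × A → E) (lam : ℝ)
    (β : ℕ → ℝ) (d : Data S A) (θ : ℕ → E) (t : ℕ) : Prop :=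
  ∀ h ∈ Finset.Icc 1 G.H,
    θ h ∈ confRegion φ lam d h (fun τ => (valueEst G cce φ lam β d (G.H - h) τ).1) t (β t) ∧
    θ h ∈ confRegion φ lam d h (fun τ => (valueEst G cce φ lam β d (G.H - h) τ).2) t (β t)

/-- Backward induction over the steps to go. Replacing the transition law by the linear model costs
`H ι` at each step, and the true parameter is a competitor in the supremum. For each fixed action of
`π` the equilibrium inequality then passes to the joint law. -/
theorem value_le_valueEst (hφ : BoundedFeatures φ) (hG : G.Misspecified φ θ B ι) (hι : 0 ≤ ι)
    (hl : 0 < lam) (hcov : Covered G cce φ lam β d θ t) (π : Policy S A) (k : ℕ) (hk : k ≤ G.H)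
    (x : S) : G.value π (policyTwo G cce φ lam β d t) (G.H + 1 - k) x ≤
      (valueEst G cce φ lam β d k t).1 x + k * (G.H * ι) := by
  have hH : (0 : ℝ) < G.H := by exact_mod_cast G.one_le_H
  induction k generalizing x with
  | zero => simp [MarkovGame.value_end, valueEst]
  | succ k ih =>
    obtain ⟨h, hh, rfl⟩ : ∃ h, h ∈ Finset.Icc 1 G.H ∧ k = G.H - h :=
      ⟨G.H - k, by simp only [Finset.mem_Icc]; omega, by omega⟩
    have hh' := Finset.mem_Icc.1 hh
    have e1 : G.H - h + 1 = G.H + 1 - h := by omega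
    have e2 : G.H + 1 - (G.H + 1 - h) = h := by omega
    have e3 : G.H + 1 - (G.H - h) = h + 1 := by omega
    rw [e1, e2, (valueEst_eq_expect hh x).1]
    set ν := policyTwo G cce φ lam β d t
    set V := fun τ => (valueEst G cce φ lam β d (G.H - h) τ).1 with hVdef
    set c : ℝ := ((G.H + 1 - h : ℕ) : ℝ) * (G.H * ι) with hc
    have hc0 : 0 ≤ c := by positivity
    have hc1 : c = ((G.H - h : ℕ) : ℝ) * (G.H * ι) + G.H * ι := by
      rw [hc, ← e1]
      push_cast
      ring
    have hval : ∀ x', |G.value π ν (h + 1) x'| ≤ G.H := fun x' =>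
      G.abs_value_le π ν (by omega) (by omega) x'
    have hVb : ∀ s, V t s ∈ Set.Icc (-(G.H : ℝ)) G.H := fun s => (valueEst_mem_Icc d _ t s).1
    have hQ : ∀ z, G.r h z + expect (G.P h z) (G.value π ν (h + 1)) ≤
        qUpper G cce φ lam β d h t z + c := fun z => by
      have h1 : expect (G.P h z) (G.value π ν (h + 1)) ≤
          expect (G.P h z) (V t) + (G.H - h : ℕ) * (G.H * ι) := by
        rw [← expect_add_const fun s => abs_le.2 (hVb s)]
        refine expect_mono hval (D := G.H + |((G.H - h : ℕ) : ℝ) * (G.H * ι)|)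
          (fun s => (abs_add_le _ _).trans (add_le_add (abs_le.2 (hVb s)) le_rfl)) fun s => ?_
        have := ih (by omega) s
        rwa [e3] at this
      have h2 := abs_le.1 (hG.abs_expect_sub_inner_le hφ hh hH hVb z)
      have h3 := (sSup_confRegion hl (hcov h hh).1 (featureOf φ (V t) z)).1
      have h4 := (abs_le.1 (G.abs_reward_add_expect_value_le π ν hh z)).2
      exact le_clip_add h4 hc0 (by rw [hc1]; linarith [h2.2])
    have hQb : ∀ z, |qUpper G cce φ lam β d h t z| ≤ G.H := fun z =>
      abs_le.2 (qUpper_mem_Icc h t z)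
    have hFb := G.abs_reward_add_expect_value_le π ν hh
    rw [G.value_eq π ν hh, ← expect_const (π h x)
      (expect (jointPolicy G cce φ lam β d t h x) (fun p => qUpper G cce φ lam β d h t (x, p)) + c)]
    refine expect_mono (fun a => abs_expect_le fun b _ => hFb _) (fun _ => le_rfl) fun a => ?_
    refine (expect_mono (fun b => hFb _) (fun b => (abs_add_le _ _).trans
      (add_le_add (hQb _) le_rfl)) fun b => hQ (x, a, b)).trans ?_
    rw [expect_add_const fun b => hQb _]
    -- A deviation to the fixed action `a` sees the joint law only through its second marginal,
    -- which is `ν^t`.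
    have := (cce.isCCE (qUpper G cce φ lam β d h t) (qLower G cce φ lam β d h t) x).1 a
    exact add_le_add this le_rfl

theorem valueEst_le_value (hφ : BoundedFeatures φ) (hG : G.Misspecified φ θ B ι) (hι : 0 ≤ ι)
    (hl : 0 < lam) (hcov : Covered G cce φ lam β d θ t) (ν : Policy S A) (k : ℕ) (hk : k ≤ G.H)
    (x : S) : (valueEst G cce φ lam β d k t).2 x ≤
      G.value (policyOne G cce φ lam β d t) ν (G.H + 1 - k) x + k * (G.H * ι) := by
  have hH : (0 : ℝ) < G.H := by exact_mod_cast G.one_le_H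
  induction k generalizing x with
  | zero => simp [MarkovGame.value_end, valueEst]
  | succ k ih =>
    obtain ⟨h, hh, rfl⟩ : ∃ h, h ∈ Finset.Icc 1 G.H ∧ k = G.H - h :=
      ⟨G.H - k, by simp only [Finset.mem_Icc]; omega, by omega⟩
    have hh' := Finset.mem_Icc.1 hh
    have e1 : G.H - h + 1 = G.H + 1 - h := by omega
    have e2 : G.H + 1 - (G.H + 1 - h) = h := by omega
    have e3 : G.H + 1 - (G.H - h) = h + 1 := by omega
    rw [e1, e2, (valueEst_eq_expect hh x).2]
    set π := policyOne G cce φ lam β d t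
    set V := fun τ => (valueEst G cce φ lam β d (G.H - h) τ).2 with hVdef
    set c : ℝ := ((G.H + 1 - h : ℕ) : ℝ) * (G.H * ι) with hc
    have hc0 : 0 ≤ c := by positivity
    have hc1 : c = ((G.H - h : ℕ) : ℝ) * (G.H * ι) + G.H * ι := by
      rw [hc, ← e1]
      push_cast
      ring
    have hval : ∀ x', |G.value π ν (h + 1) x'| ≤ G.H := fun x' =>
      G.abs_value_le π ν (by omega) (by omega) x'
    have hVb : ∀ s, V t s ∈ Set.Icc (-(G.H : ℝ)) G.H := fun s => (valueEst_mem_Icc d _ t s).2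
    have hQ : ∀ z, qLower G cce φ lam β d h t z ≤
        G.r h z + expect (G.P h z) (G.value π ν (h + 1)) + c := fun z => by
      have h1 : expect (G.P h z) (V t) ≤ expect (G.P h z) (G.value π ν (h + 1)) +
          (G.H - h : ℕ) * (G.H * ι) := by
        rw [← expect_add_const hval]
        refine expect_mono (fun s => abs_le.2 (hVb s))
          (D := G.H + |((G.H - h : ℕ) : ℝ) * (G.H * ι)|)
          (fun s => (abs_add_le _ _).trans (add_le_add (hval s) le_rfl)) fun s => ?_
        have := ih (by omega) s
        rwa [e3] at this
      have h2 := abs_le.1 (hG.abs_expect_sub_inner_le hφ hh hH hVb z)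
      have h3 := (sInf_confRegion hl (hcov h hh).2 (featureOf φ (V t) z)).1
      have h4 := (abs_le.1 (G.abs_reward_add_expect_value_le π ν hh z)).1
      exact clip_le h4 hc0 (by rw [hc1]; linarith [h2.1])
    have hQb : ∀ z, |qLower G cce φ lam β d h t z| ≤ G.H := fun z =>
      abs_le.2 (qLower_mem_Icc h t z)
    have hFb := G.abs_reward_add_expect_value_le π ν hh
    -- The deviating player is now the second one, so the averages are exchanged to fix `b` first.
    rw [G.value_eq π ν hh, expect_comm _ _ fun a b => hFb _, ← sub_le_iff_le_add,
      ← expect_const (ν h x)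
      (expect (jointPolicy G cce φ lam β d t h x) (fun p => qLower G cce φ lam β d h t (x, p)) - c)]
    refine expect_mono (fun _ => le_rfl) (fun b => abs_expect_le fun a _ => hFb _) fun b => ?_
    rw [sub_le_iff_le_add, ← expect_add_const fun a => hFb _]
    refine le_trans ?_ (expect_mono (fun a => hQb _) (fun a => (abs_add_le _ _).trans
      (add_le_add (hFb _) le_rfl)) fun a => hQ (x, a, b))
    exact (cce.isCCE (qUpper G cce φ lam β d h t) (qLower G cce φ lam β d h t) x).2 b

end Optimism

/-! ### Regret decomposition and elliptical potential -/

section Gap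

variable {S A E : Type*} [NormedAddCommGroup E] [InnerProductSpace ℝ E] {φ : S → S × A × A → E}
  {G : MarkovGame S A} {cce : CCESolver S A} {lam : ℝ} {β : ℕ → ℝ} {d : Data S A} {t : ℕ}
  {θ : ℕ → E} {B ι : ℝ}

/-- The positive part of the difference between the two value estimates at step `h`. -/
noncomputable def valueGap (G : MarkovGame S A) (cce : CCESolver S A) (φ : S → S × A × A → E)
    (lam : ℝ) (β : ℕ → ℝ) (d : Data S A) (h t : ℕ) (x : S) : ℝ :=
  max ((valueEst G cce φ lam β d (G.H + 1 - h) t).1 x -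
    (valueEst G cce φ lam β d (G.H + 1 - h) t).2 x) 0

/-- The positive part of the difference between the two action-value estimates at step `h`. -/
noncomputable def actionGap (G : MarkovGame S A) (cce : CCESolver S A) (φ : S → S × A × A → E)
    (lam : ℝ) (β : ℕ → ℝ) (d : Data S A) (h t : ℕ) (z : S × A × A) : ℝ :=
  max (qUpper G cce φ lam β d h t z - qLower G cce φ lam β d h t z) 0

theorem valueGap_mem_Icc (h t : ℕ) (x : S) :
    valueGap G cce φ lam β d h t x ∈ Set.Icc (0 : ℝ) (2 * G.H) := by
  obtain ⟨h1, h2⟩ := valueEst_mem_Icc (G := G) (cce := cce) (φ := φ) (lam := lam) (β := β) d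
    (G.H + 1 - h) t x
  have : (0 : ℝ) ≤ G.H := Nat.cast_nonneg _
  exact ⟨le_max_right _ _, max_le (by linarith [h1.2, h2.1]) (by linarith)⟩

theorem actionGap_mem_Icc (h t : ℕ) (z : S × A × A) :
    actionGap G cce φ lam β d h t z ∈ Set.Icc (0 : ℝ) (2 * G.H) := by
  have h1 := qUpper_mem_Icc (G := G) (cce := cce) (φ := φ) (lam := lam) (β := β) (d := d) h t z
  have h2 := qLower_mem_Icc (G := G) (cce := cce) (φ := φ) (lam := lam) (β := β) (d := d) h t z
  have : (0 : ℝ) ≤ G.H := Nat.cast_nonneg _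
  exact ⟨le_max_right _ _, max_le (by linarith [h1.2, h2.1]) (by linarith)⟩

theorem abs_le_of_mem_Icc_zero {x b : ℝ} (h : x ∈ Set.Icc 0 b) : |x| ≤ b := by
  rw [abs_of_nonneg h.1]
  exact h.2

/-- The positive part is convex, so it passes inside the average. It also keeps the gaps in `[0, 2
H]`, the range used in the Azuma–Hoeffding bound. -/
theorem valueGap_le_expect_actionGap {h : ℕ} (hh : h ∈ Finset.Icc 1 G.H) (x : S) :
    valueGap G cce φ lam β d h t x ≤ expect (jointPolicy G cce φ lam β d t h x)
      (fun p => actionGap G cce φ lam β d h t (x, p)) := by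
  have hg : ∀ p, |actionGap G cce φ lam β d h t (x, p)| ≤ 2 * G.H := fun p =>
    abs_le_of_mem_Icc_zero (actionGap_mem_Icc h t (x, p))
  refine max_le ?_ ?_
  · rw [(valueEst_eq_expect hh x).1, (valueEst_eq_expect hh x).2,
      ← expect_sub (fun p => abs_le.2 (qUpper_mem_Icc h t (x, p)))
        (fun p => abs_le.2 (qLower_mem_Icc h t (x, p)))]
    exact expect_mono (C := G.H + G.H) (fun p => (abs_sub _ _).trans (add_le_add
      (abs_le.2 (qUpper_mem_Icc h t (x, p))) (abs_le.2 (qLower_mem_Icc h t (x, p))))) hg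
      fun p => le_max_left _ _
  · rw [← expect_const (jointPolicy G cce φ lam β d t h x) 0]
    exact expect_mono (fun _ => le_rfl) hg fun p => le_max_right _ _

/-- The truncated confidence width `min 1 ‖φ_{V^t}(z_h^t)‖_{Λ⁻¹}`. -/
noncomputable def width (φ : S → S × A × A → E) (lam : ℝ) (d : Data S A) (h : ℕ) (V : ℕ → S → ℝ)
    (t : ℕ) : ℝ :=
  min 1 (Real.sqrt (potential lam (regFeature φ d h V) (t - 1) (regFeature φ d h V t)))

theorem width_nonneg (h : ℕ) (V : ℕ → S → ℝ) : 0 ≤ width φ lam d h V t :=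
  le_min zero_le_one (Real.sqrt_nonneg _)

/-- The gap never exceeds `2 H ≤ 2 β t`, so truncating the widths at 1 is free. Without the
truncation the elliptical potential bound would depend on the size of the features, whose norms may
reach `H`. -/
theorem actionGap_le (hφ : BoundedFeatures φ) (hG : G.Misspecified φ θ B ι) (hι : 0 ≤ ι)
    (hl : 0 < lam) (hcov : Covered G cce φ lam β d θ t) (hβ : (G.H : ℝ) ≤ β t) {h : ℕ}
    (hh : h ∈ Finset.Icc 1 G.H) :
    actionGap G cce φ lam β d h t (d.z t h) ≤
      expect (G.P h (d.z t h)) (valueGap G cce φ lam β d (h + 1) t) + 2 * (G.H * ι) + 2 * β t *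
        (width φ lam d h (fun τ => (valueEst G cce φ lam β d (G.H - h) τ).1) t +
          width φ lam d h (fun τ => (valueEst G cce φ lam β d (G.H - h) τ).2) t) := by
  have hH : (0 : ℝ) < G.H := by exact_mod_cast G.one_le_H
  have hβ0 : 0 < β t := hH.trans_le hβ
  set z := d.z t h
  set V₁ := fun τ => (valueEst G cce φ lam β d (G.H - h) τ).1 with hV₁
  set V₂ := fun τ => (valueEst G cce φ lam β d (G.H - h) τ).2 with hV₂
  have hb₁ : ∀ s, V₁ t s ∈ Set.Icc (-(G.H : ℝ)) G.H := fun s => (valueEst_mem_Icc d _ t s).1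
  have hb₂ : ∀ s, V₂ t s ∈ Set.Icc (-(G.H : ℝ)) G.H := fun s => (valueEst_mem_Icc d _ t s).2
  have m₁ := abs_le.1 (hG.abs_expect_sub_inner_le hφ hh hH hb₁ z)
  have m₂ := abs_le.1 (hG.abs_expect_sub_inner_le hφ hh hH hb₂ z)
  have c₁ := (sSup_confRegion hl (hcov h hh).1 (featureOf φ (V₁ t) z)).2
  have c₂ := (sInf_confRegion hl (hcov h hh).2 (featureOf φ (V₂ t) z)).2
  have hgap : ∀ s, valueGap G cce φ lam β d (h + 1) t s ∈ Set.Icc (0 : ℝ) (2 * G.H) :=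
    fun s => valueGap_mem_Icc _ _ s
  have hP : expect (G.P h z) (V₁ t) - expect (G.P h z) (V₂ t) ≤
      expect (G.P h z) (valueGap G cce φ lam β d (h + 1) t) := by
    rw [← expect_sub (fun s => abs_le.2 (hb₁ s)) (fun s => abs_le.2 (hb₂ s))]
    refine expect_mono (C := G.H + G.H) (fun s => (abs_sub _ _).trans (add_le_add
      (abs_le.2 (hb₁ s)) (abs_le.2 (hb₂ s)))) (fun s => abs_le_of_mem_Icc_zero (hgap s))
      fun s => ?_
    have : G.H + 1 - (h + 1) = G.H - h := by omega
    rw [valueGap, this]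
    exact le_max_left _ _
  have hP0 := (expect_mem_Icc (p := G.P h z) hgap).1
  set g := expect (G.P h z) (valueGap G cce φ lam β d (h + 1) t)
  set s₁ := Real.sqrt (potential lam (regFeature φ d h V₁) (t - 1) (featureOf φ (V₁ t) z))
  set s₂ := Real.sqrt (potential lam (regFeature φ d h V₂) (t - 1) (featureOf φ (V₂ t) z))
  have hs₁ : 0 ≤ s₁ := Real.sqrt_nonneg _
  have hs₂ : 0 ≤ s₂ := Real.sqrt_nonneg _
  have hι' : 0 ≤ G.H * ι := by positivity
  have h1 : actionGap G cce φ lam β d h t z ≤ g + 2 * (G.H * ι) + 2 * β t * (s₁ + s₂) := by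
    refine max_le (clip_sub_clip_le _ (by positivity) ?_) (by positivity)
    linarith [m₁.1, m₁.2, m₂.1, m₂.2]
  have h2 := (actionGap_mem_Icc (G := G) (cce := cce) (φ := φ) (lam := lam) (β := β) (d := d)
    h t z).2
  have hw₁ : width φ lam d h V₁ t = min 1 s₁ := rfl
  have hw₂ : width φ lam d h V₂ t = min 1 s₂ := rfl
  rw [hw₁, hw₂]
  rcases le_total s₁ 1 with h3 | h3
  · rcases le_total s₂ 1 with h4 | h4
    · rwa [min_eq_right h3, min_eq_right h4]
    · rw [min_eq_right h3, min_eq_left h4]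
      nlinarith [mul_nonneg hβ0.le hs₁]
  · rw [min_eq_left h3]
    nlinarith [mul_nonneg hβ0.le (le_min zero_le_one hs₂ : (0 : ℝ) ≤ min 1 s₂)]

theorem valueGap_step (hφ : BoundedFeatures φ) (hG : G.Misspecified φ θ B ι) (hι : 0 ≤ ι)
    (hl : 0 < lam) (hcov : Covered G cce φ lam β d θ t) (hβ : (G.H : ℝ) ≤ β t) {h : ℕ}
    (hh : h ∈ Finset.Icc 1 G.H) :
    valueGap G cce φ lam β d h t (d.state t h) ≤
      valueGap G cce φ lam β d (h + 1) t (d.state t (h + 1)) +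
      (deviation G cce φ lam β d h (actionGap G cce φ lam β d h)
        (valueGap G cce φ lam β d (h + 1)) t + 2 * (G.H * ι) + 2 * β t *
        (width φ lam d h (fun τ => (valueEst G cce φ lam β d (G.H - h) τ).1) t +
          width φ lam d h (fun τ => (valueEst G cce φ lam β d (G.H - h) τ).2) t)) := by
  have h1 := valueGap_le_expect_actionGap (G := G) (cce := cce) (φ := φ) (lam := lam) (β := β)
    (d := d) (t := t) hh (d.state t h)
  have h2 := actionGap_le hφ hG hι hl hcov hβ hh
  rw [deviation]
  linarith

theorem le_sum_of_forall_le_add {n : ℕ} {g c : ℕ → ℝ} (h0 : g (n + 1) = 0)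
    (h : ∀ i ∈ Finset.Icc 1 n, g i ≤ g (i + 1) + c i) : g 1 ≤ ∑ i ∈ Finset.Icc 1 n, c i := by
  have key : ∀ m ≤ n, g 1 ≤ g (m + 1) + ∑ i ∈ Finset.Icc 1 m, c i := by
    intro m hm
    induction m with
    | zero => simp
    | succ m ih =>
      rw [Finset.sum_Icc_succ_top (by omega)]
      have := h (m + 1) (by simp only [Finset.mem_Icc]; omega)
      linarith [ih (by omega)]
  have := key n le_rfl
  rwa [h0, zero_add] at this

/-- Combine `min 1 w ≤ 2 w / (1 + w)` with `w / (1 + w) ≤ log (1 + w)`. -/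
theorem min_one_sqrt_sq_le {w : ℝ} (hw : 0 ≤ w) :
    min 1 (Real.sqrt w) ^ 2 ≤ 2 * Real.log (1 + w) := by
  have h1 := Real.one_sub_inv_le_log_of_pos (show 0 < 1 + w by positivity)
  have h2 : 1 - (1 + w)⁻¹ = w / (1 + w) := by field_simp; ring
  rw [h2] at h1
  refine le_trans ?_ (mul_le_mul_of_nonneg_left h1 zero_le_two)
  rw [← mul_div_assoc, le_div_iff₀ (by positivity)]
  have hs := Real.sq_sqrt hw
  rcases le_total (Real.sqrt w) 1 with h3 | h3
  · have h4 : w ≤ 1 := by nlinarith [Real.sqrt_nonneg w]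
    rw [min_eq_right h3, hs]
    nlinarith
  · rw [min_eq_left h3]
    nlinarith

/-- The elliptical potential bound. -/
theorem sum_width_le (hφ : BoundedFeatures φ) (hl : 0 < lam) (T h : ℕ) {V : ℕ → S → ℝ}
    (hV : ∀ τ s, V τ s ∈ Set.Icc (-(G.H : ℝ)) G.H) :
    ∑ t ∈ Finset.Icc 1 T, width φ lam d h V t ≤
      2 * Real.sqrt (T * effDim φ G.H T lam) := by
  have h1 : ∑ t ∈ Finset.Icc 1 T, width φ lam d h V t ^ 2 ≤ 4 * effDim φ G.H T lam := by
    have h2 := sum_log_one_add_potential_le hφ G.one_le_H T hl V hV (fun τ => d.z τ h)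
      (f := regFeature φ d h V) fun _ => rfl
    -- The reindexing lemma for products, read additively through `Multiplicative ℝ`.
    have h3 : ∀ F : ℕ → ℝ, ∑ t ∈ Finset.Icc 1 T, F t = ∑ i ∈ Finset.range T, F (i + 1) :=
      fun F => prod_Icc_one_eq_prod_range (M := Multiplicative ℝ) F T
    rw [h3]
    calc _ ≤ ∑ i ∈ Finset.range T, 2 * Real.log (1 + potential lam (regFeature φ d h V) i
          (regFeature φ d h V (i + 1))) := Finset.sum_le_sum fun i _ =>
            min_one_sqrt_sq_le (potential_nonneg hl _ _)
      _ ≤ _ := by rw [← Finset.mul_sum]; linarith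
  have h4 := sq_sum_le_card_mul_sum_sq (s := Finset.Icc 1 T) (f := width φ lam d h V)
  rw [Nat.card_Icc, Nat.add_sub_cancel] at h4
  have h5 : (∑ t ∈ Finset.Icc 1 T, width φ lam d h V t) ^ 2 ≤
      4 * (T * effDim φ G.H T lam) := by
    nlinarith [mul_le_mul_of_nonneg_left h1 (Nat.cast_nonneg (α := ℝ) T)]
  refine (Real.le_sqrt_of_sq_le h5).trans_eq ?_
  rw [Real.sqrt_mul (by norm_num), show (4 : ℝ) = 2 ^ 2 by norm_num, Real.sqrt_sq zero_le_two]

/-- The regret is at most the sum of the gaps between the two value estimates, up to the bias of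
the model. -/
theorem regret_le_sum_valueGap (hφ : BoundedFeatures φ) (hG : G.Misspecified φ θ B ι)
    (hι : 0 ≤ ι) (hl : 0 < lam) {T : ℕ}
    (hcov : ∀ t ∈ Finset.Icc 1 T, Covered G cce φ lam β d θ t) :
    regret G cce φ lam β d T ≤ ∑ t ∈ Finset.Icc 1 T,
      (valueGap G cce φ lam β d 1 t (d.state t 1) + 2 * (G.H * (G.H * ι))) := by
  refine Finset.sum_le_sum fun t ht => ?_
  have hA : Nonempty (Policy S A) := ⟨policyOne G cce φ lam β d t⟩
  have e1 : G.H + 1 - G.H = 1 := by omega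
  have h1 : G.valueMax (policyTwo G cce φ lam β d t) 1 (d.state t 1) ≤
      (valueEst G cce φ lam β d G.H t).1 (d.state t 1) + G.H * (G.H * ι) :=
    ciSup_le fun π => by
      have := value_le_valueEst hφ hG hι hl (hcov t ht) π G.H le_rfl (d.state t 1)
      rwa [e1] at this
  have h2 : (valueEst G cce φ lam β d G.H t).2 (d.state t 1) - G.H * (G.H * ι) ≤
      G.valueMin (policyOne G cce φ lam β d t) 1 (d.state t 1) :=
    le_ciInf fun ν => by
      have := valueEst_le_value hφ hG hι hl (hcov t ht) ν G.H le_rfl (d.state t 1)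
      rw [e1] at this
      linarith
  have h3 : (valueEst G cce φ lam β d G.H t).1 (d.state t 1) -
      (valueEst G cce φ lam β d G.H t).2 (d.state t 1) ≤
      valueGap G cce φ lam β d 1 t (d.state t 1) := le_max_left _ _
  linarith

theorem regret_le_of_covered (hφ : BoundedFeatures φ) (hG : G.Misspecified φ θ B ι)
    (hι : 0 ≤ ι) (hl : 0 < lam) {T : ℕ}
    (hcov : ∀ t ∈ Finset.Icc 1 T, Covered G cce φ lam β d θ t)
    (hβ : ∀ t ∈ Finset.Icc 1 T, (G.H : ℝ) ≤ β t ∧ β t ≤ β T) {R : ℝ}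
    (hdev : ∀ h ∈ Finset.Icc 1 G.H, ∑ t ∈ Finset.Icc 1 T, deviation G cce φ lam β d h
      (actionGap G cce φ lam β d h) (valueGap G cce φ lam β d (h + 1)) t ≤ R) :
    regret G cce φ lam β d T ≤ G.H * R + 4 * ((G.H : ℝ) ^ 2 * T * ι) +
      8 * (β T * G.H * Real.sqrt (T * effDim φ G.H T lam)) := by
  have hH : (0 : ℝ) < G.H := by exact_mod_cast G.one_le_H
  refine (regret_le_sum_valueGap hφ hG hι hl hcov).trans ?_
  rw [Finset.sum_add_distrib]
  set w₁ := fun h t => width φ lam d h (fun τ => (valueEst G cce φ lam β d (G.H - h) τ).1) t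
  set w₂ := fun h t => width φ lam d h (fun τ => (valueEst G cce φ lam β d (G.H - h) τ).2) t
  set dev := fun h t => deviation G cce φ lam β d h
      (actionGap G cce φ lam β d h) (valueGap G cce φ lam β d (h + 1)) t
  have h1 : ∀ t ∈ Finset.Icc 1 T, valueGap G cce φ lam β d 1 t (d.state t 1) ≤
      ∑ h ∈ Finset.Icc 1 G.H, (dev h t + 2 * (G.H * ι) + 2 * β T * (w₁ h t + w₂ h t)) := by
    intro t ht
    refine le_sum_of_forall_le_add
      (g := fun h => valueGap G cce φ lam β d h t (d.state t h)) (by simp [valueGap, valueEst])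
      fun h hh => (valueGap_step hφ hG hι hl (hcov t ht) (hβ t ht).1 hh).trans ?_
    have hw : 0 ≤ w₁ h t + w₂ h t := add_nonneg (width_nonneg _ _) (width_nonneg _ _)
    have := mul_le_mul_of_nonneg_right (hβ t ht).2 hw
    simp only [w₁, w₂, dev] at this ⊢
    linarith
  have h2 : ∀ h ∈ Finset.Icc 1 G.H,
      ∑ t ∈ Finset.Icc 1 T, (dev h t + 2 * (G.H * ι) + 2 * β T * (w₁ h t + w₂ h t)) ≤
      R + T * (2 * (G.H * ι)) + 8 * (β T * Real.sqrt (T * effDim φ G.H T lam)) := by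
    intro h hh
    have hs₁ : ∑ t ∈ Finset.Icc 1 T, w₁ h t ≤ 2 * Real.sqrt (T * effDim φ G.H T lam) :=
      sum_width_le hφ hl T h fun τ s => (valueEst_mem_Icc d _ τ s).1
    have hs₂ : ∑ t ∈ Finset.Icc 1 T, w₂ h t ≤ 2 * Real.sqrt (T * effDim φ G.H T lam) :=
      sum_width_le hφ hl T h fun τ s => (valueEst_mem_Icc d _ τ s).2
    rw [Finset.sum_add_distrib, Finset.sum_add_distrib,
      ← Finset.mul_sum _ (fun t => w₁ h t + w₂ h t), Finset.sum_add_distrib]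
    rcases Nat.eq_zero_or_pos T with rfl | hT
    · have := hdev h hh
      simp only [Finset.Icc_eq_empty (show ¬ 1 ≤ 0 by norm_num), Finset.sum_empty] at this ⊢
      simp [this]
    have hβT : 0 ≤ β T := hH.le.trans (hβ T (by simp only [Finset.mem_Icc]; omega)).1
    have h3 := mul_le_mul_of_nonneg_left (add_le_add hs₁ hs₂) hβT
    have h4 : ∑ t ∈ Finset.Icc 1 T, dev h t ≤ R := hdev h hh
    simp only [Finset.sum_const, Nat.card_Icc, Nat.add_sub_cancel, nsmul_eq_mul]
    linarith
  have h3 := Finset.sum_le_sum h1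
  rw [Finset.sum_comm] at h3
  have h4 := h3.trans (Finset.sum_le_sum h2)
  simp only [Finset.sum_const, Nat.card_Icc, Nat.add_sub_cancel, nsmul_eq_mul] at h4 ⊢
  linarith

theorem regret_le_trivial (T : ℕ) : regret G cce φ lam β d T ≤ 2 * (G.H * T) := by
  have key : ∀ t ∈ Finset.Icc 1 T, G.valueMax (policyTwo G cce φ lam β d t) 1 (d.state t 1) -
      G.valueMin (policyOne G cce φ lam β d t) 1 (d.state t 1) ≤ 2 * G.H := fun t _ => by
    have hA : Nonempty (Policy S A) := ⟨policyOne G cce φ lam β d t⟩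
    have h1 : G.valueMax (policyTwo G cce φ lam β d t) 1 (d.state t 1) ≤ G.H :=
      ciSup_le fun π => (abs_le.1 (G.abs_value_le _ _ le_rfl (by omega) _)).2
    have h2 : -(G.H : ℝ) ≤ G.valueMin (policyOne G cce φ lam β d t) 1 (d.state t 1) :=
      le_ciInf fun ν => (abs_le.1 (G.abs_value_le _ _ le_rfl (by omega) _)).1
    linarith
  refine (Finset.sum_le_sum key).trans_eq ?_
  simp
  ring

end Gap

/-! ### Lower bound on the effective dimension and the union bound -/

section Regime

variable {S A E : Type*} [NormedAddCommGroup E] [InnerProductSpace ℝ E] {φ : S → S × A × A → E}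
  {G : MarkovGame S A} {cce : CCESolver S A} {lam : ℝ} {β : ℕ → ℝ} {d : Data S A}
  {θ : ℕ → E} {B ι : ℝ}

theorem effDim_nonneg (hφ : BoundedFeatures φ) {H : ℕ} (hH : 1 ≤ H) (T : ℕ) (hl : 0 < lam)
    (z : S × A × A) : 0 ≤ effDim φ H T lam := by
  refine le_trans ?_ (effDim_ge hφ hH T hl z)
  exact mul_nonneg (by norm_num) (Real.log_nonneg (le_add_of_nonneg_right (by positivity)))

/-- If the misspecification is small and the horizon of learning is long compared with the norm
bound, then the effective dimension dominates the logarithm of the planning horizon. -/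
theorem log_le_effDim (hφ : BoundedFeatures φ) (hG : G.Misspecified φ θ B ι) {T : ℕ}
    (hl : 0 < lam) (hl2 : lam ≤ 2) (z : S × A × A) (hι : ι < 1 / 4)
    (hT : 75 * B ^ 2 * effDim φ G.H T lam < T) :
    1 / 2 ≤ effDim φ G.H T lam ∧ Real.log (3 * G.H) ≤ effDim φ G.H T lam := by
  have hH1 : (1 : ℝ) ≤ G.H := by exact_mod_cast G.one_le_H
  have h1mem : 1 ∈ Finset.Icc 1 G.H := by simpa using G.one_le_H
  set Γ := effDim φ G.H T lam
  have hΓ0 : 0 ≤ Γ := effDim_nonneg hφ G.one_le_H T hl z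
  set N := ‖featureOf φ (fun _ => 1) z‖ with hN
  have hN0 : 0 ≤ N := norm_nonneg _
  -- A transition law has mass 1, and the linear model reproduces this mass up to `ι < 1/4` through
  -- an inner product of size at most `N B`.
  have hNB : 3 / 4 ≤ N * B := by
    have h1 := hG.abs_expect_sub_inner_le hφ h1mem one_pos (V := fun _ => (1 : ℝ))
      (fun _ => by simp) z
    rw [expect_const] at h1
    have h2 := real_inner_le_norm (featureOf φ (fun _ => 1) z) (θ 1)
    have h3 := mul_le_mul_of_nonneg_left (hG 1 h1mem).1 hN0
    linarith [(abs_le.1 h1).2]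
  have hT0 : (0 : ℝ) < T := by
    have : 0 ≤ 75 * B ^ 2 * Γ := by positivity
    linarith
  have hB0 : 0 < B := by
    by_contra h
    nlinarith
  set X := T * (lam⁻¹ * (G.H * N) ^ 2) with hX
  have hX0 : 0 ≤ X := by positivity
  have hlog : Real.log (1 + X) ≤ 2 * Γ := by
    have := effDim_ge hφ G.one_le_H T hl z
    linarith
  have hexp : 1 + X ≤ Real.exp (2 * Γ) := by
    rwa [← Real.log_le_iff_le_exp (by positivity)]
  have hlinv : 1 / 2 ≤ lam⁻¹ := by
    rw [one_div]
    exact inv_anti₀ hl hl2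
  have hXB : 9 / 32 * (G.H : ℝ) ^ 2 * T ≤ X * B ^ 2 := by
    have h1 : 9 / 16 ≤ (N * B) ^ 2 := by nlinarith
    have h2 : X * B ^ 2 = T * (G.H : ℝ) ^ 2 * (lam⁻¹ * (N * B) ^ 2) := by
      rw [hX]
      ring
    rw [h2]
    have h3 : 1 / 2 * (9 / 16) ≤ lam⁻¹ * (N * B) ^ 2 :=
      mul_le_mul hlinv h1 (by norm_num) (by positivity)
    have h4 := mul_le_mul_of_nonneg_left h3 (by positivity : 0 ≤ T * (G.H : ℝ) ^ 2)
    linarith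
  have hXpos : 0 < X := by
    have h1 : 0 < X * B ^ 2 := lt_of_lt_of_le (by positivity) hXB
    exact pos_of_mul_pos_left h1 (by positivity)
  have hΓpos : 0 < Γ := by
    have := Real.log_pos (by linarith : 1 < 1 + X)
    linarith
  -- The constant 75 enters here: `75 · 9 / 32 > 21`.
  have hXΓ : 21 * Γ * (G.H : ℝ) ^ 2 ≤ X := by
    have h1 : 21 * Γ * (G.H : ℝ) ^ 2 * B ^ 2 ≤ X * B ^ 2 := by
      have h2 := mul_le_mul_of_nonneg_left hT.le (by positivity : 0 ≤ 9 / 32 * (G.H : ℝ) ^ 2)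
      have h3 : 0 ≤ Γ * (G.H : ℝ) ^ 2 * B ^ 2 := by positivity
      nlinarith
    exact le_of_mul_le_mul_right h1 (by positivity)
  have hH2 : (1 : ℝ) ≤ (G.H : ℝ) ^ 2 := by nlinarith
  -- If `2 Γ < 1` then `exp (2 Γ) - 1 ≤ 4 Γ`, which is incompatible with `X ≥ 21 Γ`.
  have hhalf : 1 / 2 ≤ Γ := by
    by_contra hlt
    push Not at hlt
    have h1 := Real.abs_exp_sub_one_le (x := 2 * Γ) (by rw [abs_of_pos (by linarith)]; linarith)
    rw [abs_of_pos (by linarith : 0 < 2 * Γ)] at h1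
    have h2 := (abs_le.1 h1).2
    nlinarith
  refine ⟨hhalf, ?_⟩
  -- Now `X ≥ (21 / 2) H²`, more than the required `9 H²`.
  have h1 : (3 * (G.H : ℝ)) ^ 2 ≤ Real.exp (2 * Γ) := by nlinarith
  have h2 := (Real.log_le_iff_le_exp (by positivity)).2 h1
  rw [Real.log_pow] at h2
  push_cast at h2
  linarith

theorem potential_smul {f : ℕ → E} (n : ℕ) (c : ℝ) (x : E) :
    potential lam f n (c • x) = c ^ 2 * potential lam f n x := by
  simp only [potential, map_smul, inner_smul_left, inner_smul_right, conj_trivial]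
  ring

theorem mem_confRegion_of_potential_le (hφ : BoundedFeatures φ) (hG : G.Misspecified φ θ B ι)
    (hl : 0 < lam) {h : ℕ} (hh : h ∈ Finset.Icc 1 G.H) {V : ℕ → S → ℝ}
    (hV : ∀ τ s, V τ s ∈ Set.Icc (-(G.H : ℝ)) G.H) {t : ℕ} {M b : ℝ}
    (hpot : potential lam (regFeature φ d h V) (t - 1) (∑ i ∈ Finset.Icc 1 (t - 1),
      noise G d h V i • regFeature φ d h V i) ≤ M) (hb0 : 0 ≤ b)
    (hb : 3 * (lam * B ^ 2 + (G.H : ℝ) ^ 2 * M + t * (G.H * ι) ^ 2) ≤ b ^ 2) :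
    θ h ∈ confRegion φ lam d h V t b := by
  have hH : (0 : ℝ) < G.H := by exact_mod_cast G.one_le_H
  rw [mem_confRegion_iff, Real.sqrt_le_left hb0]
  refine (energy_sub_ridge_le hl t (θ h) (fun τ => expect (G.P h (d.z τ h)) (V τ))
    (M := G.H * ι) fun τ => hG.abs_expect_sub_inner_le hφ hh hH (hV τ) _).trans (le_trans ?_ hb)
  have h1 : ∑ τ ∈ Finset.Icc 1 (t - 1), (V τ (d.state τ (h + 1)) -
      expect (G.P h (d.z τ h)) (V τ)) • regFeature φ d h V τ = (G.H : ℝ) •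
      ∑ i ∈ Finset.Icc 1 (t - 1), noise G d h V i • regFeature φ d h V i := by
    rw [Finset.smul_sum]
    refine Finset.sum_congr rfl fun i _ => ?_
    rw [smul_smul, noise, mul_div_cancel₀ _ hH.ne']
  rw [h1, potential_smul]
  have h2 : ‖θ h‖ ^ 2 ≤ B ^ 2 := pow_le_pow_left₀ (norm_nonneg _) (hG h hh).1 2
  have h3 : ((t - 1 : ℕ) : ℝ) ≤ t := by exact_mod_cast Nat.sub_le t 1
  have h4 := mul_le_mul_of_nonneg_left h2 hl.le
  have h5 := mul_le_mul_of_nonneg_left hpot (sq_nonneg (G.H : ℝ))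
  have h6 := mul_le_mul_of_nonneg_right h3 (sq_nonneg (G.H * ι))
  linarith

variable {Ω : Type*} [MeasurableSpace Ω] {μ : MeasureTheory.Measure Ω}
  [MeasureTheory.IsProbabilityMeasure μ] [Countable S] [Finite A]
  {T : ℕ} {D : Ω → Data S A}

/-- With probability at least `1 - 3 H exp (-L)`, all responses and action draws are well
concentrated; the bad event is given as a set of small measure. -/
theorem IsRun.exists_bad_event (hrun : IsRun μ G cce φ lam β T D) (hφ : BoundedFeatures φ)
    (hl : 0 < lam) (L s : ℝ) : ∃ bad : Set Ω, μ.real bad ≤ 3 * G.H * Real.exp (-L) ∧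
      ∀ ω ∉ bad, ∀ h ∈ Finset.Icc 1 G.H,
        (∀ n ≤ T, potential lam (regFeature φ (D ω) h
            (fun τ => (valueEst G cce φ lam β (D ω) (G.H - h) τ).1)) n
            (∑ i ∈ Finset.Icc 1 n,
              noise G (D ω) h (fun τ => (valueEst G cce φ lam β (D ω) (G.H - h) τ).1) i •
              regFeature φ (D ω) h (fun τ => (valueEst G cce φ lam β (D ω) (G.H - h) τ).1) i) ≤
          2 * L + 2 * effDim φ G.H T lam) ∧
        (∀ n ≤ T, potential lam (regFeature φ (D ω) h
            (fun τ => (valueEst G cce φ lam β (D ω) (G.H - h) τ).2)) n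
            (∑ i ∈ Finset.Icc 1 n,
              noise G (D ω) h (fun τ => (valueEst G cce φ lam β (D ω) (G.H - h) τ).2) i •
              regFeature φ (D ω) h (fun τ => (valueEst G cce φ lam β (D ω) (G.H - h) τ).2) i) ≤
          2 * L + 2 * effDim φ G.H T lam) ∧
        s * ∑ t ∈ Finset.Icc 1 T, deviation G cce φ lam β (D ω) h
          (actionGap G cce φ lam β (D ω) h) (valueGap G cce φ lam β (D ω) (h + 1)) t ≤
          L + T * (s ^ 2 * (G.H : ℝ) ^ 2) := by
  let V₁ : ℕ → Data S A → ℕ → S → ℝ := fun h d τ => (valueEst G cce φ lam β d (G.H - h) τ).1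
  let V₂ : ℕ → Data S A → ℕ → S → ℝ := fun h d τ => (valueEst G cce φ lam β d (G.H - h) τ).2
  let bad₁ : ℕ → Set Ω := fun h => {ω | ∃ n ≤ T, 2 * L + 2 * effDim φ G.H T lam ≤
      potential lam (regFeature φ (D ω) h (V₁ h (D ω))) n (∑ i ∈ Finset.Icc 1 n,
        noise G (D ω) h (V₁ h (D ω)) i • regFeature φ (D ω) h (V₁ h (D ω)) i)}
  let bad₂ : ℕ → Set Ω := fun h => {ω | ∃ n ≤ T, 2 * L + 2 * effDim φ G.H T lam ≤
      potential lam (regFeature φ (D ω) h (V₂ h (D ω))) n (∑ i ∈ Finset.Icc 1 n,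
        noise G (D ω) h (V₂ h (D ω)) i • regFeature φ (D ω) h (V₂ h (D ω)) i)}
  let bad₃ : ℕ → Set Ω := fun h => {ω | L + T * (s ^ 2 * (G.H : ℝ) ^ 2) ≤
      s * ∑ t ∈ Finset.Icc 1 T, deviation G cce φ lam β (D ω) h
          (actionGap G cce φ lam β (D ω) h) (valueGap G cce φ lam β (D ω) (h + 1)) t}
  have toReal : ∀ s : Set Ω, μ s ≤ ENNReal.ofReal (Real.exp (-L)) → μ.real s ≤ Real.exp (-L) :=
    fun s hs => ENNReal.toReal_le_of_le_ofReal (Real.exp_pos _).le hs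
  have hb₁ : ∀ h ∈ Finset.Icc 1 G.H, μ.real (bad₁ h) ≤ Real.exp (-L) := fun h hh =>
    toReal _ (hrun.measure_potential_noise_le hφ hl hh
      (fun t d d' hd τ hτ => by simp only [hd.valueEst_eq (Nat.sub_le _ _) hτ])
      (fun d τ x => (valueEst_mem_Icc d _ τ x).1) L)
  have hb₂ : ∀ h ∈ Finset.Icc 1 G.H, μ.real (bad₂ h) ≤ Real.exp (-L) := fun h hh =>
    toReal _ (hrun.measure_potential_noise_le hφ hl hh
      (fun t d d' hd τ hτ => by simp only [hd.valueEst_eq (Nat.sub_le _ _) hτ])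
      (fun d τ x => (valueEst_mem_Icc d _ τ x).2) L)
  have hb₃ : ∀ h ∈ Finset.Icc 1 G.H, μ.real (bad₃ h) ≤ Real.exp (-L) := fun h hh =>
    toReal _ (hrun.measure_sum_deviation_ge_le hh
      (Q := fun d => actionGap G cce φ lam β d h) (U := fun d => valueGap G cce φ lam β d (h + 1))
      (fun t d d' hd => by
        funext z
        simp only [actionGap, hd.qUpper_eq hh, hd.qLower_eq hh])
      (fun t d d' hd => by
        funext x
        simp only [valueGap, hd.valueEst_eq (show G.H + 1 - (h + 1) ≤ G.H by omega) le_rfl])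
      (fun d t z => actionGap_mem_Icc h t z) (fun d t x => valueGap_mem_Icc (h + 1) t x) L s)
  refine ⟨⋃ h ∈ Finset.Icc 1 G.H, (bad₁ h ∪ bad₂ h ∪ bad₃ h), ?_, ?_⟩
  · refine (MeasureTheory.measureReal_biUnion_finset_le _ _).trans ?_
    calc _ ≤ ∑ _h ∈ Finset.Icc 1 G.H, 3 * Real.exp (-L) := by
          refine Finset.sum_le_sum fun h hh => ?_
          have h1 := MeasureTheory.measureReal_union_le (μ := μ) (bad₁ h ∪ bad₂ h) (bad₃ h)
          have h2 := MeasureTheory.measureReal_union_le (μ := μ) (bad₁ h) (bad₂ h)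
          linarith [hb₁ h hh, hb₂ h hh, hb₃ h hh]
      _ = _ := by
          simp
          ring
  · intro ω hω h hh
    have hω' : ω ∉ bad₁ h ∪ bad₂ h ∪ bad₃ h := fun hmem =>
      hω (Set.mem_biUnion (t := fun h => bad₁ h ∪ bad₂ h ∪ bad₃ h) hh hmem)
    have h1 : ω ∉ bad₁ h := fun hmem => hω' (Or.inl (Or.inl hmem))
    have h2 : ω ∉ bad₂ h := fun hmem => hω' (Or.inl (Or.inr hmem))
    have h3 : ω ∉ bad₃ h := fun hmem => hω' (Or.inr hmem)
    exact ⟨fun n hn => le_of_lt (not_le.1 fun hle => h1 ⟨n, hn, hle⟩),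
      fun n hn => le_of_lt (not_le.1 fun hle => h2 ⟨n, hn, hle⟩), le_of_lt (not_le.1 h3)⟩

end Regime

end KernelMG

/-! ### Choice of regime and parameters, conclusion -/

theorem mainTheorem3 :
    ∃ c : ℝ, 0 < c ∧
      ∀ (S A : Type*) [Countable S] [Finite A]
        (E : Type*) [NormedAddCommGroup E] [InnerProductSpace ℝ E] [CompleteSpace E]
        (G : KernelMG.MarkovGame S A) (cce : KernelMG.CCESolver S A)
        (φ : S → S × A × A → E) (_ : KernelMG.BoundedFeatures φ)
        (θ : ℕ → E) (B ι : ℝ) (_ : 0 < ι) (_ : G.Misspecified φ θ B ι)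
        (T : ℕ) (_ : 1 ≤ T) (lam : ℝ) (_ : lam = 1 + 1 / (T : ℝ))
        (δ : ℝ) (_ : 0 < δ)
        (β : ℕ → ℝ) (_ : ∀ t ∈ Finset.Icc 1 T, 0 < β t ∧ β t ≤ β T)
        (_ : ∀ t ∈ Finset.Icc 1 T,
          12 * KernelMG.effDim φ G.H T lam + 3 + 6 * Real.log (1 / δ)
              + 3 * lam * (B / (G.H : ℝ)) ^ 2 + 3 * ι ^ 2 * (t : ℝ)
            ≤ (β t / (G.H : ℝ)) ^ 2)
        (Ω : Type*) [MeasurableSpace Ω] (μ : MeasureTheory.Measure Ω)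
        [MeasureTheory.IsProbabilityMeasure μ] (D : Ω → KernelMG.Data S A)
        (_ : KernelMG.IsRun μ G cce φ lam β T D),
        1 - δ ≤ μ.real {ω | KernelMG.regret G cce φ lam β (D ω) T ≤
          c * (β T * (G.H : ℝ) * Real.sqrt ((T : ℝ) * KernelMG.effDim φ G.H T lam)
            + 1 + (G.H : ℝ) ^ 2 * (T : ℝ) * ι)} := by
  -- In the main regime 8 comes from the confidence widths and 2 from the martingale part; the
  -- trivial regimes are cut so as to fit the same constant.
  refine ⟨10, by norm_num, ?_⟩
  intro S A _ _ E _ _ _ G cce φ hφ θ B ι hι hG T hT lam hlam δ hδ β hβ hβ2 Ω _ μ _ D hrun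
  rcases le_or_gt 1 δ with hδ1 | hδ1
  · exact (sub_nonpos.2 hδ1).trans MeasureTheory.measureReal_nonneg
  have hH1 : (1 : ℝ) ≤ G.H := by exact_mod_cast G.one_le_H
  have hT1 : (1 : ℝ) ≤ T := by exact_mod_cast hT
  have hTmem : T ∈ Finset.Icc 1 T := Finset.mem_Icc.2 ⟨hT, le_rfl⟩
  have hl : 0 < lam := by rw [hlam]; positivity
  have hl2 : lam ≤ 2 := by
    have : 1 / (T : ℝ) ≤ 1 := by rw [div_le_one (by positivity)]; exact hT1
    linarith
  have hne : Nonempty Ω := μ.nonempty_of_neZero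
  have z : S × A × A := (D hne.some).z 1 1
  set Γ := KernelMG.effDim φ G.H T lam
  have hΓ0 : 0 ≤ Γ := KernelMG.effDim_nonneg hφ G.one_le_H T hl z
  have hlogδ : 0 ≤ Real.log (1 / δ) := Real.log_nonneg (by rw [le_div_iff₀ hδ]; linarith)
  have hβT0 : 0 < β T := (hβ T hTmem).1
  have hHT : 2 * (G.H * T : ℝ) ≤ 10 * (β T * G.H * Real.sqrt (T * Γ) + 1 + (G.H : ℝ) ^ 2 * T * ι) →
      1 - δ ≤ μ.real {ω | KernelMG.regret G cce φ lam β (D ω) T ≤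
        10 * (β T * G.H * Real.sqrt (T * Γ) + 1 + (G.H : ℝ) ^ 2 * T * ι)} := fun h => by
    have huniv : {ω | KernelMG.regret G cce φ lam β (D ω) T ≤
        10 * (β T * G.H * Real.sqrt (T * Γ) + 1 + (G.H : ℝ) ^ 2 * T * ι)} = Set.univ :=
      Set.eq_univ_of_forall fun ω => (KernelMG.regret_le_trivial T).trans h
    rw [huniv, MeasureTheory.probReal_univ]
    linarith
  have hsqrt0 : 0 ≤ β T * G.H * Real.sqrt (T * Γ) := by positivity
  rcases le_or_gt (1 / 4) ι with hι4 | hι4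
  · refine hHT ?_
    have h1 : (G.H : ℝ) * T * (1 * (1 / 4)) ≤ G.H * T * (G.H * ι) := by gcongr
    nlinarith
  -- Here `T / 5 ≤ β_T √(T Γ)`, so `2 H T` is at most ten times the main term.
  rcases le_or_gt (T : ℝ) (25 * (β T ^ 2 * Γ)) with hreg | hreg
  · refine hHT ?_
    have h1 : (T : ℝ) / 5 ≤ β T * Real.sqrt (T * Γ) := by
      refine (Real.le_sqrt_of_sq_le (y := β T ^ 2 * (T * Γ)) ?_).trans_eq ?_
      · nlinarith
      · rw [Real.sqrt_mul (sq_nonneg _), Real.sqrt_sq hβT0.le]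
    have h2 := mul_le_mul_of_nonneg_left h1 (by positivity : (0 : ℝ) ≤ G.H)
    have h3 : 0 ≤ (G.H : ℝ) ^ 2 * T * ι := by positivity
    linarith
  have hβsq : ∀ t ∈ Finset.Icc 1 T, (G.H : ℝ) ^ 2 * (12 * Γ + 3 + 6 * Real.log (1 / δ)) +
      3 * lam * B ^ 2 + 3 * ι ^ 2 * t * (G.H : ℝ) ^ 2 ≤ β t ^ 2 := fun t ht => by
    have h1 := mul_le_mul_of_nonneg_left (hβ2 t ht) (sq_nonneg (G.H : ℝ))
    have h2 : (G.H : ℝ) ^ 2 * (β t / G.H) ^ 2 = β t ^ 2 := by field_simp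
    have h3 : (G.H : ℝ) ^ 2 * (B / G.H) ^ 2 = B ^ 2 := by field_simp
    rw [h2] at h1
    linear_combination h1 - 3 * lam * h3
  have hβH : ∀ t ∈ Finset.Icc 1 T, (G.H : ℝ) ≤ β t := fun t ht => by
    refine le_of_sq_le_sq ?_ (hβ t ht).1.le
    have h1 := hβsq t ht
    have h2 : 0 ≤ 3 * lam * B ^ 2 + 3 * ι ^ 2 * t * (G.H : ℝ) ^ 2 := by positivity
    have h3 : 0 ≤ (G.H : ℝ) ^ 2 * (12 * Γ + 2 + 6 * Real.log (1 / δ)) := by positivity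
    linarith
  -- The radius condition contains `3 lam B²` with `lam ≥ 1`, and `75 = 25 · 3`.
  have hB75 : 75 * B ^ 2 * Γ < T := by
    refine lt_of_le_of_lt ?_ hreg
    have h1 : 3 * B ^ 2 ≤ β T ^ 2 := by
      have h1 := hβsq T hTmem
      have h2 : 0 ≤ (G.H : ℝ) ^ 2 * (12 * Γ + 3 + 6 * Real.log (1 / δ)) +
        3 * ι ^ 2 * T * (G.H : ℝ) ^ 2 := by positivity
      have h3 : 1 ≤ lam := by rw [hlam]; exact le_add_of_nonneg_right (by positivity)
      nlinarith [sq_nonneg B]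
    nlinarith
  obtain ⟨hΓhalf, hΓlog⟩ := KernelMG.log_le_effDim hφ hG hl hl2 z hι4 hB75
  -- Chosen so that `exp (-L) = δ / (3 H)`: three bad events at each of the `H` steps.
  set L := Real.log (3 * G.H) + Real.log (1 / δ) with hL
  have hL0 : 0 < L := add_pos_of_pos_of_nonneg (Real.log_pos (by linarith)) hlogδ
  have hexpL : 3 * G.H * Real.exp (-L) = δ := by
    rw [hL, neg_add, Real.exp_add, Real.exp_neg, Real.exp_log (by positivity), one_div,
      Real.log_inv, neg_neg, Real.exp_log hδ]
    field_simp
  -- At `s = r / H` the two terms `L` and `T s² H²` of the Azuma–Hoeffding bound are equal.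
  set r := Real.sqrt (L / T) with hr
  have hr0 : 0 < r := Real.sqrt_pos.2 (by positivity)
  have hr2 : r ^ 2 * T = L := by
    rw [hr, Real.sq_sqrt (by positivity)]
    field_simp
  obtain ⟨bad, hbad, hgood⟩ := hrun.exists_bad_event hφ hl L (r / G.H)
  rw [hexpL] at hbad
  have hsub : badᶜ ⊆ {ω | KernelMG.regret G cce φ lam β (D ω) T ≤
      10 * (β T * G.H * Real.sqrt (T * Γ) + 1 + (G.H : ℝ) ^ 2 * T * ι)} := by
    intro ω hω
    have hg := hgood ω hω
    have hcov : ∀ t ∈ Finset.Icc 1 T, KernelMG.Covered G cce φ lam β (D ω) θ t := by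
      intro t ht h hh
      -- The coefficient `12 Γ` is used up here: `6 Γ` for the determinant and `6 log (3 H) ≤ 6 Γ`
      -- for the union bound.
      have hb : 3 * (lam * B ^ 2 + (G.H : ℝ) ^ 2 * (2 * L + 2 * Γ) + t * (G.H * ι) ^ 2) ≤
          β t ^ 2 := by
        have h1 := hβsq t ht
        have h2 : (G.H : ℝ) ^ 2 * Real.log (3 * G.H) ≤ (G.H : ℝ) ^ 2 * Γ := by gcongr
        nlinarith [sq_nonneg (G.H : ℝ)]
      have htT : t - 1 ≤ T := (Nat.sub_le _ _).trans (Finset.mem_Icc.1 ht).2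
      exact ⟨KernelMG.mem_confRegion_of_potential_le hφ hG hl hh
          (fun τ x => (KernelMG.valueEst_mem_Icc _ _ τ x).1) ((hg h hh).1 _ htT)
          (hβ t ht).1.le hb,
        KernelMG.mem_confRegion_of_potential_le hφ hG hl hh
          (fun τ x => (KernelMG.valueEst_mem_Icc _ _ τ x).2) ((hg h hh).2.1 _ htT)
          (hβ t ht).1.le hb⟩
    have hdev : ∀ h ∈ Finset.Icc 1 G.H, ∑ t ∈ Finset.Icc 1 T,
        KernelMG.deviation G cce φ lam β (D ω) h (KernelMG.actionGap G cce φ lam β (D ω) h)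
          (KernelMG.valueGap G cce φ lam β (D ω) (h + 1)) t ≤ 2 * G.H * T * r := by
      intro h hh
      have h1 := (hg h hh).2.2
      have h2 : L + T * ((r / G.H) ^ 2 * (G.H : ℝ) ^ 2) = r / G.H * (2 * G.H * T * r) := by
        rw [← hr2]
        field_simp
        ring
      rw [h2] at h1
      exact le_of_mul_le_mul_left h1 (by positivity)
    have hreg := KernelMG.regret_le_of_covered hφ hG hι.le hl hcov
      (fun t ht => ⟨hβH t ht, (hβ t ht).2⟩) hdev
    -- Because `Γ ≥ 1/2` and `log (3 H) ≤ Γ`, one has `L ≤ (12 Γ + 6 log (1 / δ)) Γ`, so the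
    -- martingale part is no larger than the width part.
    have hmart : G.H * T * r ≤ β T * Real.sqrt (T * Γ) := by
      refine (Real.le_sqrt_of_sq_le (y := β T ^ 2 * (T * Γ)) ?_).trans_eq ?_
      · have h1 : (G.H : ℝ) ^ 2 * L ≤ β T ^ 2 * Γ := by
          have h2 : (G.H : ℝ) ^ 2 * (12 * Γ + 6 * Real.log (1 / δ)) ≤ β T ^ 2 := by
            have h3 : 0 ≤ 3 * (G.H : ℝ) ^ 2 + 3 * lam * B ^ 2 + 3 * ι ^ 2 * T * (G.H : ℝ) ^ 2 := by
              positivity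
            linarith [hβsq T hTmem]
          have h4 : L ≤ (12 * Γ + 6 * Real.log (1 / δ)) * Γ := by nlinarith
          have h5 := mul_le_mul_of_nonneg_right h2 hΓ0
          have h6 := mul_le_mul_of_nonneg_left h4 (sq_nonneg (G.H : ℝ))
          linarith
        have h7 := mul_le_mul_of_nonneg_right h1 (by positivity : (0 : ℝ) ≤ T)
        have h8 : (G.H * T * r) ^ 2 = (G.H : ℝ) ^ 2 * L * T := by
          rw [← hr2]
          ring
        linarith
      · rw [Real.sqrt_mul (sq_nonneg _), Real.sqrt_sq hβT0.le]
    have h1 := mul_le_mul_of_nonneg_left hmart (by positivity : (0 : ℝ) ≤ G.H)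
    have h2 : 0 ≤ (G.H : ℝ) ^ 2 * T * ι := by positivity
    change KernelMG.regret G cce φ lam β (D ω) T ≤ _
    linarith
  -- Neither the bad event nor the regret event has been shown measurable; only subadditivity and
  -- monotonicity of the outer measure enter.
  have huniv : (1 : ℝ) ≤ μ.real (bad ∪ badᶜ) := by
    rw [Set.union_compl_self, MeasureTheory.probReal_univ]
  have h1 := MeasureTheory.measureReal_union_le (μ := μ) bad badᶜ
  have h2 := MeasureTheory.measureReal_mono (μ := μ) hsub
  linarith
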